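/- Let $(M,\omega)$ be a compact symplectic manifold of dimension $2n$ with a prequantization bundle $L\to M$, i.e. a Hermitian line bundle with a Hermitian connection of curvature $\frac1i\omega$. Let $\mathcal J$ be the space of smooth almost complex structures $j$ of $M$ compatible with $\omega$ and positive: $\omega(jX,jY)=\omega(X,Y)$ and $\omega(X,jX)>0$ for $X\neq 0$. A map defined on $\mathcal J$ is called smooth if it sends families in $\mathcal J$ with parameter in an open subset of some $\mathbb R^m$, smooth jointly in the parameter and in the point of $M$, to families which are smooth in the same sense. For $j_a,j_b\in\mathcal J$ let $\Psi_{j_a,j_b}:\Lambda^{n,0}_{j_a}T^*M\to\Lambda^{n,0}_{j_b}T^*M$ be the bundle isomorphism such that $\Psi_{j_a,j_b}(\alpha)\wedge\bar\beta=\alpha\wedge\bar\beta$ for all $\alpha,\beta\in\Lambda^{n,0}_{j_a}T^*M$. Let $\delta\to M$ be a complex line bundle with, for each $j\in\mathcal J$, an isomorphism $\varphi_j:\delta^2\to\Lambda^{n,0}_jT^*M$ depending smoothly on $j$, so that $(\delta,\varphi_j)$ is a half-form bundle of $(M,j)$. Write $\delta_j$ for $\delta$ endowed with the Hermitian structure for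 which $\varphi_j$ is an isomorphism of Hermitian bundles, where $(\alpha,\beta)=i^{n(2-n)}\alpha\wedge\bar\beta/\omega^n$ on $\Lambda^{n,0}_jT^*M$. A half-form bundle morphism $(\delta,\varphi_{j_a})\to(\delta,\varphi_{j_b})$ is a line bundle isomorphism $\Psi$ such that $\varphi_{j_b}\circ\Psi^2=\Psi_{j_a,j_b}\circ\varphi_{j_a}$. For an integer $k\ge 0$, let $\mathcal P^m_k\to\mathcal J$ be the bundle whose fiber $\mathcal P^m_{k,j}$ at $j$ is the space of smooth sections of $L^k\otimes\delta_j$, with the scalar product $(\Phi,\Phi')_j=\int_M(\Phi(x),\Phi'(x))_{L^k\otimes\delta_j}\,\frac{\omega^n}{n!}(x)$. For $\eta\in T_{j_0}\mathcal J$ and $\Phi$ a smooth section of $\mathcal P^m_k$, set $$\nabla_\eta\Phi\,(j_0)=\frac{d}{dt}\Big|_{t=0}\Psi_t^{-1}.\Phi(j_t),$$ where $(j_t)$ is a smooth curve of $\mathcal J$ starting at $j_0$ and tangent to $\eta$ at $t=0$, and $\Psi_t:(\delta,\varphi_{j_0})\to(\delta,\varphi_{j_t})$ is the continuous family of half-form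 bundle morphisms with $\Psi_0=\mathrm{id}$. The same formula defines the covariant derivative of a family $\Phi(t)\in\mathcal P^m_{k,j_t}$ along a curve $(j_t)$. Identify $T_j\mathcal J$ with a space of sections of $\operatorname{Hom}(\Lambda^{1,0}_jT^*M,\Lambda^{0,1}_jT^*M)$, by representing $\Lambda^{1,0}_{j'}T^*M$, for $j'$ close to $j$, as the graph of a section of this bundle and differentiating at $j'=j$; for $\mu\in T_j\mathcal J$ let $\bar\mu:\Lambda^{0,1}_jT^*M\to\Lambda^{1,0}_jT^*M$ be its complex conjugate. Then: 1. $\nabla_\eta\Phi\,(j_0)$ is a well-defined element of $\mathcal P^m_{k,j_0}$, which does not depend on the choice of the curve $(j_t)$. 2. $\nabla$ is compatible with the Hermitian structure: for all smooth sections $\Phi,\Phi'$ of $\mathcal P^m_k$, all $j\in\mathcal J$ and all $\eta\in T_j\mathcal J$, the derivative of $(\Phi,\Phi')$ at $j$ in the direction $\eta$ is $(\nabla_\eta\Phi,\Phi'(j))_j+(\Phi(j),\nabla_\eta\Phi')_j$. 3. The curvature of $\nabla$ at $\eta,\mu\in T_j\mathcal J$ is the multiplication by a function on $M$: $$R(\eta,\mu)\Phi=\tfrac12\operatorname{tr}(\eta\bar\mu-\mu\bar\eta)\,\Phi,\qquad\Phi\in\mathcal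 P^m_{k,j}.$$ Here $R(\eta,\mu)\Phi$ is the value at $(0,0)$ of $\nabla_s\nabla_t\Phi-\nabla_t\nabla_s\Phi$ for any smooth family $j_{s,t}\in\mathcal J$, $(s,t)\in\mathbb R^2$, with $j_{0,0}=j$, $\partial_sj=\eta$ and $\partial_tj=\mu$ at $(0,0)$, and any smooth family $\Phi(s,t)\in\mathcal P^m_{k,j_{s,t}}$ with $\Phi(0,0)=\Phi$; such families exist, and these covariant derivatives are well defined and smooth. -/

import Mathlib

open scoped Manifold ContDiff TensorProduct
open Bundle

noncomputable section

namespace HalfForm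

/-! ### Linear algebra of compatible complex structures -/

section LinearAlgebra

variable {E : Type*} [AddCommGroup E] [Module ℝ E]

/-- Complex conjugate of a complex valued real linear form. -/
def conj₁ (α : E →ₗ[ℝ] ℂ) : E →ₗ[ℝ] ℂ := Complex.conjAe.toLinearMap ∘ₗ α

/-- Complex conjugate of a complex valued alternating form. -/
def conjN {n : ℕ} (α : E [⋀^Fin n]→ₗ[ℝ] ℂ) : E [⋀^Fin n]→ₗ[ℝ] ℂ :=
  Complex.conjAe.toLinearMap.compAlternatingMap α

/-- The space `Λ^{1,0}_J E^*` of complex valued forms `α` with `α ∘ J = i α`. -/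
def form10 (J : E →ₗ[ℝ] E) : Submodule ℂ (E →ₗ[ℝ] ℂ) where
  carrier := {α | ∀ v, α (J v) = Complex.I * α v}
  zero_mem' := fun v => by simp
  add_mem' := fun {a b} ha hb v => by
    simp only [LinearMap.add_apply, ha v, hb v]; ring
  smul_mem' := fun c a ha v => by
    simp only [LinearMap.smul_apply, ha v, smul_eq_mul]; ring

/-- The space `Λ^{0,1}_J E^*` of complex valued forms `α` with `α ∘ J = - i α`. -/
def form01 (J : E →ₗ[ℝ] E) : Submodule ℂ (E →ₗ[ℝ] ℂ) where
  carrier := {α | ∀ v, α (J v) = -Complex.I * α v}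
  zero_mem' := fun v => by simp
  add_mem' := fun {a b} ha hb v => by
    simp only [LinearMap.add_apply, ha v, hb v]; ring
  smul_mem' := fun c a ha v => by
    simp only [LinearMap.smul_apply, ha v, smul_eq_mul]; ring

/-- The space `Λ^{n,0}_J E^*`: the complex valued alternating `n`-forms that are complex linear in
each variable for the complex structure `J`. -/
def formN0 (n : ℕ) (J : E →ₗ[ℝ] E) : Submodule ℂ (E [⋀^Fin n]→ₗ[ℝ] ℂ) where
  carrier := {α | ∀ (v : Fin n → E) (i : Fin n),
    α (Function.update v i (J (v i))) = Complex.I * α v}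
  zero_mem' := fun v i => by simp
  add_mem' := fun {a b} ha hb v i => by
    simp only [AlternatingMap.add_apply, ha v i, hb v i]; ring
  smul_mem' := fun c a ha v i => by
    simp only [AlternatingMap.smul_apply, ha v i, smul_eq_mul]; ring

/-- The wedge product of two `n`-forms (sum over shuffles). -/
def wedge {n : ℕ} (α β : E [⋀^Fin n]→ₗ[ℝ] ℂ) : E [⋀^(Fin n ⊕ Fin n)]→ₗ[ℝ] ℂ :=
  (LinearMap.mul' ℝ ℂ).compAlternatingMap (α.domCoprod β)

/-- The index identification `(0, …, n-1, 0', …, (n-1)') ↦ (0, …, 2n-1)`. -/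
def topEquiv (n : ℕ) : Fin n ⊕ Fin n ≃ Fin (2 * n) :=
  finSumFinEquiv.trans (finCongr (two_mul n).symm)

/-- The value of the `2n`-form `Ω^n = Ω ∧ … ∧ Ω` on `2n` vectors. -/
def omegaPow (n : ℕ) (Ω : E → E → ℝ) (v : Fin (2 * n) → E) : ℝ :=
  (1 / 2 ^ n : ℝ) * ∑ σ : Equiv.Perm (Fin (2 * n)), ((Equiv.Perm.sign σ : ℤ) : ℝ) *
    ∏ i : Fin n, Ω (v (σ ⟨2 * i, by omega⟩)) (v (σ ⟨2 * i + 1, by omega⟩))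

/-- The scalar product `i^{n(2-n)} α ∧ β̄ / Ω^n` on `n`-forms of type `(n,0)`. The quotient of the
two forms of top degree is computed on a basis `e` of `E`, and does not depend on it. -/
def formInner (n : ℕ) (Ω : E → E → ℝ) (e : Fin (2 * n) → E)
    (α β : E [⋀^Fin n]→ₗ[ℝ] ℂ) : ℂ :=
  Complex.I ^ ((n : ℤ) * (2 - n)) * wedge α (conjN β) (fun i => e (topEquiv n i)) /
    (omegaPow n Ω e : ℂ)

/-- Let `A` be a tangent vector at `J` to the space of complex structures, so that `A J = - J A`.
The space `Λ^{1,0}` of a nearby structure is the graph of a map `Λ^{1,0}_J → Λ^{0,1}_J`, and the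
derivative of this map in the direction `A` is `α ↦ (1 / 2i) α ∘ A`: see `graph_derivative`. -/
def graphMap (J A : E →ₗ[ℝ] E) (hA : ∀ v, A (J v) = -J (A v)) :
    form10 J →ₗ[ℂ] form01 J where
  toFun α := ⟨(1 / (2 * Complex.I)) • ((α : E →ₗ[ℝ] ℂ) ∘ₗ A), fun v => by
    have h := α.2 (A v)
    simp only [LinearMap.smul_apply, LinearMap.comp_apply, hA v, map_neg, smul_eq_mul]
    rw [h]; ring⟩
  map_add' α β := by
    ext v; simp; ring
  map_smul' c α := by
    ext v; simp; ring

/-- Complex conjugation `Λ^{0,1}_J → Λ^{1,0}_J`. -/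
def conj01 {J : E →ₗ[ℝ] E} (β : form01 J) : form10 J :=
  ⟨conj₁ β, fun v => by have h := β.2 v; simp [conj₁, h]⟩

/-- The conjugate `μ̄ : Λ^{0,1}_J → Λ^{1,0}_J`, `μ̄ β = conj (μ (conj β))`, of a linear map
`μ : Λ^{1,0}_J → Λ^{0,1}_J`. -/
def barMap {J : E →ₗ[ℝ] E} (μ : form10 J →ₗ[ℂ] form01 J) : form01 J →ₗ[ℂ] form10 J where
  toFun β := conj01 (μ (conj01 β))
  map_add' β γ := by
    have h : conj01 (β + γ) = conj01 β + conj01 γ := by ext v; simp [conj01, conj₁]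
    rw [h, map_add]; ext v; simp [conj01, conj₁]
  map_smul' c β := by
    have h : conj01 (c • β) = (starRingEnd ℂ c) • conj01 β := by ext v; simp [conj01, conj₁]
    rw [h, map_smul]; ext v; simp [conj01, conj₁]

/-- `½ tr (η μ̄ - μ η̄)`, the trace being taken on `Λ^{0,1}_J`. -/
def halfTrace {J : E →ₗ[ℝ] E} (η μ : form10 J →ₗ[ℂ] form01 J) : ℂ :=
  (1 / 2) * LinearMap.trace ℂ (form01 J) (η ∘ₗ barMap μ - μ ∘ₗ barMap η)

/-- The linear form `a^{⊗ k} ⊗ b` on `A^{⊗ k} ⊗ B`. -/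
def tensorFunctional {A B : Type*} [AddCommGroup A] [Module ℂ A] [AddCommGroup B] [Module ℂ B]
    (k : ℕ) (a : A →ₗ[ℂ] ℂ) (b : B →ₗ[ℂ] ℂ) : (⨂[ℂ]^k A) ⊗[ℂ] B →ₗ[ℂ] ℂ :=
  LinearMap.mul' ℂ ℂ ∘ₗ TensorProduct.map
    (PiTensorProduct.lift
      ((MultilinearMap.mkPiAlgebra ℂ (Fin k) ℂ).compLinearMap fun _ => a)) b

/-- Derivative of a curve in a finite dimensional complex vector space (tested on all linear
forms). -/
def HasVecDerivAt {V : Type*} [AddCommGroup V] [Module ℂ V] (f : ℝ → V) (v : V) (t : ℝ) : Prop :=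
  ∀ l : V →ₗ[ℂ] ℂ, HasDerivAt (fun s => l (f s)) (l v) t

end LinearAlgebra

/-- `graphMap` is the derivative of the graph parametrization: if `J t` is a curve of linear maps
with `J 0 = J₀` and velocity `A`, and the graph of `μ t : Λ^{1,0}_{J₀} → Λ^{0,1}_{J₀}` is contained
in `Λ^{1,0}_{J t}`, then the derivative of `μ` at `0` is `graphMap J₀ A`. -/
theorem graph_derivative {E : Type*} [NormedAddCommGroup E] [NormedSpace ℝ E]
    [FiniteDimensional ℝ E] (J : ℝ → E →L[ℝ] E) (A J₀ : E →L[ℝ] E) (h0 : J 0 = J₀)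
    (hJ : HasDerivAt J A 0) (hA : ∀ v, A (J₀ v) = -J₀ (A v))
    (μ : ℝ → form10 (J₀ : E →ₗ[ℝ] E) →ₗ[ℂ] form01 (J₀ : E →ₗ[ℝ] E))
    (hμ : ∀ t (α : form10 (J₀ : E →ₗ[ℝ] E)), (α : E →ₗ[ℝ] ℂ) + (μ t α : E →ₗ[ℝ] ℂ) ∈ form10 (J t : E →ₗ[ℝ] E))
    (μ' : form10 (J₀ : E →ₗ[ℝ] E) →ₗ[ℂ] form01 (J₀ : E →ₗ[ℝ] E))
    (hμ' : ∀ α, HasDerivAt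
      (fun t => LinearMap.toContinuousLinearMap (μ t α : E →ₗ[ℝ] ℂ))
      (LinearMap.toContinuousLinearMap (μ' α : E →ₗ[ℝ] ℂ)) 0) :
    μ' = graphMap (J₀ : E →ₗ[ℝ] E) (A : E →ₗ[ℝ] E) hA := by
  ext α v
  have hz : (μ 0 α : E →ₗ[ℝ] ℂ) = 0 := by
    ext w
    have h1 := hμ 0 α w
    have h2 := α.2 w
    have h3 := (μ 0 α).2 w
    simp only [h0, LinearMap.add_apply] at h1
    rw [h2, h3] at h1
    have h4 : 2 * Complex.I * (μ 0 α : E →ₗ[ℝ] ℂ) w = 0 := by linear_combination -h1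
    simpa using h4
  have hv : HasDerivAt (fun t => J t v) (A v) 0 := by
    simpa using hJ.clm_apply (hasDerivAt_const (0 : ℝ) v)
  have e1 : HasDerivAt (fun t => (α : E →ₗ[ℝ] ℂ) (J t v)) ((α : E →ₗ[ℝ] ℂ) (A v)) 0 :=
    ((LinearMap.toContinuousLinearMap (α : E →ₗ[ℝ] ℂ)).hasFDerivAt.comp_hasDerivAt
      (0 : ℝ) hv)
  have e2 := (hμ' α).clm_apply hv
  have e3 := (hμ' α).clm_apply (hasDerivAt_const (0 : ℝ) v)
  have e4 := ((e3.const_add ((α : E →ₗ[ℝ] ℂ) v)).const_mul Complex.I)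
  have e5 := e1.add e2
  have hfun : (fun t => (α : E →ₗ[ℝ] ℂ) (J t v)) +
      (fun t => (LinearMap.toContinuousLinearMap (μ t α : E →ₗ[ℝ] ℂ)) (J t v)) =
      fun t => Complex.I * ((α : E →ₗ[ℝ] ℂ) v +
        (LinearMap.toContinuousLinearMap (μ t α : E →ₗ[ℝ] ℂ)) v) := by
    funext t
    simpa using hμ t α v
  rw [hfun] at e5
  have h6 := e5.unique e4
  have h7 := (μ' α).2 v
  simp only [h0, LinearMap.coe_toContinuousLinearMap', hz, map_zero,
    add_zero] at h6
  simp only [ContinuousLinearMap.coe_coe] at h7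
  have h8 : (0 : E →L[ℝ] ℂ) (A v) = 0 := rfl
  rw [h7] at h6
  simp only [graphMap, LinearMap.coe_mk, AddHom.coe_mk, LinearMap.smul_apply,
    LinearMap.comp_apply, ContinuousLinearMap.coe_coe, smul_eq_mul]
  have hI : Complex.I ≠ 0 := Complex.I_ne_zero
  field_simp
  linear_combination -h6 + h8

/-! ### Symplectic manifolds and compatible almost complex structures -/

/-- The model space of a `2n`-dimensional manifold. -/
abbrev Mod (n : ℕ) : Type := EuclideanSpace ℝ (Fin (2 * n))

section Manifold

variable {n : ℕ} {M : Type*} [TopologicalSpace M] [ChartedSpace (Mod n) M]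
  [IsManifold (𝓡 (2 * n)) ∞ M]

/-- The tangent space of `M` at `x`. -/
abbrev Tan (n : ℕ) {M : Type*} [TopologicalSpace M] [ChartedSpace (Mod n) M] (x : M) : Type :=
  TangentSpace (𝓡 (2 * n)) x

/-- The coordinate vector field with constant component `v` in the chart at `x₀`. -/
def coordVec (x₀ : M) (v : Mod n) (x : M) : Tan n x :=
  (trivializationAt (Mod n) (TangentSpace (𝓡 (2 * n)) : M → Type) x₀).symmL ℝ x v

variable (n M) in
/-- A symplectic form on `M`: a smooth, alternating, non-degenerate and closed 2-form.
Closedness is expressed in the charts of `M`. -/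
structure SymplecticForm where
  form : ∀ x : M, Tan n x →L[ℝ] Tan n x →L[ℝ] ℝ
  smooth : ContMDiff (𝓡 (2 * n)) ((𝓡 (2 * n)).prod 𝓘(ℝ, Mod n →L[ℝ] Mod n →L[ℝ] ℝ)) ∞
    (fun x => (TotalSpace.mk' (Mod n →L[ℝ] Mod n →L[ℝ] ℝ) x (form x) :
      TotalSpace (Mod n →L[ℝ] Mod n →L[ℝ] ℝ) (fun x : M => Tan n x →L[ℝ] Tan n x →L[ℝ] ℝ)))
  alternating : ∀ x v, form x v v = 0
  nondegenerate : ∀ x v, (∀ w, form x v w = 0) → v = 0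
  closed : ∀ x₀ : M, ∀ y ∈ (extChartAt (𝓡 (2 * n)) x₀).target, ∀ u v w : Mod n,
    let f : Mod n → Mod n → Mod n → ℝ := fun a b z =>
      form ((extChartAt (𝓡 (2 * n)) x₀).symm z)
        (coordVec x₀ a ((extChartAt (𝓡 (2 * n)) x₀).symm z))
        (coordVec x₀ b ((extChartAt (𝓡 (2 * n)) x₀).symm z))
    fderiv ℝ (f v w) y u + fderiv ℝ (f w u) y v + fderiv ℝ (f u v) y w = 0

/-- The space `𝒥` of (smooth) almost complex structures of `M` that are compatible with `Ω` and
positive. -/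
structure ACS (Ω : SymplecticForm n M) where
  J : ∀ x : M, Tan n x →L[ℝ] Tan n x
  smooth : ContMDiff (𝓡 (2 * n)) ((𝓡 (2 * n)).prod 𝓘(ℝ, Mod n →L[ℝ] Mod n)) ∞
    (fun x => (TotalSpace.mk' (Mod n →L[ℝ] Mod n) x (J x) :
      TotalSpace (Mod n →L[ℝ] Mod n) (fun x : M => Tan n x →L[ℝ] Tan n x)))
  sq : ∀ x v, J x (J x v) = -v
  compatible : ∀ x v w, Ω.form x (J x v) (J x w) = Ω.form x v w
  positive : ∀ x v, v ≠ 0 → 0 < Ω.form x v (J x v)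

variable {Ω : SymplecticForm n M}

/-- The complex structure of `T_x M` as a linear map. -/
def ACS.lin (j : ACS Ω) (x : M) : Tan n x →ₗ[ℝ] Tan n x := (j.J x).toLinearMap

/-- A family of elements of `𝒥` with parameter `w` in an open subset `U` of a finite dimensional
space is smooth when it is smooth jointly in the parameter and in the point of `M`. -/
def IsSmoothFamily {W : Type*} [NormedAddCommGroup W] [NormedSpace ℝ W] (U : Set W)
    (p : W → ACS Ω) : Prop :=
  ContMDiffOn (𝓘(ℝ, W).prod (𝓡 (2 * n))) ((𝓡 (2 * n)).prod 𝓘(ℝ, Mod n →L[ℝ] Mod n)) ∞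
    (fun z : W × M => (TotalSpace.mk' (Mod n →L[ℝ] Mod n) z.2 ((p z.1).J z.2) :
      TotalSpace (Mod n →L[ℝ] Mod n) (fun x : M => Tan n x →L[ℝ] Tan n x)))
    (U ×ˢ Set.univ)

/-- The tangent space `T_j 𝒥`: smooth fields of endomorphisms `A` with `A j + j A = 0` and
`Ω(A·,·) + Ω(·,A·) = 0`. -/
structure TangentACS (j : ACS Ω) where
  A : ∀ x : M, Tan n x →L[ℝ] Tan n x
  smooth : ContMDiff (𝓡 (2 * n)) ((𝓡 (2 * n)).prod 𝓘(ℝ, Mod n →L[ℝ] Mod n)) ∞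
    (fun x => (TotalSpace.mk' (Mod n →L[ℝ] Mod n) x (A x) :
      TotalSpace (Mod n →L[ℝ] Mod n) (fun x : M => Tan n x →L[ℝ] Tan n x)))
  anti : ∀ x v, A x (j.J x v) = -j.J x (A x v)
  symplectic : ∀ x v w, Ω.form x (A x v) w + Ω.form x v (A x w) = 0

/-- The tangent vector `η ∈ T_j 𝒥` seen as a section of `Hom(Λ^{1,0}_j T^*M, Λ^{0,1}_j T^*M)`,
through the representation of `Λ^{1,0}` of the structures near `j` as graphs over `Λ^{1,0}_j`. -/
def TangentACS.toHom {j : ACS Ω} (η : TangentACS j) (x : M) :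
    form10 (j.lin x) →ₗ[ℂ] form01 (j.lin x) :=
  graphMap (j.lin x) (η.A x).toLinearMap (η.anti x)

/-- The curve `γ` of `𝒥` passes through `j` at time `0` with velocity `η`. -/
def HasVelocity (γ : ℝ → ACS Ω) {j : ACS Ω} (η : TangentACS j) : Prop :=
  γ 0 = j ∧ ∀ x v, HasDerivAt (fun t => (γ t).J x v) (η.A x v) 0

/-- The derivative at `j` of the function `f` on `𝒥` in the direction `η` is `c`: this is the
derivative of `f` along every smooth curve tangent to `η`. -/
def HasDirDeriv (f : ACS Ω → ℂ) {j : ACS Ω} (η : TangentACS j) (c : ℂ) : Prop :=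
  ∀ γ : ℝ → ACS Ω, IsSmoothFamily Set.univ γ → HasVelocity γ η →
    HasDerivAt (fun t => f (γ t)) c 0

/-- A choice of a smooth partition of unity subordinate to the charts of `M`. -/
def partition [CompactSpace M] [T2Space M] :
    SmoothPartitionOfUnity M (𝓡 (2 * n)) M Set.univ :=
  Classical.choose
    (SmoothPartitionOfUnity.exists_isSubordinate_chartAt_source (I := 𝓡 (2 * n)) (M := M))

/-- The Liouville measure of `M`, defined by the volume form `Ω^n / n!`: in a chart with coordinate
vector fields `∂_1, …, ∂_{2n}` it has the density `|Ω^n (∂_1, …, ∂_{2n})| / n!` with respect to the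
Lebesgue measure, and these local expressions are glued with a partition of unity. -/
def liouville [CompactSpace M] [T2Space M] [MeasurableSpace M] (Ω : SymplecticForm n M) :
    MeasureTheory.Measure M :=
  MeasureTheory.Measure.sum fun i : M =>
    (((MeasureTheory.volume : MeasureTheory.Measure (Mod n)).restrict
        (extChartAt (𝓡 (2 * n)) i).target).withDensity
      (fun y : Mod n =>
        let x : M := (extChartAt (𝓡 (2 * n)) i).symm y
        ENNReal.ofReal ((partition (n := n) (M := M) i x) *
          (|omegaPow n (fun v w : Tan n x => Ω.form x v w)
            (fun a => coordVec i (EuclideanSpace.single a 1) x)| / (n.factorial : ℝ))))).map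
      (extChartAt (𝓡 (2 * n)) i).symm

/-! ### Complex line bundles -/

section LineBundle

variable (L : M → Type*) [TopologicalSpace (TotalSpace ℂ L)] [∀ x, AddCommGroup (L x)]
  [∀ x, Module ℂ (L x)] [∀ x, TopologicalSpace (L x)] [FiberBundle ℂ L] [VectorBundle ℂ ℂ L]

/-- The domain of the local frame `frame L x₀`. -/
abbrev dom (x₀ : M) : Set M := (trivializationAt ℂ L x₀).baseSet

/-- The local frame of the line bundle given by its trivialization at `x₀`. -/
def frame (x₀ x : M) : L x := (trivializationAt ℂ L x₀).symm x 1

/-- The coordinate in the frame `frame L x₀`. -/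
def coord (x₀ x : M) : L x →ₗ[ℂ] ℂ := (trivializationAt ℂ L x₀).linearMapAt ℂ x

/-- A smooth Hermitian metric, linear in the first variable. -/
structure HermitianMetric where
  inner : ∀ x : M, L x →ₗ[ℂ] L x →ₗ⋆[ℂ] ℂ
  symm : ∀ x u v, inner x v u = starRingEnd ℂ (inner x u v)
  positive : ∀ x u, u ≠ 0 → 0 < (inner x u u).re
  smooth : ∀ x₀ : M, ContMDiffOn (𝓡 (2 * n)) 𝓘(ℝ, ℂ) ∞
    (fun x => inner x (frame L x₀ x) (frame L x₀ x)) (dom L x₀)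

/-- A prequantization bundle structure on the complex line bundle `L`: a Hermitian metric and a
smooth connection, complex linear and compatible with the metric, of curvature `Ω / i`. -/
structure Prequantization [∀ x, IsTopologicalAddGroup (L x)] [∀ x, ContinuousSMul ℝ (L x)]
    [VectorBundle ℝ ℂ L] [ContMDiffVectorBundle ∞ ℂ L (𝓡 (2 * n))]
    (Ω : SymplecticForm n M) where
  metric : HermitianMetric (n := n) L
  nabla : CovariantDerivative (𝓡 (2 * n)) ℂ L
  smooth : ∀ s : ∀ x : M, L x,
    ContMDiff (𝓡 (2 * n)) ((𝓡 (2 * n)).prod 𝓘(ℝ, ℂ)) ∞ (fun x => TotalSpace.mk' ℂ x (s x)) →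
    ∀ X : ∀ x : M, Tan n x,
    ContMDiff (𝓡 (2 * n)) ((𝓡 (2 * n)).prod 𝓘(ℝ, Mod n)) ∞
      (fun x => (TotalSpace.mk' (Mod n) x (X x) : TangentBundle (𝓡 (2 * n)) M)) →
    ContMDiff (𝓡 (2 * n)) ((𝓡 (2 * n)).prod 𝓘(ℝ, ℂ)) ∞
      (fun x => TotalSpace.mk' ℂ x (nabla s x (X x)))
  complex_linear : ∀ s : ∀ x : M, L x,
    ContMDiff (𝓡 (2 * n)) ((𝓡 (2 * n)).prod 𝓘(ℝ, ℂ)) ∞ (fun x => TotalSpace.mk' ℂ x (s x)) →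
    ∀ x v, nabla (fun y => Complex.I • s y) x v = Complex.I • nabla s x v
  hermitian : ∀ s s' : ∀ x : M, L x,
    ContMDiff (𝓡 (2 * n)) ((𝓡 (2 * n)).prod 𝓘(ℝ, ℂ)) ∞ (fun x => TotalSpace.mk' ℂ x (s x)) →
    ContMDiff (𝓡 (2 * n)) ((𝓡 (2 * n)).prod 𝓘(ℝ, ℂ)) ∞ (fun x => TotalSpace.mk' ℂ x (s' x)) →
    ∀ x (v : Tan n x),
      mfderiv (𝓡 (2 * n)) 𝓘(ℝ, ℂ) (fun y => metric.inner y (s y) (s' y)) x v =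
        metric.inner x (nabla s x v) (s' x) + metric.inner x (s x) (nabla s' x v)
  curvature : ∀ s : ∀ x : M, L x,
    ContMDiff (𝓡 (2 * n)) ((𝓡 (2 * n)).prod 𝓘(ℝ, ℂ)) ∞ (fun x => TotalSpace.mk' ℂ x (s x)) →
    ∀ X Y : ∀ x : M, Tan n x,
    ContMDiff (𝓡 (2 * n)) ((𝓡 (2 * n)).prod 𝓘(ℝ, Mod n)) ∞
      (fun x => (TotalSpace.mk' (Mod n) x (X x) : TangentBundle (𝓡 (2 * n)) M)) →
    ContMDiff (𝓡 (2 * n)) ((𝓡 (2 * n)).prod 𝓘(ℝ, Mod n)) ∞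
      (fun x => (TotalSpace.mk' (Mod n) x (Y x) : TangentBundle (𝓡 (2 * n)) M)) →
    ∀ x, nabla (fun y => nabla s y (Y y)) x (X x) - nabla (fun y => nabla s y (X y)) x (Y x) -
        nabla s x (VectorField.mlieBracket (𝓡 (2 * n)) X Y x) =
      ((1 / Complex.I) * (Ω.form x (X x) (Y x) : ℂ)) • s x

end LineBundle

/-! ### Half-form bundles -/

section HalfFormBundle

variable (Ω) (δ : M → Type*) [TopologicalSpace (TotalSpace ℂ δ)] [∀ x, AddCommGroup (δ x)]
  [∀ x, Module ℂ (δ x)] [∀ x, TopologicalSpace (δ x)] [FiberBundle ℂ δ] [VectorBundle ℂ ℂ δ]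

/-- A smooth family `((δ_j, φ_j), j ∈ 𝒥)` of half-form bundles, with a fixed line bundle `δ_j = δ`
and an isomorphism `φ_j : δ² → Λ^{n,0}_j T^*M` which depends smoothly on `j`. -/
structure HalfFormFamily where
  φ : ∀ (j : ACS Ω) (x : M), (δ x ⊗[ℂ] δ x) ≃ₗ[ℂ] formN0 n (j.lin x)
  smooth : ∀ (m : ℕ) (U : Set (EuclideanSpace ℝ (Fin m))), IsOpen U →
    ∀ p : EuclideanSpace ℝ (Fin m) → ACS Ω, IsSmoothFamily U p →
    ∀ (x₀ : M) (v : Fin n → Mod n),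
      ContMDiffOn (𝓘(ℝ, EuclideanSpace ℝ (Fin m)).prod (𝓡 (2 * n))) 𝓘(ℝ, ℂ) ∞
        (fun z : EuclideanSpace ℝ (Fin m) × M =>
          (φ (p z.1) z.2 (frame δ x₀ z.2 ⊗ₜ[ℂ] frame δ x₀ z.2) :
            Tan n z.2 [⋀^Fin n]→ₗ[ℝ] ℂ) (fun i => coordVec x₀ (v i) z.2))
        (U ×ˢ (dom δ x₀ ∩ (chartAt (Mod n) x₀).source))

variable {Ω δ}

namespace HalfFormFamily

variable (F : HalfFormFamily Ω δ)

/-- `φ_j (u ⊗ v)` as an alternating form on `T_x M`. -/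
def form (j : ACS Ω) (x : M) (u v : δ x) : Tan n x [⋀^Fin n]→ₗ[ℝ] ℂ := F.φ j x (u ⊗ₜ[ℂ] v)

/-- Half-form bundle morphisms `(j_a, δ, φ_{j_a}) → (j_b, δ, φ_{j_b})`: the smooth isomorphisms of
line bundles `Ψ` such that `φ_{j_b} ∘ Ψ² = Ψ_{j_a,j_b} ∘ φ_{j_a}`, where
`Ψ_{j_a,j_b} : Λ^{n,0}_{j_a} → Λ^{n,0}_{j_b}` is characterized by
`Ψ_{j_a,j_b}(α) ∧ β̄ = α ∧ β̄` for all `α, β ∈ Λ^{n,0}_{j_a}`. -/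
structure IsMorphism (ja jb : ACS Ω) (Ψ : ∀ x : M, δ x ≃ₗ[ℂ] δ x) : Prop where
  smooth : ∀ x₀ : M, ContMDiffOn (𝓡 (2 * n)) 𝓘(ℝ, ℂ) ∞
    (fun x => coord δ x₀ x (Ψ x (frame δ x₀ x))) (dom δ x₀)
  compat : ∀ (x : M) (u v : δ x), ∀ β ∈ formN0 n (ja.lin x),
    wedge (F.form jb x (Ψ x u) (Ψ x v)) (conjN β) = wedge (F.form ja x u v) (conjN β)

/-- `(Ψ_t)` is the continuous family of half-form bundle morphisms
`(δ, φ_{γ(t₀)}) → (δ, φ_{γ(t)})` such that `Ψ_{t₀}` is the identity of `δ`. -/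
structure IsMorphismFamily (γ : ℝ → ACS Ω) (t₀ : ℝ) (Ψ : ℝ → ∀ x : M, δ x ≃ₗ[ℂ] δ x) :
    Prop where
  morphism : ∀ t, F.IsMorphism (γ t₀) (γ t) (Ψ t)
  continuous : ∀ x₀ : M, ContinuousOn
    (fun z : ℝ × M => coord δ x₀ z.2 (Ψ z.1 z.2 (frame δ x₀ z.2))) (Set.univ ×ˢ dom δ x₀)
  initial : ∀ x u, Ψ t₀ x u = u

/-- The Hermitian norm of `δ` for which `φ_j : δ² → Λ^{n,0}_j T^*M` is an isomorphism of Hermitian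
bundles: `|u|² = ‖φ_j(u ⊗ u)‖`. This is `|u|²`. -/
def normSq (j : ACS Ω) (x : M) (u : δ x) : ℝ :=
  Real.sqrt (formInner n (fun v w : Tan n x => Ω.form x v w)
    (fun a => (EuclideanSpace.single a (1 : ℝ) : Mod n)) (F.form j x u u) (F.form j x u u)).re

end HalfFormFamily

end HalfFormBundle

/-! ### Prequantum spaces and their connection -/

section Prequantum

variable (k : ℕ)
  (L : M → Type*) [TopologicalSpace (TotalSpace ℂ L)] [∀ x, AddCommGroup (L x)]
  [∀ x, Module ℂ (L x)] [∀ x, TopologicalSpace (L x)] [FiberBundle ℂ L] [VectorBundle ℂ ℂ L]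
  (δ : M → Type*) [TopologicalSpace (TotalSpace ℂ δ)] [∀ x, AddCommGroup (δ x)]
  [∀ x, Module ℂ (δ x)] [∀ x, TopologicalSpace (δ x)] [FiberBundle ℂ δ] [VectorBundle ℂ ℂ δ]

/-- The fiber at `x` of `L^k ⊗ δ`. -/
abbrev Fib (x : M) := (⨂[ℂ]^k (L x)) ⊗[ℂ] (δ x)

/-- The coordinate on the fiber of `L^k ⊗ δ` in the frame induced by those of `L` and `δ`. -/
def fibCoord (x₀ x : M) : Fib k L δ x →ₗ[ℂ] ℂ :=
  tensorFunctional k (coord L x₀ x) (coord δ x₀ x)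

variable (n) in
/-- Smooth sections of `L^k ⊗ δ` over `M`. -/
structure PSec where
  toFun : ∀ x : M, Fib k L δ x
  smooth : ∀ x₀ : M, ContMDiffOn (𝓡 (2 * n)) 𝓘(ℝ, ℂ) ∞
    (fun x => fibCoord k L δ x₀ x (toFun x)) (dom L x₀ ∩ dom δ x₀)

variable {k L δ}

/-- A family of sections with parameter in an open subset of a finite dimensional space is smooth
when it is smooth jointly in the parameter and in the point of `M`. -/
def IsSmoothSecFamily {W : Type*} [NormedAddCommGroup W] [NormedSpace ℝ W] (U : Set W)
    (Φ : W → PSec n k L δ) : Prop :=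
  ∀ x₀ : M, ContMDiffOn (𝓘(ℝ, W).prod (𝓡 (2 * n))) 𝓘(ℝ, ℂ) ∞
    (fun z : W × M => fibCoord k L δ x₀ z.2 ((Φ z.1).toFun z.2)) (U ×ˢ (dom L x₀ ∩ dom δ x₀))

/-- Smooth sections of the bundle `𝒫_k → 𝒥`, whose fiber at `j` is the space of smooth sections of
`L^k ⊗ δ_j`: they transform the smooth finite dimensional families of elements of `𝒥` into smooth
families of sections of `L^k ⊗ δ`. -/
def IsSmoothSection (Φ : ACS Ω → PSec n k L δ) : Prop :=
  ∀ (m : ℕ) (U : Set (EuclideanSpace ℝ (Fin m))), IsOpen U →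
    ∀ p : EuclideanSpace ℝ (Fin m) → ACS Ω, IsSmoothFamily U p →
      IsSmoothSecFamily U (fun w => Φ (p w))

variable (F : HalfFormFamily Ω δ)

/-- The covariant derivative at time `t₀`, along the curve `γ` of `𝒥`, of the family
`Φ(t) ∈ 𝒫_{k,γ(t)}` is `v ∈ 𝒫_{k,γ(t₀)}`: it is the derivative at `t₀` of `Ψ_t⁻¹ . Φ(t)`, with
`(Ψ_t)` the continuous family of half-form bundle morphisms
`(δ, φ_{γ(t₀)}) → (δ, φ_{γ(t)})` starting from the identity. -/
def IsCovDerivAlong (γ : ℝ → ACS Ω) (Φ : ℝ → PSec n k L δ) (t₀ : ℝ) (v : PSec n k L δ) : Prop :=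
  ∃ Ψ : ℝ → ∀ x : M, δ x ≃ₗ[ℂ] δ x, F.IsMorphismFamily γ t₀ Ψ ∧
    ∀ x, HasVecDerivAt
      (fun t => LinearMap.lTensor (⨂[ℂ]^k (L x)) ((Ψ t x).symm : δ x →ₗ[ℂ] δ x) ((Φ t).toFun x))
      (v.toFun x) t₀

/-- The covariant derivative `(∇_η Φ)(j)` of the section `Φ` of `𝒫_k → 𝒥` with respect to
`η ∈ T_j 𝒥` is `v`: it may be computed with any smooth curve tangent to `η` at time `0`. -/
def IsCovDeriv (Φ : ACS Ω → PSec n k L δ) {j : ACS Ω} (η : TangentACS j)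
    (v : PSec n k L δ) : Prop :=
  ∀ γ : ℝ → ACS Ω, IsSmoothFamily Set.univ γ → HasVelocity γ η →
    IsCovDerivAlong F γ (fun t => Φ (γ t)) 0 v

/-- The curvature of `∇` at `η, μ ∈ T_j 𝒥`, applied to `Φ₀ ∈ 𝒫_{k,j}`, is `R`: for every smooth
two-parameter family `p(s,t)` in `𝒥` with `∂_s p = η` and `∂_t p = μ` at `(0,0)` (and there are
such families), and every smooth family `Φ(s,t) ∈ 𝒫_{k,p(s,t)}` with `Φ(0,0) = Φ₀`, the covariant
derivatives `∇_s Φ`, `∇_t Φ` are well-defined smooth families and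
`R = ∇_s ∇_t Φ - ∇_t ∇_s Φ` at `(0,0)`. -/
def IsCurvature {j : ACS Ω} (η μ : TangentACS j) (Φ₀ : PSec n k L δ)
    (R : ∀ x : M, Fib k L δ x) : Prop :=
  (∃ p : ℝ × ℝ → ACS Ω, IsSmoothFamily Set.univ p ∧
    HasVelocity (fun s => p (s, 0)) η ∧ HasVelocity (fun t => p (0, t)) μ) ∧
  ∀ p : ℝ × ℝ → ACS Ω, IsSmoothFamily Set.univ p →
    HasVelocity (fun s => p (s, 0)) η → HasVelocity (fun t => p (0, t)) μ →
    ∀ Φ : ℝ × ℝ → PSec n k L δ, IsSmoothSecFamily Set.univ Φ → Φ (0, 0) = Φ₀ →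
      ∃ Φs Φt : ℝ × ℝ → PSec n k L δ,
        IsSmoothSecFamily Set.univ Φs ∧ IsSmoothSecFamily Set.univ Φt ∧
        (∀ s t, IsCovDerivAlong F (fun a => p (a, t)) (fun a => Φ (a, t)) s (Φs (s, t))) ∧
        (∀ s t, IsCovDerivAlong F (fun b => p (s, b)) (fun b => Φ (s, b)) t (Φt (s, t))) ∧
        ∃ Φst Φts : PSec n k L δ,
          IsCovDerivAlong F (fun a => p (a, 0)) (fun a => Φt (a, 0)) 0 Φst ∧
          IsCovDerivAlong F (fun b => p (0, b)) (fun b => Φs (0, b)) 0 Φts ∧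
          ∀ x, R x = Φst.toFun x - Φts.toFun x

/-- The Hermitian product of `L^k ⊗ δ_j` at `x`, induced by those of `L` and `δ_j`, computed in the
frame `e^k ⊗ f` of the fiber with `e` and `f` the frames of `L_x` and `δ_x`; it does not depend on
the frames. -/
def fibInner (h : HermitianMetric (n := n) L) (j : ACS Ω) (x : M) (u v : Fib k L δ x) : ℂ :=
  fibCoord k L δ x x u * starRingEnd ℂ (fibCoord k L δ x x v) *
    h.inner x (frame L x x) (frame L x x) ^ k * (F.normSq j x (frame δ x x) : ℂ)

/-- The scalar product of the prequantum space `𝒫_{k,j}`. -/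
def pInner [CompactSpace M] [T2Space M] [MeasurableSpace M] (h : HermitianMetric (n := n) L)
    (j : ACS Ω) (u v : PSec n k L δ) : ℂ :=
  ∫ x, fibInner F h j x (u.toFun x) (v.toFun x) ∂(liouville Ω)

end Prequantum

end Manifold

end HalfForm

end

/-!
Since `δ` is a line bundle, an automorphism of `δ` over the identity of `M` is the multiplication by
a function `c`, and it is a half-form bundle morphism `(δ, φ_{j_a}) → (δ, φ_{j_b})` if and only if
`c² r = 1`, where `r = φ_{j_b}(u²) ∧ conj (φ_{j_a}(u²)) / φ_{j_a}(u²) ∧ conj (φ_{j_a}(u²))` is the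
function `HalfFormFamily.ratio` (`HalfFormFamily.compat_iff_sq_mul_ratio`). Two positive compatible
structures are transverse, because `j_a + j_b` is invertible, so `r` does not vanish. Along a smooth
curve, `r` has a unique continuous inverse square root equal to `1` at the initial time, and it is
smooth. In a local frame the covariant derivative is therefore `d/dt + a / 2`, where `a` is the
derivative of `r` (`isCovDerivAlong_iff`).

For the connection to be well defined, the derivatives of functions on `𝒥` along a curve must depend
only on the velocity of the curve, although smoothness on `𝒥` is only a condition on finite
dimensional families. The Cayley transform `S ↦ (1 + S) j (1 + S)⁻¹` is a chart of `𝒥` at `j`, with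
values in the linear space of the fields of symplectic endomorphisms anticommuting with `j`. If
`S₁(t)` and `S₂(t)` represent two curves with the same velocity, then
`S₁(t) + u t⁻¹ (S₂(t) - S₁(t))` is smooth in `(u, t)` by Hadamard's lemma, is constant on `t = 0`, and
restricts to the two curves on `u = 0` and on the diagonal, so that the chain rule gives the result
(`hasDerivAt_of_hasVelocity`). The same chart provides the families with prescribed velocities
(`exists_two_parameter_family`).

The pairing `φ_{j_b}(u²) ∧ conj (φ_{j_a}(u²))` is Hermitian up to the sign `(-1)^n`. Hence the
derivative of the norm of `δ_j` along a curve is `Re a` times this norm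
(`HalfFormFamily.hasDerivAt_normSq`), which is the Leibniz rule at each point of `M`. It is integrated
over `M` by differentiating under the integral, the Liouville measure being finite
(`isFiniteMeasure_liouville`, `hasDerivAt_pInner`).

For a two parameter family `p(s, t)`, the connection form is `(A ds + B dt) / 2`, where `A` and `B`
are the partial derivatives of the ratio, and the curvature is the function `(∂_s B - ∂_t A) / 2`. At
a point, with `J = p(0, 0)` and a basis `(α_i)` of `Λ^{1,0}_J`, the forms `α_i ∘ (1 - J p) / 2` are a
basis of `Λ^{1,0}` of `p`, and they turn the ratio into a determinant, up to a factor whose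
logarithmic derivative is closed. Jacobi's formula then gives the trace of the statement
(`curvature_det`, `curvature_of_generators`, `isCurvature_halfTrace`).
-/

noncomputable section

namespace HalfForm

/-! ### Wedge products and determinants -/

section WedgeDet

variable {E : Type*} [AddCommGroup E] [Module ℝ E] {n : ℕ}

theorem factorial_smul_wedge (α β : E [⋀^Fin n]→ₗ[ℝ] ℂ) (v : Fin n ⊕ Fin n → E) :
    ((n.factorial * n.factorial : ℕ) : ℂ) * wedge α β v =
      ∑ σ : Equiv.Perm (Fin n ⊕ Fin n), ((Equiv.Perm.sign σ : ℤ) : ℂ) *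
        (α (fun i => v (σ (Sum.inl i))) * β (fun i => v (σ (Sum.inr i)))) := by
  have h := congrArg (fun f => LinearMap.mul' ℝ ℂ (f v))
    (MultilinearMap.domCoprod_alternization_eq α β)
  simp only [MultilinearMap.alternatization_apply, map_sum, Fintype.card_fin,
    AlternatingMap.smul_apply, map_nsmul] at h
  rw [nsmul_eq_mul] at h
  refine Eq.trans ?_ (h.symm.trans ?_)
  · rfl
  · refine Finset.sum_congr rfl fun σ _ => ?_
    simp only [MultilinearMap.domDomCongr_apply, MultilinearMap.domCoprod_apply]
    rcases Int.units_eq_one_or (Equiv.Perm.sign σ) with hs | hs <;> simp [hs]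

theorem wedge_eq_sum (α β : E [⋀^Fin n]→ₗ[ℝ] ℂ) (v : Fin n ⊕ Fin n → E) :
    wedge α β v = ((n.factorial * n.factorial : ℕ) : ℂ)⁻¹ *
      ∑ σ : Equiv.Perm (Fin n ⊕ Fin n), ((Equiv.Perm.sign σ : ℤ) : ℂ) *
        (α (fun i => v (σ (Sum.inl i))) * β (fun i => v (σ (Sum.inr i)))) := by
  rw [← factorial_smul_wedge, inv_mul_cancel_left₀]
  exact_mod_cast mul_ne_zero n.factorial_ne_zero n.factorial_ne_zero

theorem wedge_smul_smul (c d : ℂ) (α β : E [⋀^Fin n]→ₗ[ℝ] ℂ) :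
    wedge (c • α) (d • β) = (c * d) • wedge α β := by
  ext v
  change _ = (c * d) * wedge α β v
  rw [wedge_eq_sum, wedge_eq_sum, mul_left_comm (c * d)]
  congr 1
  rw [Finset.mul_sum]
  refine Finset.sum_congr rfl fun σ _ => ?_
  simp only [AlternatingMap.smul_apply, smul_eq_mul]
  ring

theorem conjN_apply (α : E [⋀^Fin n]→ₗ[ℝ] ℂ) (v : Fin n → E) :
    conjN α v = starRingEnd ℂ (α v) := rfl

theorem conjN_smul (c : ℂ) (α : E [⋀^Fin n]→ₗ[ℝ] ℂ) :
    conjN (c • α) = starRingEnd ℂ c • conjN α := by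
  ext v; simp [conjN_apply]

theorem sign_sumComm_self (n : ℕ) :
    Equiv.Perm.sign (Equiv.sumComm (Fin n) (Fin n)) = (-1) ^ n := by
  have h := Equiv.Perm.sign_prodCongrRight (fun _ : Fin n => (Equiv.swap false true))
  rw [Finset.prod_const, Finset.card_univ, Fintype.card_fin,
    Equiv.Perm.sign_swap (by decide)] at h
  rw [← h]
  refine Equiv.Perm.sign_eq_sign_of_equiv _ _
    ((Equiv.boolProdEquivSum (Fin n)).symm.trans (Equiv.prodComm _ _)) ?_
  rintro (i | i) <;> simp [Equiv.boolProdEquivSum, Equiv.prodCongrRight]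

/-- Exchanging two `n`-forms in `α ∧ β̄` amounts to a conjugation, up to the sign `(-1)^n`. -/
theorem wedge_conjN_swap (α β : E [⋀^Fin n]→ₗ[ℝ] ℂ) (v : Fin n ⊕ Fin n → E) :
    wedge β (conjN α) v = (-1) ^ n * starRingEnd ℂ (wedge α (conjN β) v) := by
  rw [wedge_eq_sum, wedge_eq_sum, map_mul, map_sum, mul_left_comm (_ ^ n), map_inv₀, map_natCast]
  congr 1
  rw [Finset.mul_sum]
  refine Fintype.sum_equiv (Equiv.mulRight (Equiv.sumComm (Fin n) (Fin n))) _ _ fun σ => ?_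
  simp only [Equiv.coe_mulRight, map_mul, sign_sumComm_self, conjN_apply, Complex.conj_conj,
    Equiv.Perm.mul_apply, Equiv.sumComm_apply, Sum.swap_inl, Sum.swap_inr, Units.val_mul,
    Units.val_pow_eq_pow_val, Units.val_neg, Units.val_one, Int.cast_mul, Int.cast_pow,
    Int.cast_neg, Int.cast_one, map_intCast, map_pow, map_neg, map_one]
  have : ((-1 : ℂ) ^ n) * (-1) ^ n = 1 := by rw [← mul_pow]; simp
  linear_combination (-((Equiv.Perm.sign σ : ℤ) : ℂ) * (β (fun i => v (σ (Sum.inl i))) *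
    starRingEnd ℂ (α (fun i => v (σ (Sum.inr i)))))) * this

/-- The decomposable form `a₁ ∧ … ∧ aₙ`, with value `det (a i (v k))` on `v`. -/
def detForm (a : Fin n → E →ₗ[ℝ] ℂ) : E [⋀^Fin n]→ₗ[ℝ] ℂ :=
  MultilinearMap.alternatization ((MultilinearMap.mkPiAlgebra ℝ (Fin n) ℂ).compLinearMap a)

theorem detForm_apply (a : Fin n → E →ₗ[ℝ] ℂ) (v : Fin n → E) :
    detForm a v = Matrix.det (Matrix.of fun i k => a i (v k)) := by
  rw [detForm, MultilinearMap.alternatization_apply, ← Matrix.det_transpose, Matrix.det_apply]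
  refine Finset.sum_congr rfl fun σ _ => ?_
  simp [MultilinearMap.domDomCongr_apply]

theorem detForm_mem_formN0 {J : E →ₗ[ℝ] E} {a : Fin n → E →ₗ[ℝ] ℂ} (ha : ∀ i, a i ∈ form10 J) :
    detForm a ∈ formN0 n J := by
  intro v i
  rw [detForm_apply, detForm_apply]
  have h : (Matrix.of fun l k => a l (Function.update v i (J (v i)) k)) =
      (Matrix.of fun l k => a l (v k)).updateCol i
        (Complex.I • fun l => (Matrix.of fun l k => a l (v k)) l i) := by
    ext l k
    by_cases hk : k = i
    · subst hk; simp [(ha l) (v k)]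
    · simp [hk]
  rw [h, Matrix.det_updateCol_smul]
  congr 2
  exact Matrix.updateCol_eq_self _ _

/-- The wedge product of two decomposable forms is the determinant of all the factors. -/
theorem wedge_detForm (a b : Fin n → E →ₗ[ℝ] ℂ) (v : Fin n ⊕ Fin n → E) :
    wedge (detForm a) (detForm b) v =
      Matrix.det (Matrix.of fun i k => Sum.elim a b i (v k)) := by
  rw [wedge, detForm, detForm, ← MultilinearMap.domCoprod_alternization,
    LinearMap.compAlternatingMap_apply, MultilinearMap.alternatization_apply, map_sum,
    ← Matrix.det_transpose, Matrix.det_apply]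
  refine Finset.sum_congr rfl fun σ _ => ?_
  rw [Units.smul_def, Units.smul_def, map_zsmul]
  simp [MultilinearMap.domDomCongr_apply, Fintype.prod_sum_type]

theorem conjN_detForm (a : Fin n → E →ₗ[ℝ] ℂ) :
    conjN (detForm a) = detForm fun i => conj₁ (a i) := by
  ext v
  rw [conjN_apply, detForm_apply, detForm_apply, RingHom.map_det]
  rfl

end WedgeDet

/-! ### Forms of type `(1,0)` and transverse complex structures -/

section Types

variable {E : Type*} [AddCommGroup E] [Module ℝ E] {n : ℕ}

theorem conj₁_apply (α : E →ₗ[ℝ] ℂ) (v : E) : conj₁ α v = starRingEnd ℂ (α v) := rfl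

theorem conj₁_mem_form01 {J : E →ₗ[ℝ] E} {α : E →ₗ[ℝ] ℂ} (h : α ∈ form10 J) :
    conj₁ α ∈ form01 J := fun v => by simp [conj₁_apply, h v]

theorem conj₁_mem_form10 {J : E →ₗ[ℝ] E} {α : E →ₗ[ℝ] ℂ} (h : α ∈ form01 J) :
    conj₁ α ∈ form10 J := fun v => by simp [conj₁_apply, h v]

theorem isCompl_form10_form01 {J : E →ₗ[ℝ] E} (hJ : ∀ v, J (J v) = -v) :
    IsCompl (form10 J) (form01 J) := by
  constructor
  · rw [Submodule.disjoint_def]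
    intro α h1 h2
    ext v
    have h : 2 * Complex.I * α v = 0 := by linear_combination h2 v - h1 v
    simpa using h
  · rw [codisjoint_iff, eq_top_iff]
    intro α _
    refine Submodule.mem_sup.2 ⟨(1 / 2 : ℂ) • (α - Complex.I • (α ∘ₗ J)), fun v => ?_,
      (1 / 2 : ℂ) • (α + Complex.I • (α ∘ₗ J)), fun v => ?_, ?_⟩
    · simp [hJ]; linear_combination (α (J v) / 2) * Complex.I_sq
    · simp [hJ]; linear_combination (α (J v) / 2) * Complex.I_sq
    · ext v; simp; ring

/-- Conjugation as a real linear isomorphism from `Λ^{1,0}` to `Λ^{0,1}`. -/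
def conjEquiv (J : E →ₗ[ℝ] E) : form10 J ≃ₗ[ℝ] form01 J where
  toFun α := ⟨conj₁ α, conj₁_mem_form01 α.2⟩
  invFun α := ⟨conj₁ α, conj₁_mem_form10 α.2⟩
  map_add' α β := by ext v; simp [conj₁_apply]
  map_smul' c α := by ext v; simp [conj₁_apply]
  left_inv α := by ext v; simp [conj₁_apply]
  right_inv α := by ext v; simp [conj₁_apply]

theorem finrank_form10 [FiniteDimensional ℝ E] (hE : Module.finrank ℝ E = 2 * n)
    {J : E →ₗ[ℝ] E} (hJ : ∀ v, J (J v) = -v) : Module.finrank ℂ (form10 J) = n := by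
  have h1 := Submodule.finrank_add_eq_of_isCompl (isCompl_form10_form01 hJ)
  have h2 : Module.finrank ℂ (E →ₗ[ℝ] ℂ) = 2 * n := by
    rw [Module.finrank_linearMap_self, hE]
  have h3 := (conjEquiv J).finrank_eq
  have h4 := Module.finrank_mul_finrank ℝ ℂ (form10 J)
  have h5 := Module.finrank_mul_finrank ℝ ℂ (form01 J)
  rw [Complex.finrank_real_complex] at h4 h5
  omega

theorem exists_linearIndependent_form10 [FiniteDimensional ℝ E] (hE : Module.finrank ℝ E = 2 * n)
    {J : E →ₗ[ℝ] E} (hJ : ∀ v, J (J v) = -v) :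
    ∃ a : Fin n → E →ₗ[ℝ] ℂ, (∀ i, a i ∈ form10 J) ∧ LinearIndependent ℂ a := by
  have b := Module.finBasisOfFinrankEq ℂ (form10 J) (finrank_form10 hE hJ)
  exact ⟨fun i => b i, fun i => (b i).2,
    b.linearIndependent.map' (form10 J).subtype (Submodule.ker_subtype _)⟩

/-- If `Ja + Jb` is onto then `Λ^{1,0}` of `Jb` is transverse to `Λ^{0,1}` of `Ja`, so that the
wedge product of a generator of `Λ^{n,0}` of `Jb` with the conjugate of a generator of `Λ^{n,0}`
of `Ja` does not vanish. -/
theorem det_form10_conj_ne_zero {Ja Jb : E →ₗ[ℝ] E} (hs : Function.Surjective (Ja + Jb))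
    {a b : Fin n → E →ₗ[ℝ] ℂ} (ha : ∀ i, a i ∈ form10 Ja) (hb : ∀ i, b i ∈ form10 Jb)
    (hla : LinearIndependent ℂ a) (hlb : LinearIndependent ℂ b)
    (v : Module.Basis (Fin n ⊕ Fin n) ℝ E) :
    Matrix.det (Matrix.of fun i k => Sum.elim b (fun i => conj₁ (a i)) i (v k)) ≠ 0 := by
  intro hdet
  obtain ⟨c, hc, hc0⟩ := Matrix.exists_vecMul_eq_zero_iff.2 hdet
  set ξ : E →ₗ[ℝ] ℂ := ∑ i, c (Sum.inl i) • b i with hξ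
  set ζ : E →ₗ[ℝ] ℂ := ∑ i, c (Sum.inr i) • conj₁ (a i) with hζ
  have hsum : ξ + ζ = 0 := by
    refine v.ext fun k => ?_
    have := congrFun hc0 k
    simpa [Matrix.vecMul, dotProduct, Fintype.sum_sum_type, hξ, hζ] using this
  have h1 : ξ ∈ form10 Jb := Submodule.sum_mem _ fun i _ => Submodule.smul_mem _ _ (hb i)
  have h2 : ζ ∈ form01 Ja :=
    Submodule.sum_mem _ fun i _ => Submodule.smul_mem _ _ (conj₁_mem_form01 (ha i))
  have hζξ : ζ = -ξ := eq_neg_of_add_eq_zero_right hsum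
  have h0 : ξ = 0 := by
    ext w
    obtain ⟨u, rfl⟩ := hs w
    have e1 := h1 u
    have e2 := h2 u
    rw [hζξ] at e2
    simp only [LinearMap.neg_apply] at e2
    simp only [LinearMap.add_apply, map_add, LinearMap.zero_apply]
    linear_combination e1 - e2
  have hc1 := Fintype.linearIndependent_iff.1 hlb _ h0
  have hζ0 : ∑ i, starRingEnd ℂ (c (Sum.inr i)) • a i = 0 := by
    have : conj₁ ζ = 0 := by rw [hζξ, h0]; ext v; simp [conj₁_apply]
    rw [← this, hζ]
    ext v
    simp [conj₁_apply, LinearMap.sum_apply]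
  have hc2 := Fintype.linearIndependent_iff.1 hla _ hζ0
  refine hc (funext fun i => ?_)
  rcases i with i | i
  · exact hc1 i
  · simpa using hc2 i

/-- Generators of `Λ^{n,0}` of two transverse complex structures have a nonzero pairing. -/
theorem wedge_conjN_ne_zero [FiniteDimensional ℝ E]
    {Ja Jb : E →ₗ[ℝ] E} (hJa : ∀ v, Ja (Ja v) = -v) (hJb : ∀ v, Jb (Jb v) = -v)
    (hs : Function.Surjective (Ja + Jb))
    {α β : E [⋀^Fin n]→ₗ[ℝ] ℂ} (hα : ∀ γ ∈ formN0 n Ja, ∃ c : ℂ, γ = c • α)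
    (hβ : ∀ γ ∈ formN0 n Jb, ∃ c : ℂ, γ = c • β)
    (v : Module.Basis (Fin n ⊕ Fin n) ℝ E) :
    wedge β (conjN α) v ≠ 0 := by
  have hE : Module.finrank ℝ E = 2 * n := by
    rw [Module.finrank_eq_card_basis v]; simp; ring
  obtain ⟨a, ha, hla⟩ := exists_linearIndependent_form10 hE hJa
  obtain ⟨b, hb, hlb⟩ := exists_linearIndependent_form10 hE hJb
  obtain ⟨c, hc⟩ := hα _ (detForm_mem_formN0 ha)
  obtain ⟨d, hd⟩ := hβ _ (detForm_mem_formN0 hb)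
  have h := det_form10_conj_ne_zero hs ha hb hla hlb v
  rw [← wedge_detForm, ← conjN_detForm, hc, hd, conjN_smul, wedge_smul_smul] at h
  exact right_ne_zero_of_mul h

end Types

/-! ### The top power of a symplectic form -/

/-- Alternating maps of top degree are determined by their value on a basis. -/
theorem alternatingMap_apply_eq_det {E G ι : Type*} [AddCommGroup E] [Module ℝ E] [AddCommGroup G]
    [Module ℝ G] [Fintype ι] [DecidableEq ι] (e : Module.Basis ι ℝ E) (f : E [⋀^ι]→ₗ[ℝ] G)
    (v : ι → E) : f v = e.det v • f e := by
  have h : f = (LinearMap.toSpanSingleton ℝ G (f e)).compAlternatingMap e.det := by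
    refine Module.Basis.ext_alternating e fun i hi => ?_
    let σ : Equiv.Perm ι := Equiv.ofBijective i (Finite.injective_iff_bijective.1 hi)
    change f (e ∘ σ) = e.det (e ∘ σ) • f e
    rw [AlternatingMap.map_perm, AlternatingMap.map_perm, e.det_self]
    rcases Int.units_eq_one_or (Equiv.Perm.sign σ) with hs | hs <;> simp [hs]
  conv_lhs => rw [h]
  rfl

section OmegaPow

variable {E : Type*} [AddCommGroup E] [Module ℝ E] {n : ℕ}

/-- The multilinear map `v ↦ ∏ i, B (v (i, 0)) (v (i, 1))`. -/
def pairProd (n : ℕ) (B : E →ₗ[ℝ] E →ₗ[ℝ] ℝ) : MultilinearMap ℝ (fun _ : Fin n × Fin 2 => E) ℝ :=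
  have key : ∀ (m : Fin n × Fin 2 → E) (k : Fin n × Fin 2), ∃ l : E →ₗ[ℝ] ℝ, ∀ x,
      ∏ i : Fin n, B (Function.update m k x (i, 0)) (Function.update m k x (i, 1)) = l x := by
    rintro m ⟨i₀, b⟩
    have hne : ∀ x, ∀ i ∈ Finset.univ.erase i₀,
        B (Function.update m (i₀, b) x (i, 0)) (Function.update m (i₀, b) x (i, 1)) =
          B (m (i, 0)) (m (i, 1)) := by
      intro x i hi
      have hi' := Finset.ne_of_mem_erase hi
      rw [Function.update_of_ne, Function.update_of_ne] <;> simp [hi']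
    fin_cases b
    · refine ⟨(∏ i ∈ Finset.univ.erase i₀, B (m (i, 0)) (m (i, 1))) • B.flip (m (i₀, 1)),
        fun x => ?_⟩
      rw [← Finset.mul_prod_erase _ _ (Finset.mem_univ i₀), Finset.prod_congr rfl (hne x)]
      simp [mul_comm]
    · refine ⟨(∏ i ∈ Finset.univ.erase i₀, B (m (i, 0)) (m (i, 1))) • B (m (i₀, 0)),
        fun x => ?_⟩
      rw [← Finset.mul_prod_erase _ _ (Finset.mem_univ i₀), Finset.prod_congr rfl (hne x)]
      simp [mul_comm]
  MultilinearMap.mk' (fun v => ∏ i : Fin n, B (v (i, 0)) (v (i, 1)))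
    (fun m k x y => by obtain ⟨l, hl⟩ := key m k; rw [hl, hl, hl, map_add])
    (fun m k c x => by obtain ⟨l, hl⟩ := key m k; rw [hl, hl, map_smul])

/-- The index identification `(i, b) ↦ 2 i + b`. -/
def pairEquiv (n : ℕ) : Fin n × Fin 2 ≃ Fin (2 * n) :=
  finProdFinEquiv.trans (finCongr (mul_comm n 2))

theorem pairEquiv_zero (i : Fin n) : pairEquiv n (i, 0) = ⟨2 * i, by omega⟩ := by
  ext; simp [pairEquiv]

theorem pairEquiv_one (i : Fin n) : pairEquiv n (i, 1) = ⟨2 * i + 1, by omega⟩ := by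
  ext; simp [pairEquiv]; omega

/-- The power `B ∧ … ∧ B` as an alternating map. -/
def omegaForm (n : ℕ) (B : E →ₗ[ℝ] E →ₗ[ℝ] ℝ) : E [⋀^Fin n × Fin 2]→ₗ[ℝ] ℝ :=
  (1 / 2 ^ n : ℝ) • MultilinearMap.alternatization (pairProd n B)

theorem omegaForm_apply (B : E →ₗ[ℝ] E →ₗ[ℝ] ℝ) (v : Fin n × Fin 2 → E) :
    omegaForm n B v = (1 / 2 ^ n : ℝ) * ∑ σ : Equiv.Perm (Fin n × Fin 2),
      ((Equiv.Perm.sign σ : ℤ) : ℝ) * ∏ i : Fin n, B (v (σ (i, 0))) (v (σ (i, 1))) := by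
  rw [omegaForm, AlternatingMap.smul_apply, MultilinearMap.alternatization_apply, smul_eq_mul]
  congr 1
  refine Finset.sum_congr rfl fun σ _ => ?_
  rw [Units.smul_def, zsmul_eq_mul]
  rfl

theorem omegaPow_eq_omegaForm (B : E →ₗ[ℝ] E →ₗ[ℝ] ℝ) (v : Fin (2 * n) → E) :
    omegaPow n (fun x y => B x y) v = omegaForm n B (fun p => v (pairEquiv n p)) := by
  rw [omegaForm_apply, omegaPow]
  congr 1
  refine (Fintype.sum_equiv (pairEquiv n).permCongr _ _ fun σ => ?_).symm
  rw [Equiv.Perm.sign_permCongr]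
  congr 1
  refine Finset.prod_congr rfl fun i _ => ?_
  rw [← pairEquiv_zero, ← pairEquiv_one]
  simp

theorem omegaPow_eq_det (B : E →ₗ[ℝ] E →ₗ[ℝ] ℝ) (e : Module.Basis (Fin (2 * n)) ℝ E)
    (v : Fin (2 * n) → E) :
    omegaPow n (fun x y => B x y) v = e.det v * omegaPow n (fun x y => B x y) e := by
  have h := alternatingMap_apply_eq_det e
    ((omegaForm n B).domDomCongr (pairEquiv n)) v
  rw [omegaPow_eq_omegaForm, omegaPow_eq_omegaForm]
  exact h

/-- On a symplectic family, the nonzero terms of the sum over permutations that defines the top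
power are those of the permutations that preserve the pairs, and all of them are equal to `1`. -/
theorem omegaForm_pos_of_symplectic {B : E →ₗ[ℝ] E →ₗ[ℝ] ℝ} {f : Fin n × Fin 2 → E}
    (hne : ∀ p q : Fin n × Fin 2, p.1 ≠ q.1 → B (f p) (f q) = 0)
    (heq : ∀ (i : Fin n) (τ : Equiv.Perm (Fin 2)),
      B (f (i, τ 0)) (f (i, τ 1)) = ((Equiv.Perm.sign τ : ℤ) : ℝ)) :
    0 < omegaForm n B f := by
  rw [omegaForm_apply]
  refine mul_pos (by positivity) (Finset.sum_pos' (fun σ _ => ?_) ⟨1, Finset.mem_univ _, ?_⟩)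
  · by_cases h : ∀ i, (σ (i, 0)).1 = (σ (i, 1)).1
    · have h' : ∀ i b, (σ (i, b)).1 = (σ (i, 0)).1 := by
        intro i b; fin_cases b
        · rfl
        · exact (h i).symm
      have hpair : Function.Surjective fun i => (σ (i, 0)).1 := by
        intro i
        obtain ⟨⟨l, b⟩, hl⟩ := σ.surjective (i, 0)
        exact ⟨l, by change (σ (l, 0)).1 = i; rw [← h' l b, hl]⟩
      let pair : Equiv.Perm (Fin n) :=
        Equiv.ofBijective _ (Finite.surjective_iff_bijective.1 hpair)
      have hτ : ∀ i, Function.Injective fun b => (σ (i, b)).2 := by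
        intro i b c hbc
        have : σ (i, b) = σ (i, c) :=
          Prod.ext ((h' i b).trans (h' i c).symm) hbc
        simpa using σ.injective this
      let τ : Fin n → Equiv.Perm (Fin 2) := fun i =>
        Equiv.ofBijective _ (Finite.injective_iff_bijective.1 (hτ i))
      have hσ : σ = (Equiv.prodCongrLeft fun _ : Fin 2 => pair) * Equiv.prodCongrRight τ := by
        ext1 ⟨i, b⟩
        exact Prod.ext (h' i b) rfl
      have hsign : Equiv.Perm.sign σ = ∏ i, Equiv.Perm.sign (τ i) := by
        rw [hσ, map_mul, Equiv.Perm.sign_prodCongrRight, Equiv.Perm.sign_prodCongrLeft]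
        simp
      have hterm : ∀ i, B (f (σ (i, 0))) (f (σ (i, 1))) = ((Equiv.Perm.sign (τ i) : ℤ) : ℝ) := by
        intro i
        rw [← heq (pair i) (τ i), hσ]
        rfl
      simp_rw [hterm, hsign]
      rw [Units.coe_prod, Int.cast_prod, ← Finset.prod_mul_distrib]
      exact Finset.prod_nonneg fun i _ => mul_self_nonneg _
    · push Not at h
      obtain ⟨i, hi⟩ := h
      rw [Finset.prod_eq_zero (Finset.mem_univ i) (hne _ _ hi), mul_zero]
  · have h1 : ∀ i, B (f (i, 0)) (f (i, 1)) = 1 := fun i => by simpa using heq i 1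
    simp [h1]

/-- A family which is orthonormal for the Hermitian product defined by `B` and `J`. -/
theorem exists_unitary_family [FiniteDimensional ℝ E] (hE : Module.finrank ℝ E = 2 * n)
    {B : E →ₗ[ℝ] E →ₗ[ℝ] ℝ} {J : E →ₗ[ℝ] E} (hJ : ∀ v, J (J v) = -v) (hB : ∀ v, B v v = 0)
    (hJB : ∀ v w, B (J v) (J w) = B v w) (hpos : ∀ v, v ≠ 0 → 0 < B v (J v)) (k : ℕ)
    (hk : k ≤ n) : ∃ e : Fin k → E, (∀ i l, B (e i) (e l) = 0) ∧
      ∀ i l, B (e i) (J (e l)) = if i = l then 1 else 0 := by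
  have hskew : ∀ v w, B v w = -B w v := fun v w => by
    have := hB (v + w)
    simp only [map_add, LinearMap.add_apply, hB] at this
    linarith
  induction k with
  | zero => exact ⟨Fin.elim0, fun i => i.elim0, fun i => i.elim0⟩
  | succ k ih =>
    obtain ⟨e, h1, h2⟩ := ih (by omega)
    let T : E →ₗ[ℝ] (Fin k → ℝ) × (Fin k → ℝ) :=
      (LinearMap.pi fun l => B.flip (J (e l))).prod (LinearMap.pi fun l => B.flip (e l))
    have hT : LinearMap.ker T ≠ ⊥ := LinearMap.ker_ne_bot_of_finrank_lt (by simp [hE]; omega)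
    obtain ⟨v, hv, hv0⟩ := (Submodule.ne_bot_iff _).1 hT
    have hv' : T v = 0 := hv
    have hv1 : ∀ l, B v (J (e l)) = 0 := fun l => congrFun (congrArg Prod.fst hv') l
    have hv2 : ∀ l, B v (e l) = 0 := fun l => congrFun (congrArg Prod.snd hv') l
    have hv3 : ∀ l, B (e l) (J v) = 0 := fun l => by
      rw [← hJB, hJ, map_neg, hskew, hv1]; simp
    have hv4 : ∀ l, B (e l) v = 0 := fun l => by rw [hskew, hv2]; simp
    have hr := hpos v hv0
    set r := B v (J v)
    have hs : (Real.sqrt r)⁻¹ * ((Real.sqrt r)⁻¹ * r) = 1 := by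
      have := Real.mul_self_sqrt hr.le
      have h0 : Real.sqrt r ≠ 0 := (Real.sqrt_pos.2 hr).ne'
      field_simp
      nlinarith
    refine ⟨Fin.snoc e ((Real.sqrt r)⁻¹ • v), fun i l => ?_, fun i l => ?_⟩
    · refine Fin.lastCases ?_ (fun i => ?_) i <;> refine Fin.lastCases ?_ (fun l => ?_) l <;>
        simp [h1, hv2, hv4, hB]
    · refine Fin.lastCases ?_ (fun i => ?_) i <;> refine Fin.lastCases ?_ (fun l => ?_) l
      · simpa using hs
      · simp [hv1, (Fin.castSucc_lt_last l).ne']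
      · simp [hv3, (Fin.castSucc_lt_last i).ne]
      · simp [h2]

/-- A symplectic form with a positive compatible complex structure is nondegenerate in the sense
that its top power does not vanish: this power is positive on the basis `e 1, J e 1, …, e n, J e n` built
from a unitary family. -/
theorem omegaPow_ne_zero [FiniteDimensional ℝ E]
    {B : E →ₗ[ℝ] E →ₗ[ℝ] ℝ} {J : E →ₗ[ℝ] E} (hJ : ∀ v, J (J v) = -v) (hB : ∀ v, B v v = 0)
    (hJB : ∀ v w, B (J v) (J w) = B v w) (hpos : ∀ v, v ≠ 0 → 0 < B v (J v))
    (e : Module.Basis (Fin (2 * n)) ℝ E) : omegaPow n (fun x y => B x y) e ≠ 0 := by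
  have hE : Module.finrank ℝ E = 2 * n := by rw [Module.finrank_eq_card_basis e]; simp
  have hskew : ∀ v w, B v w = -B w v := fun v w => by
    have := hB (v + w)
    simp only [map_add, LinearMap.add_apply, hB] at this
    linarith
  obtain ⟨u, h1, h2⟩ := exists_unitary_family hE hJ hB hJB hpos n le_rfl
  let f : Fin n × Fin 2 → E := fun p => if p.2 = 0 then u p.1 else J (u p.1)
  have hf : 0 < omegaForm n B f := by
    refine omegaForm_pos_of_symplectic ?_ ?_
    · rintro ⟨i, b⟩ ⟨l, c⟩ hil
      have hil' : i ≠ l := hil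
      fin_cases b <;> fin_cases c <;> simp [f, h1, h2, hJB, hil', hskew (J _), hil'.symm]
    · intro i τ
      have : τ = 1 ∨ τ = Equiv.swap 0 1 := by revert τ; decide
      rcases this with rfl | rfl
      · simp [f, h2]
      · simp [f, h2, hskew (J _)]
  intro h0
  have h := omegaPow_eq_det B e (fun k => f ((pairEquiv n).symm k))
  rw [h0, mul_zero, omegaPow_eq_omegaForm] at h
  simp only [Equiv.symm_apply_apply] at h
  exact hf.ne' h

end OmegaPow

/-! ### Partial derivatives on the plane -/

section Partial

variable {G : Type*} [NormedAddCommGroup G] [NormedSpace ℝ G] {g : ℝ × ℝ → G}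

/-- Partial derivative with respect to the first variable. -/
def dFst (g : ℝ × ℝ → G) (w : ℝ × ℝ) : G := fderiv ℝ g w (1, 0)

/-- Partial derivative with respect to the second variable. -/
def dSnd (g : ℝ × ℝ → G) (w : ℝ × ℝ) : G := fderiv ℝ g w (0, 1)

theorem hasDerivAt_dFst (hg : ContDiff ℝ ∞ g) (s t : ℝ) :
    HasDerivAt (fun a => g (a, t)) (dFst g (s, t)) s := by
  have h1 : HasDerivAt (fun a : ℝ => (a, t)) ((1 : ℝ), (0 : ℝ)) s :=
    (hasDerivAt_id s).prodMk (hasDerivAt_const s t)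
  exact ((hg.differentiable (by simp)) (s, t)).hasFDerivAt.comp_hasDerivAt s h1

theorem hasDerivAt_dSnd (hg : ContDiff ℝ ∞ g) (s t : ℝ) :
    HasDerivAt (fun b => g (s, b)) (dSnd g (s, t)) t := by
  have h1 : HasDerivAt (fun b : ℝ => (s, b)) ((0 : ℝ), (1 : ℝ)) t :=
    (hasDerivAt_const t s).prodMk (hasDerivAt_id t)
  exact ((hg.differentiable (by simp)) (s, t)).hasFDerivAt.comp_hasDerivAt t h1

theorem contDiff_dFst (hg : ContDiff ℝ ∞ g) : ContDiff ℝ ∞ (dFst g) :=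
  (hg.fderiv_right (m := ∞) (by simp)).clm_apply contDiff_const

theorem contDiff_dSnd (hg : ContDiff ℝ ∞ g) : ContDiff ℝ ∞ (dSnd g) :=
  (hg.fderiv_right (m := ∞) (by simp)).clm_apply contDiff_const

theorem dFst_dSnd_comm (hg : ContDiff ℝ ∞ g) (w : ℝ × ℝ) :
    dFst (dSnd g) w = dSnd (dFst g) w := by
  have hd : DifferentiableAt ℝ (fderiv ℝ g) w :=
    ((hg.fderiv_right (m := ∞) (by simp)).differentiable (by simp)) w
  have hsymm : IsSymmSndFDerivAt ℝ g w :=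
    (hg.contDiffAt).isSymmSndFDerivAt (by
      simpa using WithTop.coe_le_coe.2 (le_top : (2 : ℕ∞) ≤ ⊤))
  have h1 : dFst (dSnd g) w = fderiv ℝ (fderiv ℝ g) w (1, 0) (0, 1) := by
    change fderiv ℝ (fun w => fderiv ℝ g w (0, 1)) w (1, 0) = _
    rw [fderiv_clm_apply hd (differentiableAt_const _)]; simp
  have h2 : dSnd (dFst g) w = fderiv ℝ (fderiv ℝ g) w (0, 1) (1, 0) := by
    change fderiv ℝ (fun w => fderiv ℝ g w (1, 0)) w (0, 1) = _
    rw [fderiv_clm_apply hd (differentiableAt_const _)]; simp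
  rw [h1, h2, hsymm]

end Partial

/-! ### Derivatives of matrices -/

section MatrixDeriv

variable {ι : Type*} [Fintype ι]

/-- Jacobi's formula. -/
theorem hasDerivAt_det [DecidableEq ι] {X : ℝ → Matrix ι ι ℂ} {X' : Matrix ι ι ℂ} {t : ℝ}
    (h : ∀ i k, HasDerivAt (fun s => X s i k) (X' i k) t) :
    HasDerivAt (fun s => (X s).det) ((X t).adjugate * X').trace t := by
  have h1 : ∀ σ : Equiv.Perm ι, HasDerivAt
      (fun s => ((Equiv.Perm.sign σ : ℤ) : ℂ) * ∏ i, X s (σ i) i)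
      (((Equiv.Perm.sign σ : ℤ) : ℂ) *
        ∑ i, (∏ j ∈ Finset.univ.erase i, X t (σ j) j) * X' (σ i) i) t := fun σ => by
    have := (HasDerivAt.fun_finsetProd (u := Finset.univ) (f := fun i s => X s (σ i) i)
      (f' := fun i => X' (σ i) i) (x := t) (fun i _ => h (σ i) i))
    simpa [smul_eq_mul] using this.const_mul (((Equiv.Perm.sign σ : ℤ) : ℂ))
  have h2 := HasDerivAt.fun_sum (u := Finset.univ) fun σ _ => h1 σ
  have hfun : (fun s => (X s).det) =
      fun s => ∑ σ : Equiv.Perm ι, ((Equiv.Perm.sign σ : ℤ) : ℂ) * ∏ i, X s (σ i) i :=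
    funext fun s => Matrix.det_apply' _
  rw [hfun]
  refine h2.congr_deriv (Eq.symm ?_)
  · have hcol : ∀ i, ((X t).adjugate * X') i i =
        ((X t).updateCol i (fun l => X' l i)).det := by
      intro i
      rw [← Matrix.cramer_apply, Matrix.cramer_eq_adjugate_mulVec]
      rfl
    simp_rw [Matrix.trace, Matrix.diag_apply, hcol, Matrix.det_apply', Finset.mul_sum]
    rw [Finset.sum_comm]
    refine Finset.sum_congr rfl fun σ _ => Finset.sum_congr rfl fun i _ => ?_
    congr 1
    rw [← Finset.mul_prod_erase _ _ (Finset.mem_univ i), mul_comm]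
    congr 1
    · refine Finset.prod_congr rfl fun j hj => ?_
      rw [Matrix.updateCol_ne (Finset.ne_of_mem_erase hj)]
    · rw [Matrix.updateCol_self]

theorem hasDerivAt_matrix_mul {X Y : ℝ → Matrix ι ι ℂ} {X' Y' : Matrix ι ι ℂ} {t : ℝ}
    (hX : ∀ i k, HasDerivAt (fun s => X s i k) (X' i k) t)
    (hY : ∀ i k, HasDerivAt (fun s => Y s i k) (Y' i k) t) (i k : ι) :
    HasDerivAt (fun s => (X s * Y s) i k) ((X' * Y t + X t * Y') i k) t := by
  simp only [Matrix.mul_apply, Matrix.add_apply, ← Finset.sum_add_distrib]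
  exact HasDerivAt.fun_sum fun l _ => (hX i l).mul (hY l k)

theorem hasDerivAt_trace {X : ℝ → Matrix ι ι ℂ} {X' : Matrix ι ι ℂ} {t : ℝ}
    (hX : ∀ i k, HasDerivAt (fun s => X s i k) (X' i k) t) :
    HasDerivAt (fun s => (X s).trace) X'.trace t :=
  HasDerivAt.fun_sum fun i _ => hX i i

/-- Derivative of the inverse of a matrix at the identity. -/
theorem hasDerivAt_inv_of_eq_one [DecidableEq ι] {X : ℝ → Matrix ι ι ℂ} {X' : Matrix ι ι ℂ} {t : ℝ}
    (hX : ∀ i k, HasDerivAt (fun s => X s i k) (X' i k) t) (h1 : X t = 1)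
    (hdet : ∀ s, (X s).det ≠ 0) (i k : ι) :
    HasDerivAt (fun s => (X s)⁻¹ i k) ((-X') i k) t := by
  have hex : ∀ i k, ∃ y, HasDerivAt (fun s => (X s)⁻¹ i k) y t := by
    intro i k
    obtain ⟨y, hadj⟩ : ∃ y, HasDerivAt (fun s => (X s).adjugate i k) y t := by
      simp only [Matrix.adjugate_apply]
      refine ⟨_, hasDerivAt_det (X' := X'.updateRow k 0) fun l m => ?_⟩
      by_cases hl : l = k
      · subst hl; simpa using hasDerivAt_const t _
      · simpa [hl] using hX l m
    have := ((hasDerivAt_det hX).inv (hdet t)).mul hadj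
    refine ⟨_, this.congr_of_eventuallyEq (Filter.Eventually.of_forall fun s => ?_)⟩
    simp [Matrix.inv_def, Ring.inverse_eq_inv']
  choose Y hY using hex
  have h2 := fun i k => hasDerivAt_matrix_mul hX (Y' := Matrix.of Y) hY i k
  have h3 : X' + Matrix.of Y = 0 := by
    ext i k
    have h4 := h2 i k
    have : (fun s => (X s * (X s)⁻¹) i k) = fun _ => (1 : Matrix ι ι ℂ) i k := by
      funext s; rw [Matrix.mul_nonsing_inv _ (isUnit_iff_ne_zero.2 (hdet s))]
    rw [this] at h4
    have h5 := h4.unique (hasDerivAt_const t _)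
    simpa [h1] using h5
  have h6 : -X' = Matrix.of Y := neg_eq_of_add_eq_zero_right h3
  rw [h6]
  exact hY i k

/-- The connection form obtained by differentiating `f w' / f w * det (P X w' + Q X w) / det X w` in
the variable `w'` on the diagonal is `df / f + tr (X⁻¹ P dX)`, where `P + Q = 1`. Its exterior
derivative is computed at a point where `X = 1`. The logarithmic derivative of `f` is closed, so
that only the derivative of `X⁻¹` contributes. -/
theorem curvature_det [DecidableEq ι] {X : ℝ × ℝ → Matrix ι ι ℂ}
    (hX : ∀ i k, ContDiff ℝ ∞ fun w => X w i k)
    (hdet : ∀ w, (X w).det ≠ 0) (h1 : X (0, 0) = 1) {f : ℝ × ℝ → ℂ} (hf : ContDiff ℝ ∞ f)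
    (hf0 : ∀ w, f w ≠ 0) {P Q : Matrix ι ι ℂ} (hPQ : P + Q = 1) {as at' : ℝ × ℝ → ℂ}
    (has : ∀ s t, HasDerivAt (fun s' => f (s', t) / f (s, t) *
      ((P * X (s', t) + Q * X (s, t)).det / (X (s, t)).det)) (as (s, t)) s)
    (hat : ∀ s t, HasDerivAt (fun t' => f (s, t') / f (s, t) *
      ((P * X (s, t') + Q * X (s, t)).det / (X (s, t)).det)) (at' (s, t)) t)
    {Xs Xt : Matrix ι ι ℂ} (hXs : ∀ i k, HasDerivAt (fun s => X (s, 0) i k) (Xs i k) 0)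
    (hXt : ∀ i k, HasDerivAt (fun t => X (0, t) i k) (Xt i k) 0) {d d' : ℂ}
    (hd : HasDerivAt (fun s => at' (s, 0)) d 0) (hd' : HasDerivAt (fun t => as (0, t)) d' 0) :
    d - d' = (P * Xs * Xt).trace - (P * Xt * Xs).trace := by
  have key : ∀ (x : ℝ → Matrix ι ι ℂ) (x' : Matrix ι ι ℂ) (φ : ℝ → ℂ) (φ' : ℂ) (s : ℝ),
      (∀ i k, HasDerivAt (fun r => x r i k) (x' i k) s) → HasDerivAt φ φ' s →
      (x s).det ≠ 0 → φ s ≠ 0 → HasDerivAt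
        (fun r => φ r / φ s * ((P * x r + Q * x s).det / (x s).det))
        (φ' / φ s + ((x s)⁻¹ * (P * x')).trace) s := by
    intro x x' φ φ' s hx hφ hxs hφs
    have e1 : P * x s + Q * x s = x s := by rw [← add_mul, hPQ, one_mul]
    have e2 := hasDerivAt_det (X := fun r => P * x r + Q * x s) (X' := P * x') (t := s)
      fun i k => by
        have := (hasDerivAt_matrix_mul (X := fun _ => P) (X' := 0)
          (fun i k => hasDerivAt_const s _) hx i k).add_const ((Q * x s) i k)
        simpa using this
    have e3 := (hφ.div_const (φ s)).mul (e2.div_const (x s).det)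
    refine e3.congr_deriv ?_
    simp only [e1]
    rw [div_self hxs, div_self hφs, Matrix.inv_def, Ring.inverse_eq_inv', Matrix.smul_mul,
      Matrix.trace_smul, smul_eq_mul]
    field_simp
  have has' : ∀ s t, as (s, t) = dFst f (s, t) / f (s, t) +
      ((X (s, t))⁻¹ * (P * Matrix.of fun i k => dFst (fun w => X w i k) (s, t))).trace :=
    fun s t => (has s t).unique (key (fun r => X (r, t)) _ (fun r => f (r, t)) _ s
      (fun i k => hasDerivAt_dFst (hX i k) s t) (hasDerivAt_dFst hf s t) (hdet _) (hf0 _))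
  have hat' : ∀ s t, at' (s, t) = dSnd f (s, t) / f (s, t) +
      ((X (s, t))⁻¹ * (P * Matrix.of fun i k => dSnd (fun w => X w i k) (s, t))).trace :=
    fun s t => (hat s t).unique (key (fun r => X (s, r)) _ (fun r => f (s, r)) _ t
      (fun i k => hasDerivAt_dSnd (hX i k) s t) (hasDerivAt_dSnd hf s t) (hdet _) (hf0 _))
  have hXs' : (Matrix.of fun i k => dFst (fun w => X w i k) (0, 0)) = Xs := by
    ext i k; exact (hasDerivAt_dFst (hX i k) 0 0).unique (hXs i k)
  have hXt' : (Matrix.of fun i k => dSnd (fun w => X w i k) (0, 0)) = Xt := by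
    ext i k; exact (hasDerivAt_dSnd (hX i k) 0 0).unique (hXt i k)
  have hconst : ∀ i k, HasDerivAt (fun _ : ℝ => P i k) ((0 : Matrix ι ι ℂ) i k) 0 :=
    fun i k => hasDerivAt_const _ _
  have hds := ((hasDerivAt_dFst (contDiff_dSnd hf) 0 0).div (hasDerivAt_dFst hf 0 0) (hf0 _)).add
    (hasDerivAt_trace (hasDerivAt_matrix_mul
      (hasDerivAt_inv_of_eq_one hXs h1 fun s => hdet _)
      (hasDerivAt_matrix_mul hconst (Y := fun s => Matrix.of fun i k =>
        dSnd (fun w => X w i k) (s, 0))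
        (Y' := Matrix.of fun i k => dFst (dSnd (fun w => X w i k)) (0, 0))
        fun i k => hasDerivAt_dFst (contDiff_dSnd (hX i k)) 0 0)))
  have hdt := ((hasDerivAt_dSnd (contDiff_dFst hf) 0 0).div (hasDerivAt_dSnd hf 0 0) (hf0 _)).add
    (hasDerivAt_trace (hasDerivAt_matrix_mul
      (hasDerivAt_inv_of_eq_one hXt h1 fun s => hdet _)
      (hasDerivAt_matrix_mul hconst (Y := fun t => Matrix.of fun i k =>
        dFst (fun w => X w i k) (0, t))
        (Y' := Matrix.of fun i k => dSnd (dFst (fun w => X w i k)) (0, 0))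
        fun i k => hasDerivAt_dSnd (contDiff_dFst (hX i k)) 0 0)))
  have e1 := hd.unique (hds.congr_of_eventuallyEq
    (Filter.Eventually.of_forall fun s => hat' s 0))
  have e2 := hd'.unique (hdt.congr_of_eventuallyEq
    (Filter.Eventually.of_forall fun t => has' 0 t))
  have e3 : (Matrix.of fun i k => dSnd (dFst fun w => X w i k) (0, 0)) =
      Matrix.of fun i k => dFst (dSnd fun w => X w i k) (0, 0) := by
    ext i k; exact (dFst_dSnd_comm (hX i k) _).symm
  rw [e1, e2, e3, hXs', hXt', h1, dFst_dSnd_comm hf]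
  simp only [inv_one, zero_mul, zero_add, one_mul, Matrix.trace_add, neg_mul, Matrix.trace_neg]
  rw [← Matrix.mul_assoc Xs, Matrix.mul_assoc Xt P Xs |>.symm, Matrix.trace_mul_cycle Xs P Xt,
    Matrix.trace_mul_cycle Xt P Xs]
  have c1 := Matrix.trace_mul_cycle Xt Xs P
  have c2 := Matrix.trace_mul_cycle Xs Xt P
  rw [c1, c2]
  ring

end MatrixDeriv

/-! ### Curvature of the family of lines `Λ^{n,0}` at a point -/

section Curvature

variable {E : Type*} [AddCommGroup E] [Module ℝ E]

section Matrices

variable {ι : Type*} [Fintype ι] [DecidableEq ι] (v : Module.Basis ι ℝ E)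

/-- The matrix of a real endomorphism, with complex entries. -/
def cMatrix (T : E →ₗ[ℝ] E) : Matrix ι ι ℂ := (LinearMap.toMatrix v v T).map ((↑) : ℝ → ℂ)

/-- The components of complex valued forms on a real basis. -/
def formMatrix {κ : Type*} (ξ : κ → E →ₗ[ℝ] ℂ) : Matrix κ ι ℂ := Matrix.of fun i k => ξ i (v k)

theorem formMatrix_mul_cMatrix {κ : Type*} (ξ : κ → E →ₗ[ℝ] ℂ) (T : E →ₗ[ℝ] E) :
    formMatrix v ξ * cMatrix v T = formMatrix v fun i => ξ i ∘ₗ T := by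
  ext i k
  have h := congrArg (ξ i) (v.sum_repr (T (v k)))
  simp only [map_sum, map_smul] at h
  simp only [formMatrix, cMatrix, Matrix.mul_apply, Matrix.of_apply, Matrix.map_apply,
    LinearMap.comp_apply, ← h, LinearMap.toMatrix_apply]
  exact Finset.sum_congr rfl fun l _ => by rw [Complex.real_smul, mul_comm]

/-- The trace of the operator `X : α ↦ α ∘ T` of `Λ^{1,0}`, in terms of the matrices of `T` and `J`.
It is the trace of the operator `ξ ↦ (π^{1,0} ξ) ∘ T` on all complex valued forms, where
`π^{1,0} ξ = (ξ - i ξ ∘ J) / 2` is the projection along `Λ^{0,1}`. -/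
theorem trace_form10_comp {J : E →ₗ[ℝ] E} (hJ : ∀ v, J (J v) = -v) (T : E →ₗ[ℝ] E)
    (X : form10 J →ₗ[ℂ] form10 J) (hX : ∀ α v, (X α : E →ₗ[ℝ] ℂ) v = (α : E →ₗ[ℝ] ℂ) (T v)) :
    LinearMap.trace ℂ (form10 J) X =
      (((1 / 2 : ℂ) • (1 - Complex.I • cMatrix v J)) * cMatrix v T).trace := by
  have := Module.Finite.of_basis v
  let pr : (E →ₗ[ℝ] ℂ) →ₗ[ℂ] form10 J :=
    { toFun := fun ξ => ⟨(1 / 2 : ℂ) • (ξ - Complex.I • (ξ ∘ₗ J)), fun u => by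
        simp [hJ]; linear_combination (ξ (J u) / 2) * Complex.I_sq⟩
      map_add' := fun ξ ζ => by ext u; simp; ring
      map_smul' := fun c ξ => by ext u; simp; ring }
  have hpr : pr ∘ₗ (form10 J).subtype = LinearMap.id := by
    ext α u
    simp [pr, α.2 u]
    linear_combination (-(α : E →ₗ[ℝ] ℂ) u / 2) * Complex.I_sq
  have h1 : LinearMap.trace ℂ (form10 J) X =
      LinearMap.trace ℂ (E →ₗ[ℝ] ℂ) ((form10 J).subtype ∘ₗ (X ∘ₗ pr)) := by
    rw [LinearMap.trace_comp_comm', LinearMap.comp_assoc, hpr, LinearMap.comp_id]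
  rw [h1, ← LinearMap.trace_conj' _ (v.constr ℂ (M' := ℂ)).symm]
  set N := ((1 / 2 : ℂ) • (1 - Complex.I • cMatrix v J)) * cMatrix v T with hN
  have h2 : (v.constr ℂ (M' := ℂ)).symm.conj ((form10 J).subtype ∘ₗ (X ∘ₗ pr)) =
      Matrix.toLin' N.transpose := by
    refine LinearMap.ext fun c => ?_
    funext k
    set ξ := v.constr ℂ c with hξ
    have hc : ∀ l, ξ (v l) = c l := fun l => v.constr_basis ℂ c l
    have hrow : ∀ l, formMatrix v (fun _ : Unit => ξ) () l = c l := hc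
    have e1 : (formMatrix v (fun _ : Unit => ξ) * N) () k =
        ((1 / 2 : ℂ) • (ξ - Complex.I • (ξ ∘ₗ J))) (T (v k)) := by
      rw [hN, ← Matrix.mul_assoc, Matrix.mul_smul, Matrix.mul_sub, Matrix.mul_one,
        Matrix.mul_smul, formMatrix_mul_cMatrix, Matrix.smul_mul, Matrix.sub_mul, Matrix.smul_mul,
        formMatrix_mul_cMatrix, formMatrix_mul_cMatrix]
      rfl
    have e2 : ((v.constr ℂ (M' := ℂ)).symm.conj ((form10 J).subtype ∘ₗ (X ∘ₗ pr))) c k =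
        (X (pr ξ) : E →ₗ[ℝ] ℂ) (v k) := rfl
    rw [e2, hX, Matrix.toLin'_apply, Matrix.mulVec_transpose]
    refine e1.symm.trans ?_
    simp [Matrix.mul_apply, Matrix.vecMul, dotProduct, hrow]
  rw [h2, Matrix.trace_toLin'_eq, Matrix.trace_transpose]

/-- Half of the velocity of `J`, rotated: precomposition with it acts on `Λ^{1,0}` as the tangent
vector `η` and on `Λ^{0,1}` as its conjugate. -/
def halfVel (J A : E →ₗ[ℝ] E) : E →ₗ[ℝ] E := (-(1 / 2) : ℝ) • (J ∘ₗ A)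

theorem trace_graphMap_barMap {J A B : E →ₗ[ℝ] E} (hJ : ∀ v, J (J v) = -v)
    (hA : ∀ v, A (J v) = -J (A v)) (hB : ∀ v, B (J v) = -J (B v)) :
    LinearMap.trace ℂ (form01 J) (graphMap J A hA ∘ₗ barMap (graphMap J B hB)) =
      (((1 / 2 : ℂ) • (1 - Complex.I • cMatrix v J)) * cMatrix v (halfVel J A) *
        cMatrix v (halfVel J B)).trace := by
  have := Module.Finite.of_basis v
  rw [LinearMap.trace_comp_comm', Matrix.mul_assoc,
    show cMatrix v (halfVel J A) * cMatrix v (halfVel J B) =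
      cMatrix v (halfVel J A ∘ₗ halfVel J B) by
      ext i k; simp [cMatrix, LinearMap.toMatrix_comp v v v, Matrix.mul_apply]]
  refine trace_form10_comp v hJ _ _ fun α u => ?_
  have hα : ∀ u, (α : E →ₗ[ℝ] ℂ) (J u) = Complex.I * (α : E →ₗ[ℝ] ℂ) u := α.2
  have h1 : (halfVel J A ∘ₗ halfVel J B) u = (-(1 / 4) : ℝ) • J (J (A (B u))) := by
    simp [halfVel, hA, smul_smul]; norm_num
  rw [h1, map_smul, hα, hα]
  simp [barMap, graphMap, conj01, conj₁_apply, Complex.conj_ofNat]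
  ring

end Matrices

variable {n : ℕ}

/-- The curvature at a point of `M`: the ratio `θ w' ∧ conj (θ w) / θ w ∧ conj (θ w)`, where `θ w`
generates `Λ^{n,0}` of the complex structure `p w`, is differentiated in `w'` on the diagonal.
With `P w = (1 - J p w) / 2`, which is affine in `p w`, and a basis `a i` of `Λ^{1,0}` of `J`, the
forms `a i ∘ P w` are a basis of `Λ^{1,0}` of `p w`, and the pairing of the corresponding
decomposable forms is a determinant. -/
theorem curvature_of_generators (v : Module.Basis (Fin n ⊕ Fin n) ℝ E)
    {p : ℝ × ℝ → E →ₗ[ℝ] E} (hp : ∀ w u, p w (p w u) = -u)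
    (hs : ∀ w w', Function.Surjective (p w + p w'))
    (hpd : ∀ i k, ContDiff ℝ ∞ fun w => LinearMap.toMatrix v v (p w) i k)
    {θ : ℝ × ℝ → E [⋀^Fin n]→ₗ[ℝ] ℂ} (hθ : ∀ w, ∀ γ ∈ formN0 n (p w), ∃ c : ℂ, γ = c • θ w)
    (hθd : ∀ u, ContDiff ℝ ∞ fun w => θ w u)
    {J A B : E →ₗ[ℝ] E} (hJ : p (0, 0) = J)
    (hA : ∀ v, A (J v) = -J (A v)) (hB : ∀ v, B (J v) = -J (B v))
    (hpA : ∀ i k, HasDerivAt (fun s => LinearMap.toMatrix v v (p (s, 0)) i k)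
      (LinearMap.toMatrix v v A i k) 0)
    (hpB : ∀ i k, HasDerivAt (fun t => LinearMap.toMatrix v v (p (0, t)) i k)
      (LinearMap.toMatrix v v B i k) 0) {as at' : ℝ × ℝ → ℂ}
    (has : ∀ s t, HasDerivAt (fun s' => wedge (θ (s', t)) (conjN (θ (s, t))) v /
      wedge (θ (s, t)) (conjN (θ (s, t))) v) (as (s, t)) s)
    (hat : ∀ s t, HasDerivAt (fun t' => wedge (θ (s, t')) (conjN (θ (s, t))) v /
      wedge (θ (s, t)) (conjN (θ (s, t))) v) (at' (s, t)) t) {d d' : ℂ}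
    (hd : HasDerivAt (fun s => at' (s, 0)) d 0) (hd' : HasDerivAt (fun t => as (0, t)) d' 0) :
    (1 / 2) * (d - d') = halfTrace (graphMap J A hA) (graphMap J B hB) := by
  have := Module.Finite.of_basis v
  have hE : Module.finrank ℝ E = 2 * n := by
    rw [Module.finrank_eq_card_basis v]; simp; ring
  have hJ2 : ∀ u, J (J u) = -u := fun u => by rw [← hJ, hp]
  obtain ⟨a, ha, hla⟩ := exists_linearIndependent_form10 hE hJ2
  -- the projections `P w` and the bases `b w` of `Λ^{1,0}` of `p w`
  let P : ℝ × ℝ → E →ₗ[ℝ] E := fun w => (1 / 2 : ℝ) • (LinearMap.id - J ∘ₗ p w)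
  have hPs : ∀ w, Function.Surjective (P w) := fun w u => by
    obtain ⟨x, hx⟩ := hs (0, 0) w ((2 : ℝ) • J u)
    refine ⟨x, ?_⟩
    have hx' : J x + p w x = (2 : ℝ) • J u := by rw [← hx, ← hJ]; rfl
    have h2 : p w x = (2 : ℝ) • J u - J x := eq_sub_of_add_eq' hx'
    simp only [P, LinearMap.smul_apply, LinearMap.sub_apply, LinearMap.id_apply,
      LinearMap.comp_apply, h2, map_sub, map_smul, hJ2]
    module
  let b : ℝ × ℝ → Fin n → E →ₗ[ℝ] ℂ := fun w i => a i ∘ₗ P w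
  have hb : ∀ w i, b w i ∈ form10 (p w) := fun w i u => by
    have h1 : ∀ u, a i (J u) = Complex.I * a i u := ha i
    simp only [b, P, LinearMap.comp_apply, LinearMap.smul_apply, LinearMap.sub_apply,
      LinearMap.id_apply, map_sub, map_smul, hp, map_neg, h1, Complex.real_smul]
    push_cast
    linear_combination (1 / 2 * a i (p w u)) * Complex.I_sq
  have hlb : ∀ w, LinearIndependent ℂ (b w) := fun w => by
    have hinj : Function.Injective (fun ξ : E →ₗ[ℝ] ℂ => ξ ∘ₗ P w) := fun ξ ζ h => by
      ext u; obtain ⟨x, rfl⟩ := hPs w u; exact LinearMap.congr_fun h x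
    exact hla.map' ((LinearMap.lcomp ℂ ℂ (P w) : (E →ₗ[ℝ] ℂ) →ₗ[ℂ] (E →ₗ[ℝ] ℂ)))
      (LinearMap.ker_eq_bot.2 hinj)
  -- the pairing of the decomposable forms as a determinant
  let X : ℝ × ℝ → Matrix (Fin n ⊕ Fin n) (Fin n ⊕ Fin n) ℂ := fun w => cMatrix v (P w)
  set R : Matrix (Fin n ⊕ Fin n) (Fin n ⊕ Fin n) ℂ :=
    (1 / 2 : ℂ) • (1 - Complex.I • cMatrix v J) with hR
  set Q : Matrix (Fin n ⊕ Fin n) (Fin n ⊕ Fin n) ℂ :=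
    (1 / 2 : ℂ) • (1 + Complex.I • cMatrix v J) with hQ
  have hRQ : R + Q = 1 := by rw [hR, hQ]; module
  have hXJ : X (0, 0) = 1 := by
    have : P (0, 0) = LinearMap.id := by
      ext u
      simp only [P, hJ, LinearMap.smul_apply, LinearMap.sub_apply, LinearMap.id_apply,
        LinearMap.comp_apply, hJ2]
      module
    ext i k
    simp [X, this, cMatrix, Matrix.one_apply, apply_ite ((↑) : ℝ → ℂ)]
  set A₀ := formMatrix v (Sum.elim a fun i => conj₁ (a i)) with hA₀
  have hA₀R : A₀ * R = formMatrix v (Sum.elim a fun _ => 0) := by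
    rw [hA₀, hR, Matrix.mul_smul, Matrix.mul_sub, Matrix.mul_one, Matrix.mul_smul,
      formMatrix_mul_cMatrix]
    ext i k
    rcases i with i | i
    · have := ha i (v k)
      simp [formMatrix, this]
      linear_combination (-(1 / 2) * a i (v k)) * Complex.I_sq
    · have := conj₁_mem_form01 (ha i) (v k)
      simp [formMatrix, this]
      linear_combination (conj₁ (a i) (v k)) * Complex.I_sq
  have hA₀Q : A₀ * Q = formMatrix v (Sum.elim (fun _ => 0) fun i => conj₁ (a i)) := by
    have h1 : A₀ * Q = A₀ - A₀ * R := by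
      rw [eq_sub_iff_add_eq, ← Matrix.mul_add, add_comm, hRQ, Matrix.mul_one]
    rw [h1, hA₀R]
    ext i k
    rcases i with i | i <;> simp [hA₀, formMatrix]
  have hT : ∀ w' w, wedge (detForm (b w')) (conjN (detForm (b w))) v =
      A₀.det * (R * X w' + Q * X w).det := fun w' w => by
    rw [conjN_detForm, wedge_detForm, ← Matrix.det_mul, Matrix.mul_add, ← Matrix.mul_assoc,
      ← Matrix.mul_assoc, hA₀R, hA₀Q, formMatrix_mul_cMatrix, formMatrix_mul_cMatrix]
    congr 1
    ext i k
    rcases i with i | i <;> simp [formMatrix, b, conj₁_apply]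
  have hT0 : ∀ w' w, wedge (detForm (b w')) (conjN (detForm (b w))) v ≠ 0 := fun w' w => by
    rw [conjN_detForm, wedge_detForm]
    exact det_form10_conj_ne_zero (hs w w') (hb w) (hb w') (hlb w) (hlb w') v
  have hdet : ∀ w, (X w).det ≠ 0 := fun w => by
    have := hT0 w w
    rw [hT, ← add_mul, hRQ, one_mul] at this
    exact right_ne_zero_of_mul this
  -- the factor relating the given generators to the decomposable ones
  have hθ' : ∀ w, ∃ c : ℂ, c ≠ 0 ∧ θ w = c • detForm (b w) := fun w => by
    obtain ⟨c, hc⟩ := hθ w _ (detForm_mem_formN0 (hb w))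
    have hc0 : c ≠ 0 := by
      rintro rfl
      have := hT0 w w
      rw [hc, zero_smul, ← zero_smul ℂ (0 : E [⋀^Fin n]→ₗ[ℝ] ℂ), conjN_smul, wedge_smul_smul]
        at this
      simp at this
    exact ⟨c⁻¹, inv_ne_zero hc0, by rw [hc, inv_smul_smul₀ hc0]⟩
  choose f hf0 hf using hθ'
  have hXd : ∀ i k, ContDiff ℝ ∞ fun w => X w i k := fun i k => by
    have : (fun w => X w i k) = fun w => (((1 / 2 : ℝ) * ((1 : Matrix _ _ ℝ) i k -
        ∑ l, LinearMap.toMatrix v v J i l * LinearMap.toMatrix v v (p w) l k) : ℝ) : ℂ) := by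
      funext w
      simp only [X, P, cMatrix, Matrix.map_apply, map_smul, map_sub, LinearMap.toMatrix_id,
        LinearMap.toMatrix_comp v v v, Matrix.smul_apply, Matrix.sub_apply, Matrix.mul_apply,
        smul_eq_mul]
    rw [this]
    exact Complex.ofRealCLM.contDiff.comp (contDiff_const.mul (contDiff_const.sub
      (ContDiff.sum fun l _ => contDiff_const.mul (hpd l k))))
  have hKd : ∀ w₀ i k, ContDiff ℝ ∞ fun w => (R * X w + Q * X w₀) i k := fun w₀ i k => by
    simp only [Matrix.add_apply, Matrix.mul_apply]
    exact (ContDiff.sum fun l _ => contDiff_const.mul (hXd l k)).add contDiff_const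
  have hfd : ContDiff ℝ ∞ f := by
    have : f = fun w => wedge (θ w) (conjN (detForm (b (0, 0)))) v /
        (A₀.det * (R * X w + Q * X (0, 0)).det) := by
      funext w
      rw [← hT, eq_div_iff (hT0 _ _), hf w]
      conv_rhs => rw [← one_smul ℂ (detForm (b (0, 0))), conjN_smul, wedge_smul_smul]
      simp
    rw [this]
    have hnum : ContDiff ℝ ∞ fun w => wedge (θ w) (conjN (detForm (b (0, 0)))) v := by
      simp only [wedge_eq_sum]
      exact contDiff_const.mul (ContDiff.sum fun σ _ => contDiff_const.mul
        ((hθd _).mul contDiff_const))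
    have hden : ContDiff ℝ ∞ fun w => A₀.det * (R * X w + Q * X (0, 0)).det := by
      simp only [Matrix.det_apply']
      exact contDiff_const.mul (ContDiff.sum fun σ _ => contDiff_const.mul
        (contDiff_prod fun i _ => hKd _ _ _))
    have hne : ∀ w, A₀.det * (R * X w + Q * X (0, 0)).det ≠ 0 := fun w => hT w _ ▸ hT0 w _
    simp only [div_eq_mul_inv]
    exact hnum.mul (hden.inv hne)
  have hratio : ∀ w' w, wedge (θ w') (conjN (θ w)) v / wedge (θ w) (conjN (θ w)) v =
      f w' / f w * ((R * X w' + Q * X w).det / (X w).det) := fun w' w => by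
    have hA0 : A₀.det ≠ 0 := by
      have := hT0 w w
      rw [hT] at this
      exact left_ne_zero_of_mul this
    have hc : starRingEnd ℂ (f w) ≠ 0 := by simpa using hf0 w
    have h0 := hf0 w
    have hX0 := hdet w
    rw [hf w', hf w, conjN_smul, wedge_smul_smul, wedge_smul_smul, AlternatingMap.smul_apply,
      AlternatingMap.smul_apply, hT, hT, ← add_mul, hRQ, one_mul, smul_eq_mul, smul_eq_mul]
    field_simp
  simp only [hratio] at has hat
  have hvel : ∀ {C : E →ₗ[ℝ] E} {c : ℝ → ℝ × ℝ},
      (∀ i k, HasDerivAt (fun s => LinearMap.toMatrix v v (p (c s)) i k)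
        (LinearMap.toMatrix v v C i k) 0) → ∀ i k,
      HasDerivAt (fun s => X (c s) i k) (cMatrix v (halfVel J C) i k) 0 := by
    intro C c hC i k
    have h1 : HasDerivAt (fun s => (1 / 2 : ℝ) * ((1 : Matrix _ _ ℝ) i k -
        ∑ l, LinearMap.toMatrix v v J i l * LinearMap.toMatrix v v (p (c s)) l k))
        (LinearMap.toMatrix v v (halfVel J C) i k) 0 := by
      refine (((HasDerivAt.fun_sum fun l _ => (hC l k).const_mul _).const_sub _).const_mul
        (1 / 2 : ℝ)).congr_deriv ?_
      simp only [halfVel, map_smul, LinearMap.toMatrix_comp v v v, Matrix.smul_apply,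
        Matrix.mul_apply, smul_eq_mul]
      ring
    refine (h1.ofReal_comp).congr_of_eventuallyEq (Filter.Eventually.of_forall fun s => ?_)
    simp only [X, P, cMatrix, Matrix.map_apply, map_smul, map_sub, LinearMap.toMatrix_id,
      LinearMap.toMatrix_comp v v v, Matrix.smul_apply, Matrix.sub_apply, Matrix.mul_apply,
      smul_eq_mul]
  have hmain := curvature_det hXd hdet hXJ hfd hf0 hRQ has hat (hvel hpA) (hvel hpB) hd hd'
  have hsub : ∀ S T : form01 J →ₗ[ℂ] form01 J, LinearMap.trace ℂ (form01 J) (S - T) =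
      LinearMap.trace ℂ (form01 J) S - LinearMap.trace ℂ (form01 J) T := fun S T => map_sub _ S T
  rw [halfTrace, hsub, trace_graphMap_barMap v hJ2 hA hB, trace_graphMap_barMap v hJ2 hB hA,
    ← hR, hmain]

end Curvature

/-! ### Smooth families of functions on a manifold -/

section ParametricIntegral

open MeasureTheory Set Topology

variable {E F : Type} [NormedAddCommGroup E] [NormedSpace ℝ E] [FiniteDimensional ℝ E]
  [NormedAddCommGroup F] [NormedSpace ℝ F]

theorem hasFDerivAt_intervalIntegral_of_contDiffOn {K : ℝ × E → F} {V : Set E}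
    (hV : IsOpen V) (hK : ContDiffOn ℝ 1 K (univ ×ˢ V)) {z : E} (hz : z ∈ V) :
    HasFDerivAt (fun z => ∫ τ in (0 : ℝ)..1, K (τ, z))
      (∫ τ in (0 : ℝ)..1, (fderiv ℝ K (τ, z)).comp (ContinuousLinearMap.inr ℝ ℝ E)) z := by
  have hopen : IsOpen ((univ : Set ℝ) ×ˢ V) := isOpen_univ.prod hV
  have hcK : ContinuousOn K (univ ×ˢ V) := hK.continuousOn
  have hcK' : ContinuousOn (fun p => (fderiv ℝ K p).comp (ContinuousLinearMap.inr ℝ ℝ E))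
      (univ ×ˢ V) :=
    ((hK.continuousOn_fderiv_of_isOpen hopen (by simp)).clm_comp continuousOn_const)
  have hline : ∀ x ∈ V, ∀ {X : Type} [TopologicalSpace X] {G : ℝ × E → X},
      ContinuousOn G (univ ×ˢ V) → Continuous fun τ => G (τ, x) := fun x hx X _ G hG =>
    hG.comp_continuous (by fun_prop) fun τ => ⟨mem_univ _, hx⟩
  obtain ⟨r, hr, hrV⟩ := Metric.nhds_basis_closedBall.mem_iff.1 (hV.mem_nhds hz)
  have hcomp : IsCompact (Icc (0 : ℝ) 1 ×ˢ Metric.closedBall z r) :=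
    isCompact_Icc.prod (isCompact_closedBall z r)
  obtain ⟨C, hC⟩ := hcomp.exists_bound_of_continuousOn
    (hcK'.mono (prod_mono (subset_univ _) hrV))
  refine intervalIntegral.hasFDerivAt_integral_of_dominated_of_fderiv_le
    (bound := fun _ => C) (Metric.closedBall_mem_nhds z hr) ?_ ?_ ?_ ?_ ?_ ?_
    (F := fun z τ => K (τ, z))
    (F' := fun z τ => (fderiv ℝ K (τ, z)).comp (ContinuousLinearMap.inr ℝ ℝ E))
  · filter_upwards [hV.mem_nhds hz] with x hx
    exact (hline x hx hcK).aestronglyMeasurable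
  · exact (hline z hz hcK).intervalIntegrable _ _
  · exact (hline z hz hcK').aestronglyMeasurable
  · refine Filter.Eventually.of_forall fun τ hτ x hx => hC (τ, x) ⟨?_, hx⟩
    rw [uIoc_of_le zero_le_one] at hτ
    exact Ioc_subset_Icc_self hτ
  · exact intervalIntegrable_const
  · refine Filter.Eventually.of_forall fun τ _ x hx => ?_
    have h1 : HasFDerivAt K (fderiv ℝ K (τ, x)) (τ, x) :=
      ((hK.differentiableOn (by simp)).differentiableAt
        (hopen.mem_nhds ⟨mem_univ _, hrV hx⟩)).hasFDerivAt
    exact h1.comp x (hasFDerivAt_prodMk_right τ x)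

theorem contDiffOn_intervalIntegral {K : ℝ × E → F} {V : Set E} (hV : IsOpen V)
    (hK : ContDiffOn ℝ ∞ K (univ ×ˢ V)) :
    ContDiffOn ℝ ∞ (fun z => ∫ τ in (0 : ℝ)..1, K (τ, z)) V := by
  rw [contDiffOn_infty]
  intro m
  induction m generalizing F with
  | zero =>
    refine contDiffOn_zero.2 fun z hz => ?_
    exact (hasFDerivAt_intervalIntegral_of_contDiffOn hV (hK.of_le (by simp)) hz
      ).continuousAt.continuousWithinAt
  | succ m ih =>
    have hd := fun z (hz : z ∈ V) =>
      hasFDerivAt_intervalIntegral_of_contDiffOn hV (hK.of_le (by simp)) hz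
    push_cast
    rw [contDiffOn_succ_iff_fderiv_of_isOpen hV]
    refine ⟨fun z hz => (hd z hz).differentiableAt.differentiableWithinAt, by simp, ?_⟩
    refine ContDiffOn.congr (ih (K := fun p => (fderiv ℝ K p).comp
      (ContinuousLinearMap.inr ℝ ℝ E)) ?_) fun z hz => (hd z hz).fderiv
    exact (hK.fderiv_of_isOpen (isOpen_univ.prod hV) (m := ∞) (by simp)).clm_comp contDiffOn_const

variable {H : Type*} [TopologicalSpace H] {I : ModelWithCorners ℝ E H} [I.Boundaryless]
  {N : Type*} [TopologicalSpace N] [ChartedSpace H N] [IsManifold I ∞ N]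

/-- The integral over `[0, 1]` of a smooth family of functions on a manifold is smooth. -/
theorem contMDiffOn_intervalIntegral {K : ℝ × N → F} {V : Set N} (hV : IsOpen V)
    (hK : ContMDiffOn (𝓘(ℝ, ℝ).prod I) 𝓘(ℝ, F) ∞ K (univ ×ˢ V)) :
    ContMDiffOn I 𝓘(ℝ, F) ∞ (fun z => ∫ τ in (0 : ℝ)..1, K (τ, z)) V := by
  intro z₀ hz₀
  refine ContMDiffAt.contMDiffWithinAt ?_
  set e := extChartAt I z₀
  have ht : IsOpen (e.target ∩ e.symm ⁻¹' V) :=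
    (continuousOn_extChartAt_symm z₀).isOpen_inter_preimage (isOpen_extChartAt_target z₀) hV
  have h1 : ContDiffOn ℝ ∞ (fun y => ∫ τ in (0 : ℝ)..1, K (τ, e.symm y))
      (e.target ∩ e.symm ⁻¹' V) := by
    refine contDiffOn_intervalIntegral (K := fun p : ℝ × E => K (p.1, e.symm p.2)) ht ?_
    rw [← contMDiffOn_iff_contDiffOn]
    have hp : ContMDiffOn 𝓘(ℝ, ℝ × E) (𝓘(ℝ, ℝ).prod I) ∞ (fun p : ℝ × E => (p.1, e.symm p.2))
        (univ ×ˢ (e.target ∩ e.symm ⁻¹' V)) :=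
      contDiff_fst.contMDiff.contMDiffOn.prodMk ((contMDiffOn_extChartAt_symm z₀).comp
        contDiff_snd.contMDiff.contMDiffOn fun p hp => hp.2.1)
    exact hK.comp hp fun p hp => ⟨mem_univ _, hp.2.2⟩
  have h2 : ContMDiffAt I 𝓘(ℝ, F) ∞
      ((fun y => ∫ τ in (0 : ℝ)..1, K (τ, e.symm y)) ∘ e) z₀ := by
    refine ContMDiffAt.comp z₀ (I' := 𝓘(ℝ, E)) ?_ contMDiffAt_extChartAt
    refine ((h1.contMDiffOn).contMDiffAt (ht.mem_nhds ⟨mem_extChartAt_target z₀, ?_⟩))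
    simpa [e] using hz₀
  refine h2.congr_of_eventuallyEq ?_
  filter_upwards [extChartAt_source_mem_nhds (I := I) z₀] with x hx
  change _ = ∫ τ in (0 : ℝ)..1, K (τ, e.symm (e x))
  rw [(extChartAt I z₀).left_inv hx]

end ParametricIntegral

section PartialDerivative

open Set Topology

variable {W F : Type} [NormedAddCommGroup W] [NormedSpace ℝ W]
  [NormedAddCommGroup F] [NormedSpace ℝ F]
  {E : Type*} [NormedAddCommGroup E] [NormedSpace ℝ E]
  {H : Type*} [TopologicalSpace H] {I : ModelWithCorners ℝ E H}
  {N : Type*} [TopologicalSpace N] [ChartedSpace H N]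

theorem contDiffAt_fst_of_contMDiffAt {f : W × N → F} {z₀ : W × N}
    (hf : ContMDiffAt (𝓘(ℝ, W).prod I) 𝓘(ℝ, F) ∞ f z₀) :
    ContDiffAt ℝ ∞ (fun w => f (w, z₀.2)) z₀.1 := by
  rw [← contMDiffAt_iff_contDiffAt]
  exact ContMDiffAt.comp z₀.1 (g := f) (f := fun w => (w, z₀.2)) hf
    (contMDiffAt_id.prodMk contMDiffAt_const)

variable [IsManifold I ∞ N]

/-- The partial derivatives with respect to the parameter of a smooth family of functions on a
manifold are jointly smooth. -/
theorem contMDiffAt_fderiv_fst {f : W × N → F} {z₀ : W × N}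
    (hf : ContMDiffAt (𝓘(ℝ, W).prod I) 𝓘(ℝ, F) ∞ f z₀) :
    ContMDiffAt (𝓘(ℝ, W).prod I) 𝓘(ℝ, W →L[ℝ] F) ∞
      (fun z => fderiv ℝ (fun w => f (w, z.2)) z.1) z₀ := by
  have h := ContMDiffAt.mfderiv (I := 𝓘(ℝ, W)) (I' := 𝓘(ℝ, F)) (J := 𝓘(ℝ, W).prod I) (x₀ := z₀)
    (m := ∞) (n := ∞)
    (fun (z : W × N) (w : W) => f (w, z.2)) (fun z => z.1) ?_ contMDiffAt_fst (by simp)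
  · have h' := inTangentCoordinates_model_space (I := 𝓘(ℝ, W)) (I' := 𝓘(ℝ, F))
      (fun z : W × N => z.1) (fun z => f z)
      (fun z => fderiv ℝ (fun w => f (w, z.2)) z.1) z₀
    simp only [mfderiv_eq_fderiv] at h
    exact (congrArg (fun φ => ContMDiffAt (𝓘(ℝ, W).prod I) 𝓘(ℝ, W →L[ℝ] F) ∞ φ z₀) h').mp h
  · have h1 : ContMDiffAt ((𝓘(ℝ, W).prod I).prod 𝓘(ℝ, W)) (𝓘(ℝ, W).prod I) ∞
        (fun q : (W × N) × W => (q.2, q.1.2)) (z₀, z₀.1) :=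
      contMDiffAt_snd.prodMk (contMDiffAt_snd.comp _ contMDiffAt_fst)
    exact ContMDiffAt.comp (z₀, z₀.1) (g := f) hf h1

theorem contMDiffOn_fderiv_fst {f : W × N → F} {S : Set (W × N)} (hS : IsOpen S)
    (hf : ContMDiffOn (𝓘(ℝ, W).prod I) 𝓘(ℝ, F) ∞ f S) (w₀ : W) :
    ContMDiffOn (𝓘(ℝ, W).prod I) 𝓘(ℝ, F) ∞
      (fun z => fderiv ℝ (fun w => f (w, z.2)) z.1 w₀) S := fun z hz => by
  have h := contMDiffAt_fderiv_fst (hf.contMDiffAt (hS.mem_nhds hz))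
  exact (((ContinuousLinearMap.apply ℝ F w₀).contDiff.contMDiff.contMDiffAt).comp z
    h).contMDiffWithinAt

end PartialDerivative

section Hadamard

open Set Topology MeasureTheory

variable {E F : Type} [NormedAddCommGroup E] [NormedSpace ℝ E] [FiniteDimensional ℝ E]
  [NormedAddCommGroup F] [NormedSpace ℝ F] [CompleteSpace F]
  {H : Type*} [TopologicalSpace H] {I : ModelWithCorners ℝ E H} [I.Boundaryless]
  {N : Type*} [TopologicalSpace N] [ChartedSpace H N] [IsManifold I ∞ N]

/-- Hadamard's lemma: the quotient by the time of a smooth family that vanishes to second order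
at time `0` is smooth. The quotient takes the value `0` at time `0`. -/
theorem contMDiffOn_inv_smul {f : ℝ × N → F} {V : Set N} (hV : IsOpen V)
    (hf : ContMDiffOn (𝓘(ℝ, ℝ).prod I) 𝓘(ℝ, F) ∞ f (univ ×ˢ V)) (h0 : ∀ x ∈ V, f (0, x) = 0)
    (h1 : ∀ x ∈ V, HasDerivAt (fun t => f (t, x)) 0 0) :
    ContMDiffOn (𝓘(ℝ, ℝ).prod I) 𝓘(ℝ, F) ∞ (fun z => z.1⁻¹ • f z) (univ ×ˢ V) := by
  have hopen : IsOpen ((univ : Set ℝ) ×ˢ V) := isOpen_univ.prod hV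
  set g : ℝ × N → F := fun z => fderiv ℝ (fun w => f (w, z.2)) z.1 1 with hg
  have hgs : ContMDiffOn (𝓘(ℝ, ℝ).prod I) 𝓘(ℝ, F) ∞ g (univ ×ˢ V) :=
    contMDiffOn_fderiv_fst hopen hf 1
  have hfd : ∀ t, ∀ x ∈ V, HasDerivAt (fun t => f (t, x)) (g (t, x)) t := fun t x hx =>
    ((contDiffAt_fst_of_contMDiffAt (hf.contMDiffAt (hopen.mem_nhds
      (mk_mem_prod (mem_univ t) hx)))).differentiableAt (by simp)).hasFDerivAt.hasDerivAt
  have hgc : ∀ x ∈ V, Continuous fun t => g (t, x) := fun x hx =>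
    hgs.continuousOn.comp_continuous (by fun_prop) fun t => ⟨mem_univ _, hx⟩
  have hK : ContMDiffOn (𝓘(ℝ, ℝ).prod (𝓘(ℝ, ℝ).prod I)) 𝓘(ℝ, F) ∞
      (fun q : ℝ × (ℝ × N) => g (q.1 * q.2.1, q.2.2)) (univ ×ˢ (univ ×ˢ V)) := by
    refine hgs.comp (f := fun q : ℝ × (ℝ × N) => (q.1 * q.2.1, q.2.2)) ?_
      fun q hq => ⟨mem_univ _, hq.2.2⟩
    refine ContMDiff.contMDiffOn ?_
    refine ContMDiff.prodMk ?_ (contMDiff_snd.comp contMDiff_snd)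
    exact (contDiff_mul (𝕜 := ℝ) (𝔸 := ℝ)).contMDiff.comp
      (contMDiff_fst.prodMk_space (contMDiff_fst.comp contMDiff_snd))
  refine (contMDiffOn_intervalIntegral hopen hK).congr ?_
  rintro ⟨t, x⟩ ⟨-, hx⟩
  change t⁻¹ • f (t, x) = ∫ τ in (0 : ℝ)..1, g (τ * t, x)
  by_cases ht : t = 0
  · subst ht
    have : g (0, x) = 0 := (hfd 0 x hx).unique (h1 x hx)
    simp [this]
  · have hftc : ∫ s in (0 : ℝ)..t, g (s, x) = f (t, x) := by
      rw [intervalIntegral.integral_eq_sub_of_hasDerivAt (fun s _ => hfd s x hx)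
        ((hgc x hx).intervalIntegrable _ _), h0 x hx, sub_zero]
    have := intervalIntegral.integral_comp_mul_right (a := 0) (b := 1)
      (fun s => g (s, x)) ht
    rw [this, zero_mul, one_mul, hftc]

end Hadamard

/-! ### Fields of endomorphisms in coordinates -/

section Coordinates

open Set

variable {n : ℕ} {M : Type*} [TopologicalSpace M] [ChartedSpace (Mod n) M]
  [IsManifold (𝓡 (2 * n)) ∞ M]

/-- The domain of the chart of `M` at `x₀`. -/
abbrev src (n : ℕ) {M : Type*} [TopologicalSpace M] [ChartedSpace (Mod n) M] (x₀ : M) : Set M :=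
  (chartAt (Mod n) x₀).source

/-- The coordinates of tangent vectors, inverse to `coordVec`. -/
def vecCoord (x₀ x : M) : Tan n x →L[ℝ] Mod n :=
  (trivializationAt (Mod n) (TangentSpace (𝓡 (2 * n)) : M → Type) x₀).continuousLinearMapAt ℝ x

/-- `coordVec` as a linear map. -/
def coordVecL (x₀ x : M) : Mod n →L[ℝ] Tan n x :=
  (trivializationAt (Mod n) (TangentSpace (𝓡 (2 * n)) : M → Type) x₀).symmL ℝ x

theorem coordVecL_apply (x₀ x : M) (v : Mod n) : coordVecL x₀ x v = coordVec x₀ v x := rfl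

theorem vecCoord_coordVecL {x₀ x : M} (hx : x ∈ src n x₀) (v : Mod n) :
    vecCoord x₀ x (coordVecL x₀ x v) = v :=
  Bundle.Trivialization.continuousLinearMapAt_symmL _ hx v

theorem coordVecL_vecCoord {x₀ x : M} (hx : x ∈ src n x₀) (v : Tan n x) :
    coordVecL x₀ x (vecCoord x₀ x v) = v :=
  Bundle.Trivialization.symmL_continuousLinearMapAt _ hx v

/-- The matrix of an endomorphism of a tangent space in the chart at `x₀`. -/
def coordEnd (x₀ x : M) (A : Tan n x →L[ℝ] Tan n x) : Mod n →L[ℝ] Mod n :=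
  (vecCoord x₀ x).comp (A.comp (coordVecL x₀ x))

theorem coordEnd_apply (x₀ x : M) (A : Tan n x →L[ℝ] Tan n x) (v : Mod n) :
    coordEnd x₀ x A v = vecCoord x₀ x (A (coordVecL x₀ x v)) := rfl

theorem coordEnd_comp {x₀ x : M} (hx : x ∈ src n x₀) (A B : Tan n x →L[ℝ] Tan n x) :
    coordEnd x₀ x (A.comp B) = (coordEnd x₀ x A).comp (coordEnd x₀ x B) := by
  ext1 v
  simp only [coordEnd_apply, ContinuousLinearMap.comp_apply, coordVecL_vecCoord hx]

theorem coordEnd_id {x₀ x : M} (hx : x ∈ src n x₀) :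
    coordEnd x₀ x (ContinuousLinearMap.id ℝ (Tan n x)) = ContinuousLinearMap.id ℝ _ := by
  ext1 v
  simp only [coordEnd_apply, ContinuousLinearMap.id_apply, vecCoord_coordVecL hx]

theorem coordEnd_add (x₀ x : M) (A B : Tan n x →L[ℝ] Tan n x) :
    coordEnd x₀ x (A + B) = coordEnd x₀ x A + coordEnd x₀ x B := by
  ext1 v; simp [coordEnd_apply]

theorem coordEnd_sub (x₀ x : M) (A B : Tan n x →L[ℝ] Tan n x) :
    coordEnd x₀ x (A - B) = coordEnd x₀ x A - coordEnd x₀ x B := by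
  ext1 v; simp [coordEnd_apply]

theorem coordEnd_smul (x₀ x : M) (c : ℝ) (A : Tan n x →L[ℝ] Tan n x) :
    coordEnd x₀ x (c • A) = c • coordEnd x₀ x A := by
  ext1 v; simp [coordEnd_apply]

section Smooth

variable {E H Z : Type*} [NormedAddCommGroup E] [NormedSpace ℝ E] [TopologicalSpace H]
  {I : ModelWithCorners ℝ E H} [TopologicalSpace Z] [ChartedSpace H Z]

theorem contMDiffAt_end_iff {b : Z → M} {A : ∀ z, Tan n (b z) →L[ℝ] Tan n (b z)} {z₀ : Z} {x₀ : M}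
    (hx : b z₀ ∈ src n x₀) :
    ContMDiffAt I ((𝓡 (2 * n)).prod 𝓘(ℝ, Mod n →L[ℝ] Mod n)) ∞
      (fun z => (TotalSpace.mk' (Mod n →L[ℝ] Mod n) (b z) (A z) :
        TotalSpace (Mod n →L[ℝ] Mod n) (fun x : M => Tan n x →L[ℝ] Tan n x))) z₀ ↔
      ContMDiffAt I (𝓡 (2 * n)) ∞ b z₀ ∧
      ContMDiffAt I 𝓘(ℝ, Mod n →L[ℝ] Mod n) ∞ (fun z => coordEnd x₀ (b z) (A z)) z₀ := by
  refine (Bundle.Trivialization.contMDiffAt_iff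
    (e := trivializationAt (Mod n →L[ℝ] Mod n) (fun x : M => Tan n x →L[ℝ] Tan n x) x₀)
    (IB := 𝓡 (2 * n)) ?_)
  rw [hom_trivializationAt_source]
  exact ⟨hx, hx⟩

end Smooth

variable (Ω : SymplecticForm n M)

/-- The symplectic form in the chart at `x₀`. -/
def coordForm (x₀ x : M) : Mod n →L[ℝ] Mod n →L[ℝ] ℝ :=
  (trivializationAt (Mod n →L[ℝ] Mod n →L[ℝ] ℝ)
    (fun x : M => Tan n x →L[ℝ] Tan n x →L[ℝ] ℝ) x₀ ⟨x, Ω.form x⟩).2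

theorem coordForm_apply {x₀ x : M} (hx : x ∈ src n x₀) (v w : Mod n) :
    coordForm Ω x₀ x v w = Ω.form x (coordVec x₀ v x) (coordVec x₀ w x) := by
  have h := inCoordinates_apply_eq₂ (F₁ := Mod n) (F₂ := Mod n) (F₃ := ℝ)
    (E₁ := fun x : M => Tan n x) (E₂ := fun x : M => Tan n x) (E₃ := Bundle.Trivial M ℝ)
    (ϕ := Ω.form x) (x₀ := x₀) (v := v) (w := w) hx hx (by simp)
  refine Eq.trans ?_ (h.trans ?_)
  · rfl
  · have hx' : x ∈ (trivializationAt (Mod n) (TangentSpace (𝓡 (2 * n)) : M → Type) x₀).baseSet := hx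
    simp only [coordVec, Bundle.Trivialization.symmL_apply _ hx']
    simp

set_option synthInstance.maxHeartbeats 200000 in
theorem contMDiffOn_coordForm (x₀ : M) :
    ContMDiffOn (𝓡 (2 * n)) 𝓘(ℝ, Mod n →L[ℝ] Mod n →L[ℝ] ℝ) ∞ (coordForm Ω x₀) (src n x₀) := by
  intro x hx
  have h : x ∈ (trivializationAt (Mod n →L[ℝ] ℝ)
      (fun x : M => Tan n x →L[ℝ] Bundle.Trivial M ℝ x) x₀).baseSet := by
    rw [hom_trivializationAt_baseSet]; exact ⟨hx, by simp⟩
  refine (((Bundle.Trivialization.contMDiffAt_iff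
    (e := trivializationAt (Mod n →L[ℝ] Mod n →L[ℝ] ℝ)
      (fun x : M => Tan n x →L[ℝ] Tan n x →L[ℝ] ℝ) x₀)
    (IB := 𝓡 (2 * n)) ?_).1 (Ω.smooth x)).2).contMDiffWithinAt
  rw [hom_trivializationAt_source]
  exact ⟨hx, h⟩

end Coordinates

/-! ### The Cayley transform -/

section Cayley

variable {E : Type*} [AddCommGroup E] [Module ℝ E] [TopologicalSpace E]

/-- `J` is a complex structure compatible with `om` and positive. -/
structure IsCompat (om : E →L[ℝ] E →L[ℝ] ℝ) (J : E →L[ℝ] E) : Prop where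
  sq : ∀ v, J (J v) = -v
  compatible : ∀ v w, om (J v) (J w) = om v w
  positive : ∀ v, v ≠ 0 → 0 < om v (J v)

/-- `S` is an infinitesimal symplectic transformation that anticommutes with `J`. -/
structure IsTangent (om : E →L[ℝ] E →L[ℝ] ℝ) (J S : E →L[ℝ] E) : Prop where
  anti : ∀ v, S (J v) = -J (S v)
  symplectic : ∀ v w, om (S v) w = -om v (S w)

theorem IsCompat.skew {om : E →L[ℝ] E →L[ℝ] ℝ} {J : E →L[ℝ] E} (h : IsCompat om J) (v w : E) :
    om (J v) w = -om v (J w) := by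
  rw [← h.compatible v (J w), h.sq, map_neg, neg_neg]

theorem IsCompat.add_injective {om : E →L[ℝ] E →L[ℝ] ℝ} {J J' : E →L[ℝ] E} (h : IsCompat om J)
    (h' : IsCompat om J') {v : E} (hv : J v + J' v = 0) : v = 0 := by
  by_contra h0
  have h1 := add_pos (h.positive v h0) (h'.positive v h0)
  rw [← map_add, hv, map_zero] at h1
  exact lt_irrefl _ h1

theorem IsTangent.add [IsTopologicalAddGroup E] {om : E →L[ℝ] E →L[ℝ] ℝ} {J S T : E →L[ℝ] E}
    (hS : IsTangent om J S) (hT : IsTangent om J T) : IsTangent om J (S + T) where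
  anti v := by simp [hS.anti, hT.anti]; abel
  symplectic v w := by simp [hS.symplectic, hT.symplectic]; ring

theorem IsTangent.smul [ContinuousConstSMul ℝ E] {om : E →L[ℝ] E →L[ℝ] ℝ} {J S : E →L[ℝ] E}
    (hS : IsTangent om J S) (c : ℝ) : IsTangent om J (c • S) where
  anti v := by simp [hS.anti]
  symplectic v w := by simp [hS.symplectic]

variable [IsTopologicalAddGroup E]

/-- The structure `(1 + S) J (1 + S)⁻¹`, defined by `Ring.inverse` when `1 + S` is invertible. -/
def cayleyJ (J S : E →L[ℝ] E) : E →L[ℝ] E := (1 + S) * J * Ring.inverse (1 + S)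

/-- The operator `S` such that `J' = (1 + S) J (1 + S)⁻¹` and `S` anticommutes with `J`. These
conditions amount to `(J + J') S = J - J'`, and `J + J'` is invertible for positive structures. -/
def cayleyS (J J' : E →L[ℝ] E) : E →L[ℝ] E := Ring.inverse (J + J') * (J - J')

section Unit

variable [ContinuousSMul ℝ E] [T2Space E] [FiniteDimensional ℝ E]

theorem isUnit_of_injective {A : E →L[ℝ] E} (h : ∀ v, A v = 0 → v = 0) : IsUnit A := by
  have hA : Function.Injective (A : E →ₗ[ℝ] E) := (injective_iff_map_eq_zero _).2 h
  let e := (LinearEquiv.ofInjectiveEndo (A : E →ₗ[ℝ] E) hA)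
  let B : E →L[ℝ] E := LinearMap.toContinuousLinearMap (e.symm : E →ₗ[ℝ] E)
  refine ⟨⟨A, B, ?_, ?_⟩, rfl⟩
  · ext v; exact e.apply_symm_apply v
  · ext v; exact e.symm_apply_apply v

variable {om : E →L[ℝ] E →L[ℝ] ℝ} {J J' S : E →L[ℝ] E}

theorem IsCompat.isUnit_add (h : IsCompat om J) (h' : IsCompat om J') : IsUnit (J + J') :=
  isUnit_of_injective fun _ hv => h.add_injective h' hv

theorem IsCompat.add_cayleyS (h : IsCompat om J) (h' : IsCompat om J') (v : E) :
    J (cayleyS J J' v) + J' (cayleyS J J' v) = J v - J' v :=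
  DFunLike.congr_fun (Ring.mul_inverse_cancel_left (J + J') (J - J') (h.isUnit_add h')) v

theorem IsCompat.cayleyS_anti (h : IsCompat om J) (h' : IsCompat om J') (v : E) :
    cayleyS J J' (J v) = -J (cayleyS J J' v) := by
  set S := cayleyS J J'
  have e1 := h.add_cayleyS h' (J v)
  have e2 := congrArg J' (h.add_cayleyS h' v)
  have h0 : J (S (J v) + J (S v)) + J' (S (J v) + J (S v)) = 0 := by
    simp only [map_add, map_sub, h.sq, h'.sq] at e1 e2 ⊢
    linear_combination (norm := module) e1 + e2
  exact eq_neg_of_add_eq_zero_left (h.add_injective h' h0)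

theorem IsCompat.cayleyS_add (h : IsCompat om J) (h' : IsCompat om J') (v : E) :
    cayleyS J J' (J v + J' v) = J' v - J v := by
  set S := cayleyS J J'
  have e1 := h.add_cayleyS h' (J v + J' v)
  have h0 : J (S (J v + J' v) - (J' v - J v)) + J' (S (J v + J' v) - (J' v - J v)) = 0 := by
    simp only [map_add, map_sub, h.sq, h'.sq] at e1 ⊢
    linear_combination (norm := module) e1
  exact sub_eq_zero.1 (h.add_injective h' h0)

theorem IsCompat.isTangent_cayleyS (h : IsCompat om J) (h' : IsCompat om J') :
    IsTangent om J (cayleyS J J') where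
  anti := h.cayleyS_anti h'
  symplectic v w := by
    obtain ⟨B, hB⟩ := (h.isUnit_add h').exists_right_inv
    have hw : J (B w) + J' (B w) = w := DFunLike.congr_fun hB w
    rw [← hw, h.cayleyS_add h']
    simp only [map_add, map_sub]
    have e := congrArg (fun u => om u (B w)) (h.add_cayleyS h' v)
    simp only [map_add, map_sub, add_apply, sub_apply,
      h.skew, h'.skew] at e
    linarith

theorem IsCompat.isUnit_one_add_cayleyS (h : IsCompat om J) (h' : IsCompat om J') :
    IsUnit (1 + cayleyS J J') := by
  refine isUnit_of_injective fun v hv => ?_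
  have hv' : cayleyS J J' v = -v := eq_neg_of_add_eq_zero_right hv
  have e := h.add_cayleyS h' v
  rw [hv'] at e
  simp only [map_neg] at e
  have h2 : (2 : ℝ) • J v = 0 := by linear_combination (norm := module) -e
  have h3 := (smul_eq_zero.1 h2).resolve_left two_ne_zero
  have := h.sq v
  rw [h3, map_zero] at this
  exact neg_eq_zero.1 this.symm

theorem IsCompat.cayleyJ_cayleyS (h : IsCompat om J) (h' : IsCompat om J') :
    cayleyJ J (cayleyS J J') = J' := by
  have hu := h.isUnit_one_add_cayleyS h'
  have e : (1 + cayleyS J J') * J = J' * (1 + cayleyS J J') := by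
    ext v
    have e1 := h.add_cayleyS h' v
    have e2 := h.cayleyS_anti h' v
    change J v + cayleyS J J' (J v) = J' (v + cayleyS J J' v)
    rw [e2, map_add]
    linear_combination (norm := module) -e1
  rw [cayleyJ, e, mul_assoc, Ring.mul_inverse_cancel _ hu, mul_one]

theorem isUnit_one_add_of_pos (hpos : ∀ v, v ≠ 0 → 0 < om v (J (v - S (S v)))) :
    IsUnit (1 + S) := by
  refine isUnit_of_injective fun v hv => ?_
  have hv' : S v = -v := eq_neg_of_add_eq_zero_right hv
  by_contra h0
  have := hpos v h0
  simp [hv'] at this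

/-- The Cayley transform of a tangent operator `S` is a positive compatible structure when
`1 - S²` is positive. -/
theorem IsTangent.isCompat_cayleyJ (h : IsCompat om J) (hS : IsTangent om J S)
    (hpos : ∀ v, v ≠ 0 → 0 < om v (J (v - S (S v)))) : IsCompat om (cayleyJ J S) := by
  have hu := isUnit_one_add_of_pos hpos
  have hsurj : ∀ v, ∃ u, v = u + S u := fun v => by
    obtain ⟨B, hB⟩ := hu.exists_right_inv
    exact ⟨B v, (DFunLike.congr_fun hB v).symm⟩
  have hJ : ∀ u, cayleyJ J S (u + S u) = J u + S (J u) := fun u => by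
    have : cayleyJ J S * (1 + S) = (1 + S) * J := by
      rw [cayleyJ, mul_assoc, Ring.inverse_mul_cancel _ hu, mul_one]
    exact DFunLike.congr_fun this u
  refine ⟨fun v => ?_, fun v w => ?_, fun v hv => ?_⟩
  · obtain ⟨u, rfl⟩ := hsurj v
    rw [hJ, hJ, h.sq, map_neg, neg_add]
  · obtain ⟨u, rfl⟩ := hsurj v
    obtain ⟨t, rfl⟩ := hsurj w
    rw [hJ, hJ]
    simp only [map_add, add_apply, hS.symplectic, hS.anti, h.compatible,
      map_neg, neg_apply]
    ring
  · obtain ⟨u, rfl⟩ := hsurj v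
    have hu0 : u ≠ 0 := by rintro rfl; simp at hv
    have := hpos u hu0
    rw [hJ]
    simp only [map_add, map_sub, add_apply, hS.symplectic, hS.anti,
      map_neg, neg_neg] at this ⊢
    linarith

end Unit

end Cayley

/-! ### Smooth families of fields of endomorphisms -/

section Families

open Set

variable {n : ℕ} {M : Type*} [TopologicalSpace M] [ChartedSpace (Mod n) M]

theorem isOpen_src (x₀ : M) : IsOpen (src n x₀) := (chartAt (Mod n) x₀).open_source

theorem mem_src (x : M) : x ∈ src n x := mem_chart_source _ x

variable [IsManifold (𝓡 (2 * n)) ∞ M]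

instance (x : M) : T2Space (Tan n x) := inferInstanceAs (T2Space (Mod n))

instance (x : M) : FiniteDimensional ℝ (Tan n x) := inferInstanceAs (FiniteDimensional ℝ (Mod n))

variable {W : Type*} [NormedAddCommGroup W] [NormedSpace ℝ W]

/-- A family of fields of endomorphisms of the tangent bundle which is smooth on `U × M`, as seen
in the charts. -/
def IsSmoothEnd (U : Set W) (A : W → ∀ x : M, Tan n x →L[ℝ] Tan n x) : Prop :=
  ∀ x₀ : M, ContMDiffOn (𝓘(ℝ, W).prod (𝓡 (2 * n))) 𝓘(ℝ, Mod n →L[ℝ] Mod n) ∞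
    (fun z : W × M => coordEnd x₀ z.2 (A z.1 z.2)) (U ×ˢ src n x₀)

theorem isSmoothEnd_iff {U : Set W} (hU : IsOpen U) {A : W → ∀ x : M, Tan n x →L[ℝ] Tan n x} :
    ContMDiffOn (𝓘(ℝ, W).prod (𝓡 (2 * n))) ((𝓡 (2 * n)).prod 𝓘(ℝ, Mod n →L[ℝ] Mod n)) ∞
    (fun z : W × M => (TotalSpace.mk' (Mod n →L[ℝ] Mod n) z.2 (A z.1 z.2) :
      TotalSpace (Mod n →L[ℝ] Mod n) (fun x : M => Tan n x →L[ℝ] Tan n x)))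
    (U ×ˢ Set.univ) ↔ IsSmoothEnd U A := by
  constructor
  · intro h x₀ z hz
    have h1 := (h z ⟨hz.1, mem_univ _⟩).contMDiffAt ((hU.prod isOpen_univ).mem_nhds
      ⟨hz.1, mem_univ _⟩)
    exact ((contMDiffAt_end_iff (b := Prod.snd) hz.2).1 h1).2.contMDiffWithinAt
  · intro h z hz
    refine ((contMDiffAt_end_iff (b := Prod.snd) (mem_src z.2)).2
      ⟨contMDiffAt_snd, ?_⟩).contMDiffWithinAt
    exact (h z.2 z ⟨hz.1, mem_src z.2⟩).contMDiffAt
      ((hU.prod (isOpen_src _)).mem_nhds ⟨hz.1, mem_src z.2⟩)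

theorem isSmoothFamily_iff {Ω : SymplecticForm n M} {U : Set W} (hU : IsOpen U) {p : W → ACS Ω} :
    IsSmoothFamily U p ↔ IsSmoothEnd U (fun w => (p w).J) :=
  isSmoothEnd_iff (A := fun w => (p w).J) hU

theorem isSmoothEnd_const {A : ∀ x : M, Tan n x →L[ℝ] Tan n x}
    (hA : ContMDiff (𝓡 (2 * n)) ((𝓡 (2 * n)).prod 𝓘(ℝ, Mod n →L[ℝ] Mod n)) ∞
    (fun x => (TotalSpace.mk' (Mod n →L[ℝ] Mod n) x (A x) :
      TotalSpace (Mod n →L[ℝ] Mod n) (fun x : M => Tan n x →L[ℝ] Tan n x)))) (U : Set W) :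
    IsSmoothEnd U (fun _ => A) := fun _ z hz =>
  ((((contMDiffAt_end_iff (b := fun x : M => x) hz.2).1 (hA z.2)).2).comp z
    (contMDiffAt_snd (I := 𝓘(ℝ, W)))).contMDiffWithinAt

theorem IsSmoothEnd.slice {U : Set W} {A : W → ∀ x : M, Tan n x →L[ℝ] Tan n x}
    (hA : IsSmoothEnd U A) {w : W} (hw : w ∈ U) :
    ContMDiff (𝓡 (2 * n)) ((𝓡 (2 * n)).prod 𝓘(ℝ, Mod n →L[ℝ] Mod n)) ∞
    (fun x => (TotalSpace.mk' (Mod n →L[ℝ] Mod n) x (A w x) :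
      TotalSpace (Mod n →L[ℝ] Mod n) (fun x : M => Tan n x →L[ℝ] Tan n x))) := fun x => by
  refine (contMDiffAt_end_iff (b := fun x : M => x) (mem_src x)).2 ⟨contMDiffAt_id, ?_⟩
  have h : ContMDiffOn (𝓡 (2 * n)) 𝓘(ℝ, Mod n →L[ℝ] Mod n) ∞
      (fun y => coordEnd x y (A w y)) (src n x) :=
    (hA x).comp (t := U ×ˢ src n x) (f := fun y : M => (w, y))
      (contMDiff_const.prodMk contMDiff_id).contMDiffOn fun y hy => ⟨hw, hy⟩
  exact (h x (mem_src x)).contMDiffAt ((isOpen_src x).mem_nhds (mem_src x))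

variable {U : Set W} {A B : W → ∀ x : M, Tan n x →L[ℝ] Tan n x}

theorem IsSmoothEnd.mono (hA : IsSmoothEnd U A) {V : Set W} (h : V ⊆ U) : IsSmoothEnd V A :=
  fun x₀ => (hA x₀).mono (prod_mono h subset_rfl)

theorem IsSmoothEnd.congr (hA : IsSmoothEnd U A) (h : ∀ w ∈ U, ∀ x, B w x = A w x) :
    IsSmoothEnd U B := fun x₀ => (hA x₀).congr fun z hz => by rw [h z.1 hz.1 z.2]

theorem IsSmoothEnd.add (hA : IsSmoothEnd U A) (hB : IsSmoothEnd U B) :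
    IsSmoothEnd U (fun w x => A w x + B w x) := fun x₀ =>
  ((hA x₀).add (hB x₀)).congr fun z _ => by simp [coordEnd_add]

theorem IsSmoothEnd.sub (hA : IsSmoothEnd U A) (hB : IsSmoothEnd U B) :
    IsSmoothEnd U (fun w x => A w x - B w x) := fun x₀ =>
  ((hA x₀).sub (hB x₀)).congr fun z _ => by simp [coordEnd_sub]

theorem IsSmoothEnd.smul (hA : IsSmoothEnd U A) {c : W → ℝ} (hc : ContDiff ℝ ∞ c) :
    IsSmoothEnd U (fun w x => c w • A w x) := fun x₀ =>
  (((hc.contMDiff.comp contMDiff_fst).contMDiffOn).smul (hA x₀)).congr fun z _ => by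
    simp [coordEnd_smul]

theorem IsSmoothEnd.mul (hA : IsSmoothEnd U A) (hB : IsSmoothEnd U B) :
    IsSmoothEnd U (fun w x => A w x * B w x) := fun x₀ =>
  ((hA x₀).clm_comp (hB x₀)).congr fun _ hz => coordEnd_comp hz.2 _ _

theorem isSmoothEnd_one : IsSmoothEnd U (fun _ (x : M) => (1 : Tan n x →L[ℝ] Tan n x)) := fun _ =>
  (contMDiffOn_const (c := ContinuousLinearMap.id ℝ (Mod n))).congr fun _ hz => coordEnd_id hz.2

theorem coordEnd_inverse {x₀ x : M} (hx : x ∈ src n x₀) {A : Tan n x →L[ℝ] Tan n x}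
    (hA : IsUnit A) :
    IsUnit (coordEnd x₀ x A) ∧
      coordEnd x₀ x (Ring.inverse A) = Ring.inverse (coordEnd x₀ x A) := by
  obtain ⟨u, rfl⟩ := hA
  let v : (Mod n →L[ℝ] Mod n)ˣ :=
    ⟨coordEnd x₀ x u, coordEnd x₀ x (u⁻¹ : (Tan n x →L[ℝ] Tan n x)ˣ),
      (coordEnd_comp hx _ _).symm.trans
        ((congrArg (coordEnd x₀ x) u.mul_inv).trans (coordEnd_id hx)),
      (coordEnd_comp hx _ _).symm.trans
        ((congrArg (coordEnd x₀ x) u.inv_mul).trans (coordEnd_id hx))⟩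
  refine ⟨⟨v, rfl⟩, ?_⟩
  rw [Ring.inverse_unit]
  exact (Ring.inverse_unit v).symm

theorem IsSmoothEnd.inverse (hA : IsSmoothEnd U A) (hu : ∀ w ∈ U, ∀ x, IsUnit (A w x)) :
    IsSmoothEnd U (fun w x => Ring.inverse (A w x)) := fun x₀ => by
  have h : ContMDiffOn (𝓘(ℝ, W).prod (𝓡 (2 * n))) 𝓘(ℝ, Mod n →L[ℝ] Mod n) ∞
      (fun z : W × M => Ring.inverse (coordEnd x₀ z.2 (A z.1 z.2))) (U ×ˢ src n x₀) := by
    intro z hz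
    obtain ⟨⟨v, hv⟩, -⟩ := coordEnd_inverse hz.2 (hu z.1 hz.1 z.2)
    have h1 : ContMDiffAt 𝓘(ℝ, Mod n →L[ℝ] Mod n) 𝓘(ℝ, Mod n →L[ℝ] Mod n) ∞ Ring.inverse
        (coordEnd x₀ z.2 (A z.1 z.2)) := by
      rw [← hv]; exact (contDiffAt_ringInverse ℝ v).contMDiffAt
    exact h1.comp_contMDiffWithinAt z (hA x₀ z hz)
  exact h.congr fun z hz => (coordEnd_inverse hz.2 (hu z.1 hz.1 z.2)).2

theorem IsSmoothEnd.cayleyJ (hA : IsSmoothEnd U A) (hB : IsSmoothEnd U B)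
    (hu : ∀ w ∈ U, ∀ x, IsUnit (1 + B w x)) :
    IsSmoothEnd U (fun w x => HalfForm.cayleyJ (A w x) (B w x)) :=
  ((isSmoothEnd_one.add hB).mul hA).mul ((isSmoothEnd_one.add hB).inverse hu)

theorem IsSmoothEnd.cayleyS (hA : IsSmoothEnd U A) (hB : IsSmoothEnd U B)
    (hu : ∀ w ∈ U, ∀ x, IsUnit (A w x + B w x)) :
    IsSmoothEnd U (fun w x => HalfForm.cayleyS (A w x) (B w x)) :=
  ((hA.add hB).inverse hu).mul (hA.sub hB)

theorem IsSmoothEnd.comp (hA : IsSmoothEnd U A) {W' : Type*} [NormedAddCommGroup W']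
    [NormedSpace ℝ W'] {f : W' → W} {V : Set W'} (hf : ContDiff ℝ ∞ f) (hV : MapsTo f V U) :
    IsSmoothEnd V (fun w => A (f w)) := fun x₀ =>
  (hA x₀).comp (t := U ×ˢ src n x₀) (f := fun z : W' × M => (f z.1, z.2))
    ((hf.contMDiff.comp contMDiff_fst).prodMk contMDiff_snd).contMDiffOn fun _ hz => ⟨hV hz.1, hz.2⟩

variable {Ω : SymplecticForm n M}

theorem ACS.isCompat (j : ACS Ω) (x : M) : IsCompat (Ω.form x) (j.J x) :=
  ⟨j.sq x, j.compatible x, j.positive x⟩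

theorem ACS.ext_J {j j' : ACS Ω} (h : ∀ x, j.J x = j'.J x) : j = j' := by
  obtain ⟨J, _⟩ := j
  obtain ⟨J', _⟩ := j'
  obtain rfl : J = J' := funext h
  rfl

theorem IsSmoothFamily.comp {p : W → ACS Ω} (hp : IsSmoothFamily U p) {W' : Type*}
    [NormedAddCommGroup W'] [NormedSpace ℝ W'] {f : W' → W} {V : Set W'}
    (hf : ContDiff ℝ ∞ f) (hV : MapsTo f V U) : IsSmoothFamily V (fun w => p (f w)) :=
  ContMDiffOn.comp (t := U ×ˢ univ) (f := fun z : W' × M => (f z.1, z.2)) hp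
    ((hf.contMDiff.comp contMDiff_fst).prodMk contMDiff_snd).contMDiffOn
      fun _ hz => ⟨hV hz.1, trivial⟩

theorem coordEnd_vecCoord {x₀ x : M} (hx : x ∈ src n x₀) (A : Tan n x →L[ℝ] Tan n x)
    (v : Tan n x) : coordVecL x₀ x (coordEnd x₀ x A (vecCoord x₀ x v)) = A v := by
  rw [coordEnd_apply, coordVecL_vecCoord hx, coordVecL_vecCoord hx]

/-- Positivity of `1 - S²` is an open condition on the parameter, by compactness of `M` and of the
unit sphere. -/
theorem eventually_cayley_pos [CompactSpace M] (j : ACS Ω) {w₀ : W} (hB : IsSmoothEnd univ B)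
    (h0 : ∀ x, B w₀ x = 0) :
    ∀ᶠ w in nhds w₀, ∀ x (v : Tan n x), v ≠ 0 →
      0 < Ω.form x v (j.J x (v - B w x (B w x v))) := by
  have key : ∀ x₀ : M, ∀ᶠ z : W × M in nhds (w₀, x₀), ∀ v : Tan n z.2, v ≠ 0 →
      0 < Ω.form z.2 v (j.J z.2 (v - B z.1 z.2 (B z.1 z.2 v))) := by
    intro x₀
    set P : W × M → Mod n → ℝ := fun z u => coordForm Ω x₀ z.2 u
      (coordEnd x₀ z.2 (j.J z.2)
        (u - coordEnd x₀ z.2 (B z.1 z.2) (coordEnd x₀ z.2 (B z.1 z.2) u))) with hP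
    have hPeq : ∀ z : W × M, z.2 ∈ src n x₀ → ∀ u, P z u = Ω.form z.2 (coordVecL x₀ z.2 u)
        (j.J z.2 (coordVecL x₀ z.2 u -
          B z.1 z.2 (B z.1 z.2 (coordVecL x₀ z.2 u)))) := by
      intro z hz u
      simp only [hP]
      rw [coordForm_apply Ω hz, ← coordVecL_apply, ← coordVecL_apply]
      congr 1
      simp only [coordEnd_apply, map_sub, coordVecL_vecCoord hz]
    have hsphere : ∀ᶠ z : W × M in nhds (w₀, x₀), ∀ u ∈ Metric.sphere (0 : Mod n) 1, 0 < P z u := by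
      refine (isCompact_sphere (0 : Mod n) 1).eventually_forall_of_forall_eventually fun u hu => ?_
      have hx₀ : ((w₀, x₀) : W × M) ∈ univ ×ˢ src n x₀ := ⟨mem_univ _, mem_src x₀⟩
      have hn : (univ : Set W) ×ˢ src n x₀ ∈ nhds (w₀, x₀) :=
        (isOpen_univ.prod (isOpen_src x₀)).mem_nhds hx₀
      have cB : ContinuousAt (fun q : (W × M) × Mod n => coordEnd x₀ q.1.2 (B q.1.1 q.1.2))
          ((w₀, x₀), u) :=
        ContinuousAt.comp (f := fun q : (W × M) × Mod n => q.1)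
          ((hB x₀).continuousOn.continuousAt hn) continuousAt_fst
      have cJ : ContinuousAt (fun q : (W × M) × Mod n => coordEnd x₀ q.1.2 (j.J q.1.2))
          ((w₀, x₀), u) :=
        ContinuousAt.comp (f := fun q : (W × M) × Mod n => q.1)
          ((isSmoothEnd_const j.smooth univ x₀).continuousOn.continuousAt hn) continuousAt_fst
      have cF : ContinuousAt (fun q : (W × M) × Mod n => coordForm Ω x₀ q.1.2) ((w₀, x₀), u) :=
        ContinuousAt.comp (f := fun q : (W × M) × Mod n => q.1.2)
          ((contMDiffOn_coordForm Ω x₀).continuousOn.continuousAt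
            ((isOpen_src x₀).mem_nhds (mem_src x₀)))
          (continuousAt_snd.comp continuousAt_fst)
      have cu : ContinuousAt (fun q : (W × M) × Mod n => q.2) ((w₀, x₀), u) := continuousAt_snd
      have cP : ContinuousAt (fun q : (W × M) × Mod n => P q.1 q.2) ((w₀, x₀), u) :=
        (cF.clm_apply cu).clm_apply (cJ.clm_apply (cu.sub (cB.clm_apply (cB.clm_apply cu))))
      refine cP.eventually (lt_mem_nhds ?_)
      change 0 < P (w₀, x₀) u
      rw [hPeq (w₀, x₀) (mem_src x₀)]
      simp only [h0, zero_apply, sub_zero]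
      refine j.positive x₀ _ fun hv => ?_
      have hu0 : u = 0 := by
        rw [← vecCoord_coordVecL (mem_src x₀) u, hv, map_zero]
      simp [hu0] at hu
    have hsrc : ∀ᶠ z : W × M in nhds (w₀, x₀), z.2 ∈ src n x₀ :=
      continuousAt_snd.eventually ((isOpen_src x₀).mem_nhds (mem_src x₀))
    filter_upwards [hsphere, hsrc] with z hz hzs v hv
    set u := vecCoord x₀ z.2 v with hu
    have hvu : coordVecL x₀ z.2 u = v := coordVecL_vecCoord hzs v
    have hu0 : u ≠ 0 := fun h => hv (by rw [← hvu, h, map_zero])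
    have h1 := hz (‖u‖⁻¹ • u) (by simp [norm_smul, hu0])
    have h2 : P z (‖u‖⁻¹ • u) = ‖u‖⁻¹ * (‖u‖⁻¹ * P z u) := by
      simp only [hP, map_smul, ← smul_sub, smul_apply, smul_eq_mul]
    rw [h2] at h1
    have hpos : 0 < ‖u‖⁻¹ := by positivity
    have h3 := (mul_pos_iff_of_pos_left hpos).1 ((mul_pos_iff_of_pos_left hpos).1 h1)
    rwa [hPeq z hzs, hvu] at h3
  have := (isCompact_univ (X := M)).eventually_forall_of_forall_eventually
    (P := fun w x => ∀ v : Tan n x, v ≠ 0 → 0 < Ω.form x v (j.J x (v - B w x (B w x v))))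
    (x₀ := w₀) fun x _ => key x
  exact this.mono fun w hw x => hw x trivial

open Classical in
/-- Smooth families of tangent operators which vanish at `w₀` integrate to smooth families of
complex structures, by the Cayley transform. -/
theorem exists_acs_family [CompactSpace M] (j : ACS Ω) {w₀ : W} (hB : IsSmoothEnd univ B)
    (h0 : ∀ x, B w₀ x = 0) (hT : ∀ w x, IsTangent (Ω.form x) (j.J x) (B w x)) :
    ∃ U : Set W, IsOpen U ∧ w₀ ∈ U ∧ ∃ p : W → ACS Ω, IsSmoothFamily U p ∧
      ∀ w ∈ U, ∀ x, IsUnit (1 + B w x) ∧ (p w).J x = cayleyJ (j.J x) (B w x) := by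
  obtain ⟨U, hU, hUo, hw₀⟩ := eventually_nhds_iff.1 (eventually_cayley_pos j hB h0)
  have hun : ∀ w ∈ U, ∀ x, IsUnit (1 + B w x) := fun w hw x => isUnit_one_add_of_pos (hU w hw x)
  have hsm : IsSmoothEnd U (fun w x => cayleyJ (j.J x) (B w x)) :=
    IsSmoothEnd.cayleyJ (isSmoothEnd_const j.smooth U) (hB.mono (subset_univ U)) hun
  have hc : ∀ w ∈ U, ∀ x, IsCompat (Ω.form x) (cayleyJ (j.J x) (B w x)) := fun w hw x =>
    (hT w x).isCompat_cayleyJ (j.isCompat x) (hU w hw x)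
  let p : W → ACS Ω := fun w => if hw : w ∈ U then
    ⟨fun x => cayleyJ (j.J x) (B w x), hsm.slice hw, fun x => (hc w hw x).sq,
      fun x => (hc w hw x).compatible, fun x => (hc w hw x).positive⟩ else j
  have hp : ∀ w ∈ U, ∀ x, (p w).J x = cayleyJ (j.J x) (B w x) := fun w hw x => by
    simp only [p, dif_pos hw]
  exact ⟨U, hUo, hw₀, p, (isSmoothFamily_iff hUo).2 (hsm.congr hp), fun w hw x =>
    ⟨hun w hw x, hp w hw x⟩⟩

end Families

/-! ### Curves of complex structures with a given velocity -/

section Velocity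

open Set

variable {n : ℕ} {M : Type*} [TopologicalSpace M] [ChartedSpace (Mod n) M]
  [IsManifold (𝓡 (2 * n)) ∞ M]
variable {W : Type} [NormedAddCommGroup W] [NormedSpace ℝ W]
variable {Ω : SymplecticForm n M}

theorem IsSmoothEnd.contDiffAt {U : Set W} {A : W → ∀ x : M, Tan n x →L[ℝ] Tan n x}
    (hA : IsSmoothEnd U A) (hU : IsOpen U) {w : W} (hw : w ∈ U) {x₀ x : M} (hx : x ∈ src n x₀) :
    ContDiffAt ℝ ∞ (fun w => coordEnd x₀ x (A w x)) w :=
  contDiffAt_fst_of_contMDiffAt (z₀ := (w, x)) ((hA x₀ (w, x) ⟨hw, hx⟩).contMDiffAt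
    ((hU.prod (isOpen_src _)).mem_nhds ⟨hw, hx⟩))

theorem hasDerivAt_apply_of_coordEnd {x₀ x : M} (hx : x ∈ src n x₀)
    {A : ℝ → Tan n x →L[ℝ] Tan n x} {A' : Tan n x →L[ℝ] Tan n x} {t : ℝ}
    (h : HasDerivAt (fun t => coordEnd x₀ x (A t)) (coordEnd x₀ x A') t) (v : Tan n x) :
    HasDerivAt (fun t => A t v) (A' v) t := by
  have h1 : HasDerivAt (fun t => coordEnd x₀ x (A t) (vecCoord x₀ x v))
      (coordEnd x₀ x A' (vecCoord x₀ x v)) t := by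
    simpa using h.clm_apply (hasDerivAt_const t (vecCoord x₀ x v))
  let T : Mod n →L[ℝ] Mod n := coordVecL x₀ x
  have h2 : HasDerivAt (F := Mod n) (fun t => T (coordEnd x₀ x (A t) (vecCoord x₀ x v)))
      (T (coordEnd x₀ x A' (vecCoord x₀ x v))) t := T.hasFDerivAt.comp_hasDerivAt t h1
  have h3 : ∀ B : Tan n x →L[ℝ] Tan n x, T (coordEnd x₀ x B (vecCoord x₀ x v)) = B v :=
    fun B => coordEnd_vecCoord hx B v
  simp only [h3] at h2
  exact h2

theorem HasVelocity.hasDerivAt_coordEnd {γ : ℝ → ACS Ω} {j : ACS Ω} {η : TangentACS j}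
    (h : HasVelocity γ η) (hγ : IsSmoothFamily univ γ) {x₀ x : M} (hx : x ∈ src n x₀) :
    HasDerivAt (fun t => coordEnd x₀ x ((γ t).J x)) (coordEnd x₀ x (η.A x)) 0 := by
  have hd := (((isSmoothFamily_iff isOpen_univ).1 hγ).contDiffAt isOpen_univ
    (mem_univ (0 : ℝ)) hx).differentiableAt (by simp)
  have hd' := hd.hasDerivAt
  have : deriv (fun t => coordEnd x₀ x ((γ t).J x)) 0 = coordEnd x₀ x (η.A x) := by
    ext1 v
    let T : Mod n →L[ℝ] Mod n := vecCoord x₀ x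
    have h1 : HasDerivAt (fun t => coordEnd x₀ x ((γ t).J x) v)
        (deriv (fun t => coordEnd x₀ x ((γ t).J x)) 0 v) 0 := by
      simpa using hd'.clm_apply (hasDerivAt_const (0 : ℝ) v)
    have h2 : HasDerivAt (F := Mod n) (fun t => T ((γ t).J x (coordVecL x₀ x v)))
      (T (η.A x (coordVecL x₀ x v))) 0 := T.hasFDerivAt.comp_hasDerivAt 0 (h.2 x (coordVecL x₀ x v))
    exact h1.unique h2
  rwa [this] at hd'

/-- The derivative of a function on `𝒥`, smooth on the two parameter families, along a smooth curve
depends only on the velocity of the curve: two curves `γ₁`, `γ₂` with the same velocity are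
restrictions, to the axis and to the diagonal, of a smooth family `H` which is constant on the
other axis. In the Cayley chart `H(u, t) = S₁(t) + u t⁻¹ (S₂(t) - S₁(t))`. -/
theorem hasDerivAt_of_hasVelocity [CompactSpace M] {V : Type*} [NormedAddCommGroup V]
    [NormedSpace ℝ V] {f : ACS Ω → V}
    (hf : ∀ U : Set (ℝ × ℝ), IsOpen U → (0, 0) ∈ U → ∀ p : ℝ × ℝ → ACS Ω, IsSmoothFamily U p →
      DifferentiableAt ℝ (fun w => f (p w)) (0, 0))
    {j : ACS Ω} {η : TangentACS j} {γ₁ γ₂ : ℝ → ACS Ω} (hγ₁ : IsSmoothFamily univ γ₁)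
    (hγ₂ : IsSmoothFamily univ γ₂) (h₁ : HasVelocity γ₁ η) (h₂ : HasVelocity γ₂ η) {c : V}
    (hc : HasDerivAt (fun t => f (γ₁ t)) c 0) : HasDerivAt (fun t => f (γ₂ t)) c 0 := by
  have hjs : IsSmoothEnd (univ : Set ℝ) (fun _ => j.J) := isSmoothEnd_const j.smooth univ
  have hs : ∀ γ : ℝ → ACS Ω, IsSmoothFamily univ γ →
      IsSmoothEnd univ (fun t x => cayleyS (j.J x) ((γ t).J x)) := fun γ hγ =>
    hjs.cayleyS ((isSmoothFamily_iff isOpen_univ).1 hγ) fun t _ x =>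
      (j.isCompat x).isUnit_add ((γ t).isCompat x)
  have hz : ∀ γ : ℝ → ACS Ω, HasVelocity γ η → ∀ x, cayleyS (j.J x) ((γ 0).J x) = 0 :=
    fun γ hγ x => by rw [hγ.1, cayleyS, sub_self, mul_zero]
  have hT : ∀ γ : ℝ → ACS Ω, ∀ t x,
      IsTangent (Ω.form x) (j.J x) (cayleyS (j.J x) ((γ t).J x)) := fun γ t x =>
    (j.isCompat x).isTangent_cayleyS ((γ t).isCompat x)
  have hJS : ∀ γ : ℝ → ACS Ω, ∀ t x, cayleyJ (j.J x) (cayleyS (j.J x) ((γ t).J x)) = (γ t).J x :=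
    fun γ t x => (j.isCompat x).cayleyJ_cayleyS ((γ t).isCompat x)
  -- the velocity of the curve of Cayley transforms, from the equation `(J + J') S = J - J'`
  have hd : ∀ γ : ℝ → ACS Ω, (hγ : IsSmoothFamily univ γ) → (h : HasVelocity γ η) →
      ∀ x₀ x, x ∈ src n x₀ → ∃ D, HasDerivAt
        (fun t => coordEnd x₀ x (cayleyS (j.J x) ((γ t).J x))) D 0 ∧
        (coordEnd x₀ x (j.J x) + coordEnd x₀ x (j.J x)) * D = - coordEnd x₀ x (η.A x) := by
    intro γ hγ h x₀ x hx
    have hd1 := (((hs γ hγ).contDiffAt isOpen_univ (mem_univ (0 : ℝ)) hx).differentiableAt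
      (by simp)).hasDerivAt
    refine ⟨_, hd1, ?_⟩
    have hd2 := (h.hasDerivAt_coordEnd hγ hx)
    have e : ∀ t, (coordEnd x₀ x (j.J x) + coordEnd x₀ x ((γ t).J x)) *
        coordEnd x₀ x (cayleyS (j.J x) ((γ t).J x)) =
        coordEnd x₀ x (j.J x) - coordEnd x₀ x ((γ t).J x) := fun t => by
      rw [← coordEnd_add, ← coordEnd_sub]
      refine (coordEnd_comp hx _ _).symm.trans (congrArg _ ?_)
      exact Ring.mul_inverse_cancel_left _ _ ((j.isCompat x).isUnit_add ((γ t).isCompat x))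
    have hd3 := (hd2.const_add (coordEnd x₀ x (j.J x))).mul hd1
    have hd4 := hd2.const_sub (coordEnd x₀ x (j.J x))
    have hfun : ((fun t => coordEnd x₀ x (j.J x) + coordEnd x₀ x ((γ t).J x)) *
        fun t => coordEnd x₀ x (cayleyS (j.J x) ((γ t).J x))) =
        fun t => coordEnd x₀ x (j.J x) - coordEnd x₀ x ((γ t).J x) := funext e
    rw [hfun] at hd3
    have h5 := hd3.unique hd4
    have h0 : coordEnd x₀ x (0 : Tan n x →L[ℝ] Tan n x) = 0 := by ext1 v; simp [coordEnd_apply]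
    rw [hz γ h x, h0, mul_zero, zero_add, h.1] at h5
    exact h5
  have hD : IsSmoothEnd (univ : Set ℝ) (fun t x =>
      t⁻¹ • (cayleyS (j.J x) ((γ₂ t).J x) - cayleyS (j.J x) ((γ₁ t).J x))) := by
    intro x₀
    refine (contMDiffOn_inv_smul (isOpen_src x₀) (((hs γ₂ hγ₂).sub (hs γ₁ hγ₁)) x₀) ?_ ?_).congr
      fun z _ => by rw [coordEnd_smul]
    · intro x _
      simp only [hz γ₁ h₁, hz γ₂ h₂, sub_self]
      ext1 v; simp [coordEnd_apply]
    · intro x hx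
      obtain ⟨D₁, hD₁, e₁⟩ := hd γ₁ hγ₁ h₁ x₀ x hx
      obtain ⟨D₂, hD₂, e₂⟩ := hd γ₂ hγ₂ h₂ x₀ x hx
      have hu := (coordEnd_inverse hx ((j.isCompat x).isUnit_add (j.isCompat x))).1
      rw [coordEnd_add] at hu
      have hDD : D₂ = D₁ := hu.mul_left_cancel (e₂.trans e₁.symm)
      have := hD₂.sub hD₁
      rw [hDD, sub_self] at this
      refine this.congr_of_eventuallyEq (Filter.Eventually.of_forall fun t => ?_)
      simp [coordEnd_sub]
  have hB : IsSmoothEnd (univ : Set (ℝ × ℝ)) (fun w x => cayleyS (j.J x) ((γ₁ w.2).J x) +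
      w.1 • (w.2⁻¹ • (cayleyS (j.J x) ((γ₂ w.2).J x) - cayleyS (j.J x) ((γ₁ w.2).J x)))) :=
    ((hs γ₁ hγ₁).comp contDiff_snd (mapsTo_univ _ _)).add
      ((hD.comp contDiff_snd (mapsTo_univ _ _)).smul contDiff_fst)
  obtain ⟨U, hU, h0U, p, hp, hpJ⟩ := exists_acs_family (w₀ := ((0, 0) : ℝ × ℝ)) j hB
    (fun x => by simp [hz γ₁ h₁]) fun w x => (hT γ₁ w.2 x).add
      (((by simpa [sub_eq_add_neg] using (hT γ₂ w.2 x).add ((hT γ₁ w.2 x).smul (-1)) :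
        IsTangent (Ω.form x) (j.J x)
          (cayleyS (j.J x) ((γ₂ w.2).J x) - cayleyS (j.J x) ((γ₁ w.2).J x))).smul _).smul _)
  have hev : ∀ (g : ℝ → ℝ × ℝ), Continuous g → g 0 = (0, 0) → ∀ᶠ t in nhds (0 : ℝ), g t ∈ U :=
    fun g hg h => hg.continuousAt.eventually (by rw [h]; exact hU.mem_nhds h0U)
  have e1 : ∀ᶠ t in nhds (0 : ℝ), p (0, t) = γ₁ t := by
    filter_upwards [hev (fun t => (0, t)) (by fun_prop) rfl] with t ht
    refine ACS.ext_J fun x => ?_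
    rw [(hpJ _ ht x).2]
    simp only [zero_smul, add_zero, hJS]
  have e2 : ∀ᶠ t in nhds (0 : ℝ), p (t, t) = γ₂ t := by
    filter_upwards [hev (fun t => (t, t)) (by fun_prop) rfl] with t ht
    refine ACS.ext_J fun x => ?_
    rw [(hpJ _ ht x).2]
    rcases eq_or_ne t 0 with rfl | h0
    · simpa [hz γ₁ h₁, hz γ₂ h₂] using hJS γ₂ 0 x
    · simp only [smul_smul, mul_inv_cancel₀ h0, one_smul, add_sub_cancel, hJS]
  have e3 : ∀ᶠ t in nhds (0 : ℝ), p (t, 0) = j := by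
    filter_upwards [hev (fun t => (t, 0)) (by fun_prop) rfl] with t ht
    refine ACS.ext_J fun x => ?_
    rw [(hpJ _ ht x).2]
    simpa [hz γ₁ h₁, hz γ₂ h₂, h₁.1] using hJS γ₁ 0 x
  have hp' := (hf U hU h0U p hp).hasFDerivAt
  set P' := fderiv ℝ (fun w => f (p w)) (0, 0)
  have d1 : HasDerivAt (fun t : ℝ => f (p (0, t))) (P' (0, 1)) 0 :=
    hp'.comp_hasDerivAt (0 : ℝ) ((hasDerivAt_const (0 : ℝ) (0 : ℝ)).prodMk (hasDerivAt_id (0 : ℝ)))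
  have d2 : HasDerivAt (fun t : ℝ => f (p (t, t))) (P' (1, 1)) 0 :=
    HasFDerivAt.comp_hasDerivAt (f := fun t : ℝ => (t, t)) (0 : ℝ) hp'
      ((hasDerivAt_id (0 : ℝ)).prodMk (hasDerivAt_id (0 : ℝ)))
  have d3 : HasDerivAt (fun t : ℝ => f (p (t, 0))) (P' (1, 0)) 0 :=
    HasFDerivAt.comp_hasDerivAt (f := fun t : ℝ => (t, (0 : ℝ))) (0 : ℝ) hp'
      ((hasDerivAt_id (0 : ℝ)).prodMk (hasDerivAt_const (0 : ℝ) (0 : ℝ)))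
  have c3 : P' (1, 0) = 0 := (d3.congr_of_eventuallyEq (e3.mono fun t h => by
    change f j = f (p (t, 0)); rw [h])).unique (hasDerivAt_const 0 (f j))
  have c1 : P' (0, 1) = c := (d1.congr_of_eventuallyEq (e1.mono fun t h => by
    change f (γ₁ t) = f (p (0, t)); rw [h])).unique hc
  have c2 : P' (1, 1) = c := by
    rw [← c1, ← zero_add (P' (0, 1)), ← c3, ← map_add]; simp
  rw [c2] at d2
  exact d2.congr_of_eventuallyEq (e2.mono fun t h => by
    change f (γ₂ t) = f (p (t, t)); rw [h])

/-- The tangent operator `½ j A`, whose Cayley curves have velocity `A`. -/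
def TangentACS.half {j : ACS Ω} (η : TangentACS j) (x : M) : Tan n x →L[ℝ] Tan n x :=
  (1 / 2 : ℝ) • (j.J x * η.A x)

theorem TangentACS.isTangent_half {j : ACS Ω} (η : TangentACS j) (x : M) :
    IsTangent (Ω.form x) (j.J x) (η.half x) := by
  refine IsTangent.smul ⟨fun v => ?_, fun v w => ?_⟩ _
  · change j.J x (η.A x (j.J x v)) = -j.J x (j.J x (η.A x v))
    rw [η.anti, map_neg]
  · change Ω.form x (j.J x (η.A x v)) w = -Ω.form x v (j.J x (η.A x w))
    have h := η.symplectic x v (j.J x w)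
    rw [η.anti, map_neg] at h
    rw [(j.isCompat x).skew]
    linarith

theorem hasVelocity_cayley {j : ACS Ω} {η : TangentACS j} {γ : ℝ → ACS Ω}
    (hγ : IsSmoothFamily univ γ) {c : ℝ → ℝ} (hc0 : c 0 = 0) (hc : HasDerivAt c 1 0)
    (h : ∀ t x, IsUnit (1 + c t • η.half x) ∧ (γ t).J x = cayleyJ (j.J x) (c t • η.half x)) :
    HasVelocity γ η := by
  have h0 : γ 0 = j := ACS.ext_J fun x => by
    rw [(h 0 x).2, hc0, zero_smul, cayleyJ, add_zero, Ring.inverse_one, one_mul, mul_one]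
  refine ⟨h0, fun x v => ?_⟩
  refine hasDerivAt_apply_of_coordEnd (A := fun t => (γ t).J x) (mem_src x) ?_ v
  have hx := mem_src (n := n) x
  have hd := ((((isSmoothFamily_iff isOpen_univ).1 hγ).contDiffAt isOpen_univ
    (mem_univ (0 : ℝ)) hx).differentiableAt (by simp)).hasDerivAt
  have e : ∀ t, coordEnd x x ((γ t).J x) * (1 + c t • coordEnd x x (η.half x)) =
      (1 + c t • coordEnd x x (η.half x)) * coordEnd x x (j.J x) := fun t => by
    have h1 : coordEnd x x (1 + c t • η.half x) = 1 + c t • coordEnd x x (η.half x) := by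
      rw [coordEnd_add, coordEnd_smul]; congr 1; exact coordEnd_id hx
    rw [← h1]
    refine (coordEnd_comp hx _ _).symm.trans (Eq.trans (congrArg _ ?_) (coordEnd_comp hx _ _))
    change (γ t).J x * (1 + c t • η.half x) = (1 + c t • η.half x) * j.J x
    rw [(h t x).2, cayleyJ, mul_assoc, Ring.inverse_mul_cancel _ (h t x).1, mul_one]
  have d1 : HasDerivAt (fun t => 1 + c t • coordEnd x x (η.half x))
      (coordEnd x x (η.half x)) 0 := by
    simpa using (hc.smul_const (coordEnd x x (η.half x))).const_add 1
  have d2 := hd.mul d1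
  have d3 := d1.mul_const (coordEnd x x (j.J x))
  have hfun : ((fun t => coordEnd x x ((γ t).J x)) * fun t => 1 + c t • coordEnd x x (η.half x)) =
      fun t => (1 + c t • coordEnd x x (η.half x)) * coordEnd x x (j.J x) := funext e
  rw [hfun] at d2
  have h5 := d2.unique d3
  rw [hc0, h0] at h5
  have h50 : 1 + (0 : ℝ) • coordEnd x x (η.half x) = 1 := by
    rw [show (0 : ℝ) • coordEnd x x (η.half x) = 0 from by ext1 u; simp, add_zero]
  rw [h50, mul_one] at h5
  have h6 : η.half x * j.J x = η.A x + j.J x * η.half x := by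
    ext1 u
    have hs := j.sq x (η.A x u)
    change (1 / 2 : ℝ) • j.J x (η.A x (j.J x u)) =
      η.A x u + j.J x ((1 / 2 : ℝ) • j.J x (η.A x u))
    rw [η.anti, map_neg, map_smul, hs]
    module
  have h7 : coordEnd x x (η.half x) * coordEnd x x (j.J x) =
      coordEnd x x (η.A x) + coordEnd x x (j.J x) * coordEnd x x (η.half x) := by
    refine (coordEnd_comp hx (η.half x) (j.J x)).symm.trans ((congrArg _ h6).trans ?_)
    rw [coordEnd_add]
    congr 1
    exact coordEnd_comp hx _ _
  rw [h7] at h5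
  rw [add_right_cancel h5] at hd
  exact hd

/-- Every pair of tangent vectors at `j` is the pair of partial velocities of a smooth two
parameter family. -/
theorem exists_two_parameter_family [CompactSpace M] {j : ACS Ω} (η μ : TangentACS j) :
    ∃ p : ℝ × ℝ → ACS Ω, IsSmoothFamily univ p ∧
      HasVelocity (fun s => p (s, 0)) η ∧ HasVelocity (fun t => p (0, t)) μ := by
  have hh : ∀ η : TangentACS j, IsSmoothEnd (univ : Set (ℝ × ℝ)) (fun _ x => η.half x) := fun η =>
    ((isSmoothEnd_const j.smooth univ).mul (isSmoothEnd_const η.smooth univ)).smul contDiff_const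
  have hB : IsSmoothEnd (univ : Set (ℝ × ℝ)) (fun w x => w.1 • η.half x + w.2 • μ.half x) :=
    ((hh η).smul contDiff_fst).add ((hh μ).smul contDiff_snd)
  obtain ⟨U, hU, h0U, p, hp, hpJ⟩ := exists_acs_family (w₀ := ((0, 0) : ℝ × ℝ)) j hB
    (fun x => by simp) fun w x => ((η.isTangent_half x).smul _).add ((μ.isTangent_half x).smul _)
  obtain ⟨ε, hε, hball⟩ := Metric.isOpen_iff.1 hU _ h0U
  -- a bounded reparametrization of the line, tangent to the identity at `0`
  set c : ℝ → ℝ := fun t => ε / 2 * Real.sin (2 / ε * t) with hc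
  have hcs : ContDiff ℝ ∞ c :=
    contDiff_const.mul (Real.contDiff_sin.comp (contDiff_const.mul contDiff_id))
  have hc0 : c 0 = 0 := by simp [hc]
  have hcb : ∀ t, |c t| < ε := fun t => by
    have h1 := Real.abs_sin_le_one (2 / ε * t)
    rw [hc, abs_mul, abs_of_pos (half_pos hε)]
    nlinarith
  have hcd : HasDerivAt c 1 0 := by
    have h1 : HasDerivAt (fun t : ℝ => 2 / ε * t) (2 / ε) 0 := by
      simpa using (hasDerivAt_id (0 : ℝ)).const_mul (2 / ε)
    have h2 := (h1.sin).const_mul (ε / 2)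
    simp only [mul_zero, Real.cos_zero, one_mul] at h2
    have h3 : ε / 2 * (2 / ε) = 1 := by field_simp
    rw [h3] at h2
    exact h2
  have hm : ∀ w : ℝ × ℝ, (c w.1, c w.2) ∈ U := fun w => hball (by
    rw [Metric.mem_ball, Prod.dist_eq]
    simpa [Real.dist_eq] using And.intro (hcb w.1) (hcb w.2))
  have hq : IsSmoothFamily univ (fun w : ℝ × ℝ => p (c w.1, c w.2)) :=
    hp.comp ((hcs.comp contDiff_fst).prodMk (hcs.comp contDiff_snd)) fun w _ => hm w
  refine ⟨_, hq, ?_, ?_⟩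
  · refine hasVelocity_cayley (c := c) (hq.comp (f := fun s : ℝ => (s, (0 : ℝ)))
      (contDiff_id.prodMk contDiff_const) (mapsTo_univ _ _)) hc0 hcd fun t x => ?_
    simpa [hc0] using hpJ _ (hm (t, 0)) x
  · refine hasVelocity_cayley (c := c) (hq.comp (f := fun t : ℝ => ((0 : ℝ), t))
      (contDiff_const.prodMk contDiff_id) (mapsTo_univ _ _)) hc0 hcd fun t x => ?_
    simpa [hc0] using hpJ _ (hm (0, t)) x

end Velocity

/-! ### Smooth complex valued functions -/

section ComplexValued

variable {E H N : Type*} [NormedAddCommGroup E] [NormedSpace ℝ E] [TopologicalSpace H]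
  {I : ModelWithCorners ℝ E H} [TopologicalSpace N] [ChartedSpace H N] {s : Set N}

theorem contMDiffOn_complex_mul {f g : N → ℂ} (hf : ContMDiffOn I 𝓘(ℝ, ℂ) ∞ f s)
    (hg : ContMDiffOn I 𝓘(ℝ, ℂ) ∞ g s) : ContMDiffOn I 𝓘(ℝ, ℂ) ∞ (fun x => f x * g x) s :=
  (contDiff_mul (𝕜 := ℝ) (𝔸 := ℂ)).contMDiff.comp_contMDiffOn (hf.prodMk_space hg)

theorem contMDiffOn_complex_div {f g : N → ℂ} (hf : ContMDiffOn I 𝓘(ℝ, ℂ) ∞ f s)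
    (hg : ContMDiffOn I 𝓘(ℝ, ℂ) ∞ g s) (h0 : ∀ x ∈ s, g x ≠ 0) :
    ContMDiffOn I 𝓘(ℝ, ℂ) ∞ (fun x => f x / g x) s := by
  simp only [div_eq_mul_inv]
  exact contMDiffOn_complex_mul hf fun x hx =>
    (contDiffAt_inv ℝ (h0 x hx)).contMDiffAt.comp_contMDiffWithinAt x (hg x hx)

end ComplexValued

/-! ### Frames of line bundles -/

section LineFrames

variable {M : Type*} [TopologicalSpace M] {δ : M → Type*} [TopologicalSpace (TotalSpace ℂ δ)]
  [∀ x, TopologicalSpace (δ x)] [FiberBundle ℂ δ]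

theorem mem_dom (x : M) : x ∈ dom δ x := FiberBundle.mem_baseSet_trivializationAt' x

theorem isOpen_dom (x₀ : M) : IsOpen (dom δ x₀) := (trivializationAt ℂ δ x₀).open_baseSet

variable [∀ x, AddCommGroup (δ x)] [∀ x, Module ℂ (δ x)] [VectorBundle ℂ ℂ δ]

theorem coord_frame {x₀ x : M} (hx : x ∈ dom δ x₀) : coord δ x₀ x (frame δ x₀ x) = 1 :=
  Trivialization.linearMapAt_symm _ hx 1

theorem coord_smul_frame {x₀ x : M} (hx : x ∈ dom δ x₀) (u : δ x) :
    coord δ x₀ x u • frame δ x₀ x = u := by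
  have h := Trivialization.symmₗ_linearMapAt (R := ℂ) (trivializationAt ℂ δ x₀) hx u
  have h1 := (Trivialization.symmₗ ℂ (trivializationAt ℂ δ x₀) x).map_smul (coord δ x₀ x u) 1
  rw [smul_eq_mul, mul_one] at h1
  have h2 : ∀ c, Trivialization.symmₗ ℂ (trivializationAt ℂ δ x₀) x c =
      (trivializationAt ℂ δ x₀).symm x c := fun c =>
    Trivialization.symmₗ_apply (R := ℂ) _ hx c
  rw [h2 1] at h1
  exact h1.symm.trans h

theorem frame_ne_zero {x₀ x : M} (hx : x ∈ dom δ x₀) : frame δ x₀ x ≠ 0 := fun h => by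
  have := coord_frame hx
  rw [h, map_zero] at this
  exact zero_ne_one this

theorem exists_eq_smul {x : M} {u : δ x} (hu : u ≠ 0) (w : δ x) : ∃ c : ℂ, w = c • u := by
  have h0 : coord δ x x u ≠ 0 := fun h => hu (by
    rw [← coord_smul_frame (mem_dom x) u, h, zero_smul])
  refine ⟨coord δ x x w / coord δ x x u, ?_⟩
  calc w = coord δ x x w • frame δ x x := (coord_smul_frame (mem_dom x) w).symm
    _ = (coord δ x x w / coord δ x x u) • coord δ x x u • frame δ x x := by
        rw [smul_smul, div_mul_cancel₀ _ h0]
    _ = _ := by rw [coord_smul_frame (mem_dom x) u]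

/-- An automorphism of a fiber of a line bundle is the multiplication by a scalar. -/
theorem linearEquiv_eq_smul {x : M} (Ψ : δ x ≃ₗ[ℂ] δ x) (w : δ x) :
    Ψ w = coord δ x x (Ψ (frame δ x x)) • w := by
  rw [← coord_smul_frame (mem_dom x) w, map_smul, smul_comm, coord_smul_frame (mem_dom x)]

end LineFrames

/-! ### The forms of a half-form bundle and their wedge products -/

section Ratio

open Set

variable {n : ℕ} {M : Type*} [TopologicalSpace M] [ChartedSpace (Mod n) M]
  [IsManifold (𝓡 (2 * n)) ∞ M] {Ω : SymplecticForm n M}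
  {δ : M → Type*} [TopologicalSpace (TotalSpace ℂ δ)]
  [∀ x, AddCommGroup (δ x)] [∀ x, Module ℂ (δ x)] [∀ x, TopologicalSpace (δ x)]
  [FiberBundle ℂ δ]

variable (n) in
/-- The standard basis of the model space, with the indices of forms of type `(n, n)`. -/
def modBasis : Module.Basis (Fin n ⊕ Fin n) ℝ (Mod n) :=
  (EuclideanSpace.basisFun (Fin (2 * n)) ℝ).toBasis.reindex (topEquiv n).symm

theorem modBasis_apply (i : Fin n ⊕ Fin n) :
    modBasis n i = EuclideanSpace.single (topEquiv n i) 1 := by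
  simp [modBasis]

/-- The basis of coordinate vectors at `x` of the chart at `x₀`. -/
def coordBasis {x₀ x : M} (hx : x ∈ src n x₀) : Module.Basis (Fin n ⊕ Fin n) ℝ (Tan n x) :=
  (modBasis n).map
    { toLinearMap := (coordVecL (n := n) x₀ x).toLinearMap
      invFun := vecCoord (n := n) x₀ x
      left_inv := vecCoord_coordVecL hx
      right_inv := coordVecL_vecCoord hx }

theorem coordBasis_apply {x₀ x : M} (hx : x ∈ src n x₀) (i : Fin n ⊕ Fin n) :
    coordBasis hx i = coordVec x₀ (modBasis n i) x := by
  rw [coordBasis, Module.Basis.map_apply]; rfl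

/-- The basis `modBasis` seen as a basis of the tangent space at `x`. -/
def tanBasis (x : M) : Module.Basis (Fin n ⊕ Fin n) ℝ (Tan n x) := modBasis n

theorem surjective_lin_add (ja jb : ACS Ω) (x : M) :
    Function.Surjective (ja.lin x + jb.lin x) := by
  refine LinearMap.injective_iff_surjective.1 ((injective_iff_map_eq_zero _).2 fun v hv => ?_)
  exact (ja.isCompat x).add_injective (jb.isCompat x) hv

theorem alternatingMap_ext_basis {E G ι : Type*} [AddCommGroup E] [Module ℝ E] [AddCommGroup G]
    [Module ℝ G] [Fintype ι] [DecidableEq ι] (e : Module.Basis ι ℝ E) {f g : E [⋀^ι]→ₗ[ℝ] G}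
    (h : f e = g e) : f = g := by
  ext v
  rw [alternatingMap_apply_eq_det e f, alternatingMap_apply_eq_det e g, h]

namespace HalfFormFamily

variable (F : HalfFormFamily Ω δ)

theorem form_smul_smul (j : ACS Ω) (x : M) (c : ℂ) (u : δ x) :
    F.form j x (c • u) (c • u) = (c * c) • F.form j x u u := by
  rw [form, TensorProduct.smul_tmul_smul, map_smul]; rfl

theorem form_mem (j : ACS Ω) (x : M) (u v : δ x) : F.form j x u v ∈ formN0 n (j.lin x) :=
  (F.φ j x (u ⊗ₜ[ℂ] v)).2

/-- `φ_{j_b}(u²) ∧ conj (φ_{j_a}(u²))`, evaluated on a family of vectors. -/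
def pairing (ja jb : ACS Ω) (x : M) (u : δ x) (b : Fin n ⊕ Fin n → Tan n x) : ℂ :=
  wedge (F.form jb x u u) (conjN (F.form ja x u u)) b

theorem pairing_smul (ja jb : ACS Ω) (x : M) (c : ℂ) (u : δ x) (b : Fin n ⊕ Fin n → Tan n x) :
    F.pairing ja jb x (c • u) b =
      c * c * starRingEnd ℂ (c * c) * F.pairing ja jb x u b := by
  rw [pairing, form_smul_smul, form_smul_smul, conjN_smul, wedge_smul_smul]; rfl

variable {W : Type} [NormedAddCommGroup W] [NormedSpace ℝ W] [FiniteDimensional ℝ W]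

/-- The forms `φ_j(e²)`, `e` being a frame of `δ`, depend smoothly on the parameter and the point
for smooth families with parameter in any finite dimensional space. -/
theorem contMDiffOn_form {U : Set W} (hU : IsOpen U) {p : W → ACS Ω} (hp : IsSmoothFamily U p)
    (x₀ : M) (v : Fin n → Mod n) :
    ContMDiffOn (𝓘(ℝ, W).prod (𝓡 (2 * n))) 𝓘(ℝ, ℂ) ∞
      (fun z : W × M => F.form (p z.1) z.2 (frame δ x₀ z.2) (frame δ x₀ z.2)
        (fun i => coordVec x₀ (v i) z.2)) (U ×ˢ (dom δ x₀ ∩ src n x₀)) := by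
  let e : W ≃L[ℝ] EuclideanSpace ℝ (Fin (Module.finrank ℝ W)) := toEuclidean
  have h := F.smooth _ (e.symm ⁻¹' U) (hU.preimage e.symm.continuous) (fun w => p (e.symm w))
    (hp.comp e.symm.contDiff fun _ h => h) x₀ v
  have h2 := ContMDiffOn.comp (I := 𝓘(ℝ, W).prod (𝓡 (2 * n))) (f := fun z : W × M => (e z.1, z.2))
    (s := U ×ˢ (dom δ x₀ ∩ src n x₀)) h
    ((e.contDiff.contMDiff.comp contMDiff_fst).prodMk contMDiff_snd).contMDiffOn
    fun z hz => ⟨by simpa using hz.1, hz.2⟩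
  refine h2.congr fun z _ => ?_
  have hz : e.symm (e z.1) = z.1 := e.symm_apply_apply z.1
  change _ = F.form (p (e.symm (e z.1))) z.2 (frame δ x₀ z.2) (frame δ x₀ z.2) _
  rw [hz]

theorem contMDiffOn_pairing {U : Set W} (hU : IsOpen U) {pa pb : W → ACS Ω}
    (hpa : IsSmoothFamily U pa) (hpb : IsSmoothFamily U pb) (x₀ : M) :
    ContMDiffOn (𝓘(ℝ, W).prod (𝓡 (2 * n))) 𝓘(ℝ, ℂ) ∞
      (fun z : W × M => F.pairing (pa z.1) (pb z.1) z.2 (frame δ x₀ z.2)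
        (fun i => coordVec x₀ (modBasis n i) z.2)) (U ×ˢ (dom δ x₀ ∩ src n x₀)) := by
  simp only [pairing, wedge_eq_sum]
  refine contMDiffOn_complex_mul contMDiffOn_const (contMDiffOn_finsetSum fun σ _ =>
    contMDiffOn_complex_mul contMDiffOn_const (contMDiffOn_complex_mul
      (F.contMDiffOn_form hU hpb x₀ fun i => modBasis n (σ (Sum.inl i))) ?_))
  exact (Complex.conjCLE.contDiff.contMDiff).comp_contMDiffOn
    (F.contMDiffOn_form hU hpa x₀ fun i => modBasis n (σ (Sum.inr i)))

variable [VectorBundle ℂ ℂ δ]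

theorem exists_eq_smul_form (j : ACS Ω) {x : M} {u : δ x} (hu : u ≠ 0) :
    ∀ γ ∈ formN0 n (j.lin x), ∃ c : ℂ, γ = c • F.form j x u u := by
  have key : ∀ t : δ x ⊗[ℂ] δ x, ∃ c : ℂ, t = c • (u ⊗ₜ[ℂ] u) := fun t => by
    induction t using TensorProduct.induction_on with
    | zero => exact ⟨0, (zero_smul _ _).symm⟩
    | tmul a b =>
      obtain ⟨c, rfl⟩ := exists_eq_smul hu a
      obtain ⟨d, rfl⟩ := exists_eq_smul hu b
      exact ⟨c * d, TensorProduct.smul_tmul_smul _ _ _ _⟩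
    | add a b ha hb =>
      obtain ⟨c, rfl⟩ := ha
      obtain ⟨d, rfl⟩ := hb
      exact ⟨c + d, (add_smul _ _ _).symm⟩
  intro γ hγ
  obtain ⟨c, hc⟩ := key ((F.φ j x).symm ⟨γ, hγ⟩)
  refine ⟨c, ?_⟩
  have h := (F.φ j x).apply_symm_apply ⟨γ, hγ⟩
  rw [hc, map_smul] at h
  exact (congrArg Subtype.val h).symm

theorem pairing_ne_zero (ja jb : ACS Ω) {x : M} {u : δ x} (hu : u ≠ 0)
    (b : Module.Basis (Fin n ⊕ Fin n) ℝ (Tan n x)) : F.pairing ja jb x u b ≠ 0 :=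
  wedge_conjN_ne_zero (ja.sq x) (jb.sq x) (surjective_lin_add ja jb x)
    (F.exists_eq_smul_form ja hu) (F.exists_eq_smul_form jb hu) b

/-- The function `φ_{j_b}(u²) ∧ conj (φ_{j_a}(u²)) / φ_{j_a}(u²) ∧ conj (φ_{j_a}(u²))` on `M`: it is
the ratio of `φ_{j_b}` and `Ψ_{j_a, j_b} ∘ φ_{j_a}`. It depends neither on `u` nor on the basis
used to compute it. -/
def ratio (ja jb : ACS Ω) (x : M) : ℂ :=
  F.pairing ja jb x (frame δ x x) (tanBasis x) / F.pairing ja ja x (frame δ x x) (tanBasis x)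

theorem ratio_eq (ja jb : ACS Ω) {x : M} {u : δ x} (hu : u ≠ 0)
    (b : Module.Basis (Fin n ⊕ Fin n) ℝ (Tan n x)) :
    F.ratio ja jb x = F.pairing ja jb x u b / F.pairing ja ja x u b := by
  obtain ⟨c, rfl⟩ := exists_eq_smul (frame_ne_zero (mem_dom x)) u
  have hc : c ≠ 0 := fun h => hu (by rw [h, zero_smul])
  have hb : ∀ jb, F.pairing ja jb x (frame δ x x) b =
      ((tanBasis x).det b : ℂ) * F.pairing ja jb x (frame δ x x) (tanBasis x) := fun jb => by
    rw [pairing, alternatingMap_apply_eq_det (tanBasis x), Complex.real_smul]; rfl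
  have hd : ((tanBasis x).det b : ℂ) ≠ 0 := by
    exact_mod_cast ((tanBasis x).isUnit_det b).ne_zero
  rw [pairing_smul, pairing_smul, hb, hb, mul_div_mul_left, mul_div_mul_left _ _ hd, ratio]
  exact mul_ne_zero (mul_ne_zero hc hc) ((map_ne_zero _).2 (mul_ne_zero hc hc))

theorem ratio_ne_zero (ja jb : ACS Ω) (x : M) : F.ratio ja jb x ≠ 0 :=
  div_ne_zero (F.pairing_ne_zero _ _ (frame_ne_zero (mem_dom x)) _)
    (F.pairing_ne_zero _ _ (frame_ne_zero (mem_dom x)) _)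

theorem ratio_self (j : ACS Ω) (x : M) : F.ratio j j x = 1 :=
  div_self (F.pairing_ne_zero _ _ (frame_ne_zero (mem_dom x)) _)

/-- The fiberwise multiplication by a function `c` is a half-form bundle morphism exactly when
`c² ratio = 1`. -/
theorem compat_iff_sq_mul_ratio {ja jb : ACS Ω} {x : M} (c : ℂ) :
    (∀ (u v : δ x), ∀ β ∈ formN0 n (ja.lin x),
      wedge (F.form jb x (c • u) (c • v)) (conjN β) = wedge (F.form ja x u v) (conjN β)) ↔
      c ^ 2 * F.ratio ja jb x = 1 := by
  set e := frame δ x x with he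
  have he0 : e ≠ 0 := frame_ne_zero (mem_dom x)
  have hne := F.pairing_ne_zero ja ja he0 (tanBasis x)
  have hr : F.pairing ja jb x e (tanBasis x) = F.ratio ja jb x * F.pairing ja ja x e (tanBasis x) :=
    (div_mul_cancel₀ _ hne).symm
  constructor
  · intro h
    have h1 := congrArg (fun f => f (tanBasis x)) (h e e _ (F.form_mem ja x e e))
    simp only [form_smul_smul] at h1
    rw [← one_smul ℂ (conjN (F.form ja x e e)), wedge_smul_smul, mul_one, one_smul] at h1
    change c * c * F.pairing ja jb x e (tanBasis x) = F.pairing ja ja x e (tanBasis x) at h1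
    rw [hr, ← mul_assoc] at h1
    rw [sq]
    exact mul_right_cancel₀ hne (h1.trans (one_mul _).symm)
  · intro h u v β hβ
    obtain ⟨d, rfl⟩ := F.exists_eq_smul_form ja he0 β hβ
    obtain ⟨a, rfl⟩ := exists_eq_smul he0 u
    obtain ⟨b, rfl⟩ := exists_eq_smul he0 v
    have hf : ∀ (j : ACS Ω) (a b : ℂ), F.form j x (a • e) (b • e) = (a * b) • F.form j x e e :=
      fun j a b => by rw [form, TensorProduct.smul_tmul_smul, map_smul]; rfl
    rw [smul_smul, smul_smul, hf, hf, conjN_smul, wedge_smul_smul, wedge_smul_smul]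
    refine alternatingMap_ext_basis (tanBasis x) ?_
    change c * a * (c * b) * starRingEnd ℂ d * F.pairing ja jb x e (tanBasis x) =
      a * b * starRingEnd ℂ d * F.pairing ja ja x e (tanBasis x)
    rw [hr]
    linear_combination (a * b * starRingEnd ℂ d * F.pairing ja ja x e (tanBasis x)) * h

theorem contMDiffOn_ratio {U : Set W} (hU : IsOpen U) {pa pb : W → ACS Ω}
    (hpa : IsSmoothFamily U pa) (hpb : IsSmoothFamily U pb) :
    ContMDiffOn (𝓘(ℝ, W).prod (𝓡 (2 * n))) 𝓘(ℝ, ℂ) ∞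
      (fun z : W × M => F.ratio (pa z.1) (pb z.1) z.2) (U ×ˢ univ) := by
  intro z₀ hz₀
  have hmem : z₀ ∈ U ×ˢ (dom δ z₀.2 ∩ src n z₀.2) := ⟨hz₀.1, mem_dom _, mem_src _⟩
  have hopen : IsOpen (U ×ˢ (dom δ z₀.2 ∩ src n z₀.2)) :=
    hU.prod ((isOpen_dom _).inter (isOpen_src _))
  have hfun : ∀ z ∈ U ×ˢ (dom δ z₀.2 ∩ src n z₀.2), ∀ ja jb : ACS Ω,
      F.pairing ja jb z.2 (frame δ z₀.2 z.2) (fun i => coordVec z₀.2 (modBasis n i) z.2) ≠ 0 ∧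
      F.ratio ja jb z.2 =
        F.pairing ja jb z.2 (frame δ z₀.2 z.2) (fun i => coordVec z₀.2 (modBasis n i) z.2) /
        F.pairing ja ja z.2 (frame δ z₀.2 z.2) (fun i => coordVec z₀.2 (modBasis n i) z.2) := by
    intro z hz ja jb
    have h1 : (fun i => coordVec z₀.2 (modBasis n i) z.2) = coordBasis hz.2.2 :=
      funext fun i => (coordBasis_apply hz.2.2 i).symm
    rw [h1]
    exact ⟨F.pairing_ne_zero _ _ (frame_ne_zero hz.2.1) _, F.ratio_eq _ _ (frame_ne_zero hz.2.1) _⟩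
  have h := contMDiffOn_complex_div (F.contMDiffOn_pairing hU hpa hpb z₀.2)
    (F.contMDiffOn_pairing hU hpa hpa z₀.2) fun z hz => (hfun z hz _ _).1
  exact ((h.congr fun z hz => (hfun z hz _ _).2).contMDiffAt
    (hopen.mem_nhds hmem)).contMDiffWithinAt

end HalfFormFamily

end Ratio

/-! ### Sections of `L^k ⊗ δ` and their derivatives -/

section Sections

open Set

theorem isOpen_dom_inter {M : Type*} [TopologicalSpace M]
    {L : M → Type*} [TopologicalSpace (TotalSpace ℂ L)] [∀ x, TopologicalSpace (L x)]
    [FiberBundle ℂ L] {δ : M → Type*} [TopologicalSpace (TotalSpace ℂ δ)]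
    [∀ x, TopologicalSpace (δ x)] [FiberBundle ℂ δ] (x₀ : M) : IsOpen (dom L x₀ ∩ dom δ x₀) :=
  (isOpen_dom x₀).inter (isOpen_dom x₀)

variable {n : ℕ} {M : Type*} [TopologicalSpace M] [ChartedSpace (Mod n) M]
  {k : ℕ}
  {L : M → Type*} [TopologicalSpace (TotalSpace ℂ L)] [∀ x, AddCommGroup (L x)]
  [∀ x, Module ℂ (L x)] [∀ x, TopologicalSpace (L x)] [FiberBundle ℂ L] [VectorBundle ℂ ℂ L]
  {δ : M → Type*} [TopologicalSpace (TotalSpace ℂ δ)] [∀ x, AddCommGroup (δ x)]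
  [∀ x, Module ℂ (δ x)] [∀ x, TopologicalSpace (δ x)] [FiberBundle ℂ δ] [VectorBundle ℂ ℂ δ]

variable (k L δ) in
/-- The frame of the fiber of `L^k ⊗ δ` induced by the frames of `L` and `δ`. -/
def fibFrame (x : M) : Fib k L δ x :=
  (PiTensorProduct.tprod ℂ fun _ : Fin k => frame L x x) ⊗ₜ[ℂ] frame δ x x

theorem fibCoord_tmul (x₀ x : M) (f : Fin k → L x) (b : δ x) :
    fibCoord k L δ x₀ x ((PiTensorProduct.tprod ℂ f) ⊗ₜ[ℂ] b) =
      (∏ i, coord L x₀ x (f i)) * coord δ x₀ x b := by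
  simp [fibCoord, tensorFunctional]

/-- The fibers of `L^k ⊗ δ` are one dimensional. -/
theorem fibCoord_smul_fibFrame {x : M} (z : Fib k L δ x) :
    fibCoord k L δ x x z • fibFrame k L δ x = z := by
  have key : ∃ c : ℂ, z = c • fibFrame k L δ x := by
    induction z using TensorProduct.induction_on with
    | zero => exact ⟨0, (zero_smul _ _).symm⟩
    | tmul a b =>
      have ha : ∃ c : ℂ, a = c • PiTensorProduct.tprod ℂ fun _ : Fin k => frame L x x := by
        induction a using PiTensorProduct.induction_on with
        | smul_tprod r f =>
          refine ⟨r * ∏ i, coord L x x (f i), ?_⟩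
          have hf : f = fun i => coord L x x (f i) • frame L x x :=
            funext fun i => (coord_smul_frame (mem_dom x) (f i)).symm
          conv_lhs => rw [hf]
          rw [MultilinearMap.map_smul_univ, smul_smul]
        | add a b ha hb =>
          obtain ⟨c, rfl⟩ := ha
          obtain ⟨d, rfl⟩ := hb
          exact ⟨c + d, (add_smul _ _ _).symm⟩
      obtain ⟨c, rfl⟩ := ha
      obtain ⟨d, rfl⟩ := exists_eq_smul (frame_ne_zero (mem_dom x)) b
      exact ⟨c * d, TensorProduct.smul_tmul_smul _ _ _ _⟩
    | add a b ha hb =>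
      obtain ⟨c, hc⟩ := ha
      obtain ⟨d, hd⟩ := hb
      exact ⟨c + d, by rw [add_smul, ← hc, ← hd]⟩
  obtain ⟨c, rfl⟩ := key
  congr 1
  rw [map_smul, fibFrame, fibCoord_tmul, coord_frame (mem_dom x), coord_frame (mem_dom x)]
  simp

theorem functional_fib {x : M} (l : Fib k L δ x →ₗ[ℂ] ℂ) (z : Fib k L δ x) :
    l z = fibCoord k L δ x x z * l (fibFrame k L δ x) := by
  conv_lhs => rw [← fibCoord_smul_fibFrame z, map_smul, smul_eq_mul]

theorem fibCoord_injective {x : M} {z z' : Fib k L δ x}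
    (h : fibCoord k L δ x x z = fibCoord k L δ x x z') : z = z' := by
  rw [← fibCoord_smul_fibFrame z, h, fibCoord_smul_fibFrame]

theorem hasVecDerivAt_iff {x : M} {f : ℝ → Fib k L δ x} {v : Fib k L δ x} {t : ℝ} :
    HasVecDerivAt f v t ↔
      HasDerivAt (fun s => fibCoord k L δ x x (f s)) (fibCoord k L δ x x v) t := by
  refine ⟨fun h => h _, fun h l => ?_⟩
  rw [show (fun s => l (f s)) = fun s => fibCoord k L δ x x (f s) * l (fibFrame k L δ x) from
    funext fun s => functional_fib l (f s), functional_fib l v]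
  exact h.mul_const _

theorem PSec.ext_toFun {Φ Ψ : PSec n k L δ} (h : ∀ x, Φ.toFun x = Ψ.toFun x) : Φ = Ψ := by
  obtain ⟨f, _⟩ := Φ
  obtain ⟨g, _⟩ := Ψ
  obtain rfl : f = g := funext h
  rfl

variable {W : Type} [NormedAddCommGroup W] [NormedSpace ℝ W]

theorem contMDiffOn_slice {F : Type*} [NormedAddCommGroup F] [NormedSpace ℝ F] {f : W × M → F}
    {V : Set M} (hf : ContMDiffOn (𝓘(ℝ, W).prod (𝓡 (2 * n))) 𝓘(ℝ, F) ∞ f (univ ×ˢ V)) (w : W) :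
    ContMDiffOn (𝓡 (2 * n)) 𝓘(ℝ, F) ∞ (fun x => f (w, x)) V :=
  hf.comp (f := fun x : M => (w, x)) (contMDiff_const.prodMk contMDiff_id).contMDiffOn
    fun _ hx => ⟨mem_univ _, hx⟩

/-- Jointly smooth values are those of a smooth family of smooth sections. -/
theorem exists_secFamily {f : W → ∀ x : M, Fib k L δ x}
    (hf : ∀ x₀ : M, ContMDiffOn (𝓘(ℝ, W).prod (𝓡 (2 * n))) 𝓘(ℝ, ℂ) ∞
      (fun z : W × M => fibCoord k L δ x₀ z.2 (f z.1 z.2)) (univ ×ˢ (dom L x₀ ∩ dom δ x₀))) :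
    ∃ Φ : W → PSec n k L δ, IsSmoothSecFamily univ Φ ∧ ∀ w, (Φ w).toFun = f w :=
  ⟨fun w => ⟨f w, fun x₀ => contMDiffOn_slice (hf x₀) w⟩, hf, fun _ => rfl⟩

theorem IsSmoothSecFamily.contDiff {Φ : W → PSec n k L δ} (hΦ : IsSmoothSecFamily univ Φ) {x : M}
    (l : Fib k L δ x →ₗ[ℂ] ℂ) : ContDiff ℝ ∞ fun w => l ((Φ w).toFun x) := by
  rw [show (fun w => l ((Φ w).toFun x)) = fun w => fibCoord k L δ x x ((Φ w).toFun x) *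
    l (fibFrame k L δ x) from funext fun w => functional_fib l _]
  refine ContDiff.mul (contDiff_iff_contDiffAt.2 fun w => ?_) contDiff_const
  exact contDiffAt_fst_of_contMDiffAt (z₀ := (w, x))
    ((hΦ x (w, x) ⟨mem_univ _, mem_dom x, mem_dom x⟩).contMDiffAt
      ((isOpen_univ.prod (isOpen_dom_inter x)).mem_nhds ⟨mem_univ _, mem_dom x, mem_dom x⟩))

variable [IsManifold (𝓡 (2 * n)) ∞ M]

/-- The partial derivatives of a smooth family of sections are smooth families of sections. -/
theorem IsSmoothSecFamily.exists_deriv {Φ : W → PSec n k L δ} (hΦ : IsSmoothSecFamily univ Φ)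
    (e : W) : ∃ D : W → PSec n k L δ, IsSmoothSecFamily univ D ∧
      ∀ w x (l : Fib k L δ x →ₗ[ℂ] ℂ),
        l ((D w).toFun x) = fderiv ℝ (fun w => l ((Φ w).toFun x)) w e := by
  set f : W → ∀ x : M, Fib k L δ x := fun w x =>
    (fderiv ℝ (fun w => fibCoord k L δ x x ((Φ w).toFun x)) w e) • fibFrame k L δ x with hf
  have hl : ∀ w x (l : Fib k L δ x →ₗ[ℂ] ℂ),
        l (f w x) = fderiv ℝ (fun w => l ((Φ w).toFun x)) w e := fun w x l => by
    simp only [functional_fib l ((Φ _).toFun x)]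
    rw [fderiv_mul_const ((hΦ.contDiff _).differentiable (by simp) w), hf]
    simp [mul_comm]
  obtain ⟨D, hD, hDf⟩ := exists_secFamily (n := n) (f := f) fun x₀ => by
    simp only [hl]
    exact contMDiffOn_fderiv_fst (isOpen_univ.prod (isOpen_dom_inter x₀)) (hΦ x₀) e
  exact ⟨D, hD, fun w x l => by rw [hDf, hl]⟩

end Sections

/-! ### Square roots of families of functions -/

section SquareRoot

open Set

variable {E H : Type} [NormedAddCommGroup E] [NormedSpace ℝ E] [FiniteDimensional ℝ E]
  [TopologicalSpace H]
  {I : ModelWithCorners ℝ E H} [I.Boundaryless]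
  {N : Type*} [TopologicalSpace N] [ChartedSpace H N] [IsManifold I ∞ N]

/-- A smooth family of nowhere vanishing functions, equal to `1` at the time `t₀`, has a smooth
family of inverse square roots equal to `1` at the time `t₀`. -/
theorem exists_inv_sqrt_family {g : ℝ × N → ℂ}
    (hg : ContMDiffOn (𝓘(ℝ, ℝ).prod I) 𝓘(ℝ, ℂ) ∞ g (univ ×ˢ univ)) (h0 : ∀ z, g z ≠ 0) {t₀ : ℝ}
    (h1 : ∀ x, g (t₀, x) = 1) :
    ∃ c : ℝ × N → ℂ, ContMDiff (𝓘(ℝ, ℝ).prod I) 𝓘(ℝ, ℂ) ∞ c ∧ (∀ x, c (t₀, x) = 1) ∧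
      ∀ z, c z ^ 2 * g z = 1 := by
  set h : ℝ × N → ℂ := fun z => fderiv ℝ (fun t => g (t, z.2)) z.1 1 / g z with hh
  have hopen : IsOpen ((univ : Set ℝ) ×ˢ (univ : Set N)) := isOpen_univ.prod isOpen_univ
  have hhs : ContMDiffOn (𝓘(ℝ, ℝ).prod I) 𝓘(ℝ, ℂ) ∞ h (univ ×ˢ univ) :=
    contMDiffOn_complex_div (contMDiffOn_fderiv_fst hopen hg 1) hg fun z _ => h0 z
  set K : ℝ × (ℝ × N) → ℂ := fun z => h ((z.2.1 - t₀) * z.1 + t₀, z.2.2) with hK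
  have hKs : ContMDiffOn (𝓘(ℝ, ℝ).prod (𝓘(ℝ, ℝ).prod I)) 𝓘(ℝ, ℂ) ∞ K (univ ×ˢ univ) := by
    have haff : ContDiff ℝ ∞ fun q : ℝ × ℝ => (q.2 - t₀) * q.1 + t₀ := by fun_prop
    refine hhs.comp (f := fun z : ℝ × (ℝ × N) => ((z.2.1 - t₀) * z.1 + t₀, z.2.2)) ?_
      fun _ _ => ⟨mem_univ _, mem_univ _⟩
    have h2 : ContMDiff (𝓘(ℝ, ℝ).prod (𝓘(ℝ, ℝ).prod I)) 𝓘(ℝ, ℝ × ℝ) ∞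
        fun z : ℝ × (ℝ × N) => (z.1, z.2.1) :=
      contMDiff_fst.prodMk_space (contMDiff_fst.comp contMDiff_snd)
    exact ((haff.contMDiff.comp h2).prodMk (contMDiff_snd.comp contMDiff_snd)).contMDiffOn
  -- `S` is the logarithm of `g`, a primitive of its logarithmic derivative `h`, written as an
  -- integral over a fixed interval
  have hJ := contMDiffOn_intervalIntegral isOpen_univ hKs
  set S : ℝ × N → ℂ := fun z => ((z.1 - t₀ : ℝ) : ℂ) * ∫ τ in (0 : ℝ)..1, K (τ, z) with hS
  have hSs : ContMDiffOn (𝓘(ℝ, ℝ).prod I) 𝓘(ℝ, ℂ) ∞ S univ := by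
    refine contMDiffOn_complex_mul ?_ hJ
    have : ContDiff ℝ ∞ fun t : ℝ => ((t - t₀ : ℝ) : ℂ) :=
      Complex.ofRealCLM.contDiff.comp (contDiff_id.sub contDiff_const)
    exact (this.contMDiff.comp contMDiff_fst).contMDiffOn
  have hS0 : ∀ x, S (t₀, x) = 0 := fun x => by simp [hS]
  have hct : ∀ x, Continuous fun t => h (t, x) := fun x =>
    (hhs.continuousOn.comp_continuous (f := fun t : ℝ => (t, x)) (by fun_prop)
      fun _ => ⟨mem_univ _, mem_univ _⟩)
  have hSi : ∀ t x, S (t, x) = ∫ s in t₀..t, h (s, x) := fun t x => by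
    have := intervalIntegral.smul_integral_comp_mul_add (a := 0) (b := 1)
      (fun s => h (s, x)) (t - t₀) t₀
    simp only [mul_zero, zero_add, mul_one, sub_add_cancel] at this
    rw [← this, Complex.real_smul]
  have hSd : ∀ t x, HasDerivAt (fun t => S (t, x)) (h (t, x)) t := fun t x => by
    simp only [hSi]
    exact ((hct x).integral_hasStrictDerivAt t₀ t).hasDerivAt
  have hgd : ∀ t x, HasDerivAt (fun t => g (t, x)) (h (t, x) * g (t, x)) t := fun t x => by
    have hd := ((contDiffAt_fst_of_contMDiffAt (z₀ := (t, x)) ((hg (t, x) ⟨mem_univ _, mem_univ _⟩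
      ).contMDiffAt (hopen.mem_nhds ⟨mem_univ _, mem_univ _⟩))).differentiableAt
      (by simp)).hasDerivAt
    simp only [hh]
    rw [div_mul_cancel₀ _ (h0 _), fderiv_eq_smul_deriv, one_smul]
    exact hd
  have hconst : ∀ t x, Complex.exp (-S (t, x)) * g (t, x) = 1 := fun t x => by
    have hd : ∀ t, HasDerivAt (fun t => Complex.exp (-S (t, x)) * g (t, x)) 0 t := fun t => by
      have := ((hSd t x).fun_neg.cexp).mul (hgd t x)
      refine this.congr_deriv ?_
      ring
    have h2 := is_const_of_deriv_eq_zero (fun t => (hd t).differentiableAt)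
      (fun t => (hd t).deriv) t t₀
    rw [h2, hS0, h1]
    simp
  refine ⟨fun z => Complex.exp (-(1 / 2) * S z), ?_, fun x => by simp [hS0], fun z => ?_⟩
  · have he : ContDiff ℝ ∞ fun s : ℂ => Complex.exp (-(1 / 2) * s) :=
      (Complex.contDiff_exp (𝕜 := ℝ)).comp (contDiff_const.mul contDiff_id)
    exact he.contMDiff.comp (contMDiffOn_univ.1 hSs)
  · rw [← Complex.exp_nat_mul]
    refine Eq.trans ?_ (hconst z.1 z.2)
    congr 2
    push_cast
    ring

end SquareRoot

/-! ### The covariant derivative in a frame -/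

section Covariant

open Set

variable {n : ℕ} {M : Type*} [TopologicalSpace M] [ChartedSpace (Mod n) M]
  [IsManifold (𝓡 (2 * n)) ∞ M] {Ω : SymplecticForm n M}
  {k : ℕ}
  {L : M → Type*} [TopologicalSpace (TotalSpace ℂ L)] [∀ x, AddCommGroup (L x)]
  [∀ x, Module ℂ (L x)] [∀ x, TopologicalSpace (L x)] [FiberBundle ℂ L] [VectorBundle ℂ ℂ L]
  {δ : M → Type*} [TopologicalSpace (TotalSpace ℂ δ)] [∀ x, AddCommGroup (δ x)]
  [∀ x, Module ℂ (δ x)] [∀ x, TopologicalSpace (δ x)] [FiberBundle ℂ δ] [VectorBundle ℂ ℂ δ]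
  (F : HalfFormFamily Ω δ)
  {W : Type} [NormedAddCommGroup W] [NormedSpace ℝ W] [FiniteDimensional ℝ W]

namespace HalfFormFamily

theorem contDiffAt_ratio {U : Set W} (hU : IsOpen U) {pa pb : W → ACS Ω}
    (hpa : IsSmoothFamily U pa) (hpb : IsSmoothFamily U pb) (x : M) {w : W} (hw : w ∈ U) :
    ContDiffAt ℝ ∞ (fun w => F.ratio (pa w) (pb w) x) w :=
  contDiffAt_fst_of_contMDiffAt (z₀ := (w, x))
    ((F.contMDiffOn_ratio hU hpa hpb (w, x) ⟨hw, mem_univ _⟩).contMDiffAt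
      ((hU.prod isOpen_univ).mem_nhds ⟨hw, mem_univ _⟩))

/-- The derivative in the direction `e` of `φ` at `p w`, relative to `φ` and to the identification
`Ψ` of the spaces of forms. -/
def rate (p : W → ACS Ω) (e w : W) (x : M) : ℂ :=
  fderiv ℝ (fun w' => F.ratio (p w) (p w') x) w e

theorem contDiff_ratio_right {p : W → ACS Ω} (hp : IsSmoothFamily univ p) (j : ACS Ω) (x : M) :
    ContDiff ℝ ∞ (fun w => F.ratio j (p w) x) :=
  contDiff_iff_contDiffAt.2 fun w => F.contDiffAt_ratio isOpen_univ (pa := fun _ => j)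
    ((isSmoothFamily_iff isOpen_univ).2 (isSmoothEnd_const j.smooth _)) hp x (mem_univ w)

theorem hasDerivAt_ratio {p : W → ACS Ω} (hp : IsSmoothFamily univ p) {f : ℝ → W} {e : W} {t : ℝ}
    (hf : HasDerivAt f e t) (x : M) :
    HasDerivAt (fun t' => F.ratio (p (f t)) (p (f t')) x) (F.rate p e (f t) x) t :=
  ((F.contDiff_ratio_right hp (p (f t)) x).differentiable (by simp) (f t)
    ).hasFDerivAt.comp_hasDerivAt t hf

/-- The rate is jointly smooth, being a partial derivative of the ratio as a function of two
independent parameters, restricted to the diagonal. -/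
theorem contMDiffOn_rate {p : W → ACS Ω} (hp : IsSmoothFamily univ p) (e : W) :
    ContMDiffOn (𝓘(ℝ, W).prod (𝓡 (2 * n))) 𝓘(ℝ, ℂ) ∞
      (fun z : W × M => F.rate p e z.1 z.2) (univ ×ˢ univ) := by
  have h1 := F.contMDiffOn_ratio (W := W × W) isOpen_univ (pa := fun q => p q.1)
    (pb := fun q => p q.2) (hp.comp contDiff_fst (mapsTo_univ _ _))
    (hp.comp contDiff_snd (mapsTo_univ _ _))
  have h2 := contMDiffOn_fderiv_fst (isOpen_univ.prod isOpen_univ) h1 ((0, e) : W × W)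
  have h3 := h2.comp (f := fun z : W × M => ((z.1, z.1), z.2)) (s := univ ×ˢ univ)
    ((contMDiff_fst.prodMk_space contMDiff_fst).prodMk contMDiff_snd).contMDiffOn
    fun _ _ => ⟨mem_univ _, mem_univ _⟩
  refine h3.congr fun z _ => ?_
  have hd : DifferentiableAt ℝ (fun q : W × W => F.ratio (p q.1) (p q.2) z.2) (z.1, z.1) :=
    (F.contDiffAt_ratio isOpen_univ (pa := fun q : W × W => p q.1)
      (pb := fun q => p q.2) (hp.comp contDiff_fst (mapsTo_univ _ _))
      (hp.comp contDiff_snd (mapsTo_univ _ _)) z.2 (mem_univ _)).differentiableAt (by simp)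
  have hc := hd.hasFDerivAt.comp (f := fun w : W => (z.1, w)) z.1
    ((hasFDerivAt_const z.1 z.1).prodMk (hasFDerivAt_id z.1))
  exact DFunLike.congr_fun hc.fderiv e

end HalfFormFamily

/-- The scalars `c_t` such that the multiplications by `c_t` form the continuous family of half-form
morphisms starting from the identity. -/
theorem exists_morphism_scalar {γ : ℝ → ACS Ω} (hγ : IsSmoothFamily univ γ) (t₀ : ℝ) :
    ∃ c : ℝ × M → ℂ, ContMDiff (𝓘(ℝ, ℝ).prod (𝓡 (2 * n))) 𝓘(ℝ, ℂ) ∞ c ∧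
      (∀ x, c (t₀, x) = 1) ∧ ∀ z, c z ^ 2 * F.ratio (γ t₀) (γ z.1) z.2 = 1 :=
  exists_inv_sqrt_family (F.contMDiffOn_ratio isOpen_univ (pa := fun _ => γ t₀)
    ((isSmoothFamily_iff isOpen_univ).2 (isSmoothEnd_const (γ t₀).smooth _)) hγ)
    (fun _ => F.ratio_ne_zero _ _ _) fun _ => F.ratio_self _ _

theorem isMorphismFamily_smul {γ : ℝ → ACS Ω} {t₀ : ℝ} {c : ℝ × M → ℂ}
    (hc : ContMDiff (𝓘(ℝ, ℝ).prod (𝓡 (2 * n))) 𝓘(ℝ, ℂ) ∞ c) (h0 : ∀ z, c z ≠ 0)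
    (h1 : ∀ x, c (t₀, x) = 1) (h : ∀ z, c z ^ 2 * F.ratio (γ t₀) (γ z.1) z.2 = 1) :
    F.IsMorphismFamily γ t₀ fun t x => LinearEquiv.smulOfNeZero ℂ (δ x) (c (t, x)) (h0 (t, x)) where
  morphism t :=
    { smooth := fun x₀ => (contMDiffOn_slice (V := dom δ x₀) (hc.contMDiffOn) t).congr
        fun x hx => by
          rw [LinearEquiv.smulOfNeZero_apply, map_smul, coord_frame hx, smul_eq_mul, mul_one]
      compat := fun x => (F.compat_iff_sq_mul_ratio (c (t, x))).2 (h (t, x)) }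
  continuous x₀ := hc.continuous.continuousOn.congr fun z hz => by
    rw [LinearEquiv.smulOfNeZero_apply, map_smul, coord_frame hz.2, smul_eq_mul, mul_one]
  initial x u := by rw [LinearEquiv.smulOfNeZero_apply, h1, one_smul]

/-- The family of half-form morphisms starting from the identity is unique: two such families
differ by a continuous family of square roots of `1`. -/
theorem HalfFormFamily.IsMorphismFamily.eq_smul {γ : ℝ → ACS Ω} {t₀ : ℝ}
    {Ψ : ℝ → ∀ x : M, δ x ≃ₗ[ℂ] δ x} (hΨ : F.IsMorphismFamily γ t₀ Ψ) {c : ℝ × M → ℂ}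
    (hc : Continuous c) (h1 : ∀ x, c (t₀, x) = 1)
    (h : ∀ z, c z ^ 2 * F.ratio (γ t₀) (γ z.1) z.2 = 1) (t : ℝ) (x : M) (u : δ x) :
    Ψ t x u = c (t, x) • u := by
  set d : ℝ → ℂ := fun t => coord δ x x (Ψ t x (frame δ x x)) with hd
  have hΨd : ∀ t u, Ψ t x u = d t • u := fun t u => linearEquiv_eq_smul (Ψ t x) u
  have hdc : Continuous d :=
    (hΨ.continuous x).comp_continuous (f := fun t : ℝ => (t, x)) (by fun_prop)
      fun _ => ⟨mem_univ _, mem_dom x⟩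
  have hd2 : ∀ t, d t ^ 2 * F.ratio (γ t₀) (γ t) x = 1 := fun t => by
    refine (F.compat_iff_sq_mul_ratio (d t)).1 fun u v β hβ => ?_
    rw [← hΨd, ← hΨd]
    exact (hΨ.morphism t).compat x u v β hβ
  have hd1 : d t₀ = 1 := by
    rw [hd]; simp only [hΨ.initial]; exact coord_frame (mem_dom x)
  have heq := IsPreconnected.eq_of_sq_eq (S := univ) (f := d) (g := fun t => c (t, x))
    isPreconnected_univ hdc.continuousOn
    (hc.comp (Continuous.prodMk continuous_id continuous_const)).continuousOn
    (fun t _ => mul_right_cancel₀ (F.ratio_ne_zero (γ t₀) (γ t) x) ((hd2 t).trans (h (t, x)).symm))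
    (fun {t} _ h0 => by have := h (t, x); rw [h0] at this; simp at this)
    (mem_univ t₀) (by rw [hd1, h1])
  rw [hΨd, heq (mem_univ t)]

/-- In the frames of `L` and `δ` at `x`, the covariant derivative is `d/dt + a / 2` where `a` is
the derivative of the ratio of the half-form structures. -/
theorem isCovDerivAlong_iff {γ : ℝ → ACS Ω} (hγ : IsSmoothFamily univ γ) {Φ : ℝ → PSec n k L δ}
    {t₀ : ℝ} {v : PSec n k L δ} {a : M → ℂ}
    (ha : ∀ x, HasDerivAt (fun t => F.ratio (γ t₀) (γ t) x) (a x) t₀) :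
    IsCovDerivAlong F γ Φ t₀ v ↔ ∀ x, HasDerivAt (fun t => fibCoord k L δ x x ((Φ t).toFun x))
      (fibCoord k L δ x x (v.toFun x) - 1 / 2 * a x * fibCoord k L δ x x ((Φ t₀).toFun x)) t₀ := by
  obtain ⟨c, hc, hc1, hc2⟩ := exists_morphism_scalar F hγ t₀
  have hc0 : ∀ z, c z ≠ 0 := fun z h => by have := hc2 z; rw [h] at this; simp at this
  have hcd : ∀ x, HasDerivAt (fun t => c (t, x)) (-(1 / 2) * a x) t₀ := fun x => by
    have hd := ((contDiffAt_fst_of_contMDiffAt (z₀ := (t₀, x))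
      (hc (t₀, x))).differentiableAt (by simp)).hasDerivAt
    have h2 := (hd.fun_pow 2).mul (ha x)
    have h3 : ((fun t => c (t, x) ^ 2) * fun t => F.ratio (γ t₀) (γ t) x) = fun _ => 1 :=
      funext fun t => hc2 (t, x)
    rw [h3] at h2
    have h4 := h2.unique (hasDerivAt_const t₀ (1 : ℂ))
    simp only [hc1, F.ratio_self] at h4
    refine hd.congr_deriv ?_
    norm_num at h4
    linear_combination (1 / 2) * h4
  have key : ∀ x, HasDerivAt (fun t => (c (t, x))⁻¹ * fibCoord k L δ x x ((Φ t).toFun x))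
      (fibCoord k L δ x x (v.toFun x)) t₀ ↔
      HasDerivAt (fun t => fibCoord k L δ x x ((Φ t).toFun x))
      (fibCoord k L δ x x (v.toFun x) - 1 / 2 * a x * fibCoord k L δ x x ((Φ t₀).toFun x)) t₀ := by
    intro x
    constructor
    · intro h
      have h2 := (hcd x).mul h
      have h3 : ((fun t => c (t, x)) * fun t => (c (t, x))⁻¹ * fibCoord k L δ x x ((Φ t).toFun x)) =
          fun t => fibCoord k L δ x x ((Φ t).toFun x) :=
        funext fun t => mul_inv_cancel_left₀ (hc0 _) _
      rw [h3] at h2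
      refine h2.congr_deriv ?_
      rw [hc1]
      ring
    · intro h
      refine (((hcd x).fun_inv (hc0 _)).mul h).congr_deriv ?_
      rw [hc1]
      ring
  have hl : ∀ (Ψ : ℝ → ∀ x : M, δ x ≃ₗ[ℂ] δ x), (∀ t x u, Ψ t x u = c (t, x) • u) → ∀ t x,
      fibCoord k L δ x x (LinearMap.lTensor (⨂[ℂ]^k (L x)) ((Ψ t x).symm : δ x →ₗ[ℂ] δ x)
        ((Φ t).toFun x)) = (c (t, x))⁻¹ * fibCoord k L δ x x ((Φ t).toFun x) := by
    intro Ψ hΨ t x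
    have h1 : ((Ψ t x).symm : δ x →ₗ[ℂ] δ x) = (c (t, x))⁻¹ • LinearMap.id := by
      ext u
      change (Ψ t x).symm u = (c (t, x))⁻¹ • u
      rw [LinearEquiv.symm_apply_eq, hΨ, smul_inv_smul₀ (hc0 _)]
    rw [h1, LinearMap.lTensor_smul, LinearMap.lTensor_id, LinearMap.smul_apply, map_smul]
    rfl
  constructor
  · rintro ⟨Ψ, hΨ, hv⟩ x
    have h1 := hasVecDerivAt_iff.1 (hv x)
    simp only [hl Ψ (hΨ.eq_smul F hc.continuous hc1 hc2)] at h1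
    exact (key x).1 h1
  · intro h
    refine ⟨_, isMorphismFamily_smul F hc hc0 hc1 hc2, fun x => hasVecDerivAt_iff.2 ?_⟩
    have h2 : ∀ t, fibCoord k L δ x x (LinearMap.lTensor (⨂[ℂ]^k (L x))
        ((LinearEquiv.smulOfNeZero ℂ (δ x) (c (t, x)) (hc0 (t, x))).symm : δ x →ₗ[ℂ] δ x)
        ((Φ t).toFun x)) = (c (t, x))⁻¹ * fibCoord k L δ x x ((Φ t).toFun x) := fun t =>
      hl (fun t x => LinearEquiv.smulOfNeZero ℂ (δ x) (c (t, x)) (hc0 (t, x)))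
        (fun t x u => LinearEquiv.smulOfNeZero_apply _ _ _ _ u) t x
    simp only [h2]
    exact (key x).2 (h x)

/-- The covariant derivatives of a smooth family of sections, along a smooth family of complex
structures, in a direction `e` of the space of parameters, form a smooth family. -/
theorem exists_covDeriv_family {p : W → ACS Ω} (hp : IsSmoothFamily univ p)
    {Φ : W → PSec n k L δ} (hΦ : IsSmoothSecFamily univ Φ) (e : W) :
    ∃ D : W → PSec n k L δ, IsSmoothSecFamily univ D ∧
      (∀ w x, fibCoord k L δ x x ((D w).toFun x) =
        fderiv ℝ (fun w => fibCoord k L δ x x ((Φ w).toFun x)) w e +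
          1 / 2 * F.rate p e w x * fibCoord k L δ x x ((Φ w).toFun x)) ∧
      ∀ (f : ℝ → W), ContDiff ℝ ∞ f → ∀ t, HasDerivAt f e t →
        IsCovDerivAlong F (fun t => p (f t)) (fun t => Φ (f t)) t (D (f t)) := by
  obtain ⟨D₀, hD₀, hl⟩ := hΦ.exists_deriv e
  obtain ⟨D, hD, hDf⟩ := exists_secFamily (n := n) (k := k) (L := L) (δ := δ)
    (f := fun (w : W) x => (D₀ w).toFun x + (1 / 2 * F.rate p e w x) • (Φ w).toFun x) fun x₀ => by
    simp only [map_add, map_smul, smul_eq_mul]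
    refine (hD₀ x₀).add (contMDiffOn_complex_mul (contMDiffOn_complex_mul contMDiffOn_const ?_)
      (hΦ x₀))
    exact (F.contMDiffOn_rate hp e).mono (prod_mono subset_rfl (subset_univ _))
  have hDv : ∀ w x, fibCoord k L δ x x ((D w).toFun x) =
        fderiv ℝ (fun w => fibCoord k L δ x x ((Φ w).toFun x)) w e +
          1 / 2 * F.rate p e w x * fibCoord k L δ x x ((Φ w).toFun x) := fun w x => by
    rw [hDf, map_add, map_smul, hl, smul_eq_mul]
  refine ⟨D, hD, hDv, fun f hf t hft => ?_⟩
  refine (isCovDerivAlong_iff F (γ := fun t => p (f t)) (hp.comp hf (mapsTo_univ _ _))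
    (fun x => F.hasDerivAt_ratio hp hft x)).2 fun x => ?_
  rw [hDv, add_sub_cancel_right]
  exact ((hΦ.contDiff _).differentiable (by simp) (f t)).hasFDerivAt.comp_hasDerivAt t hft

/-! ### The connection is well defined -/

theorem IsSmoothSection.comp {Φ : ACS Ω → PSec n k L δ} (hΦ : IsSmoothSection Φ) {U : Set W}
    (hU : IsOpen U) {p : W → ACS Ω} (hp : IsSmoothFamily U p) :
    IsSmoothSecFamily U (fun w => Φ (p w)) := by
  intro x₀
  let e : W ≃L[ℝ] EuclideanSpace ℝ (Fin (Module.finrank ℝ W)) := toEuclidean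
  have h := hΦ _ (e.symm ⁻¹' U) (hU.preimage e.symm.continuous) (fun w => p (e.symm w))
    (hp.comp e.symm.contDiff fun _ h => h) x₀
  have h2 := ContMDiffOn.comp (I := 𝓘(ℝ, W).prod (𝓡 (2 * n))) (f := fun z : W × M => (e z.1, z.2))
    (s := U ×ˢ (dom L x₀ ∩ dom δ x₀)) h
    ((e.contDiff.contMDiff.comp contMDiff_fst).prodMk contMDiff_snd).contMDiffOn
    fun z hz => ⟨by simpa using hz.1, hz.2⟩
  refine h2.congr fun z _ => ?_
  have hz : e.symm (e z.1) = z.1 := e.symm_apply_apply z.1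
  change _ = fibCoord k L δ x₀ z.2 ((Φ (p (e.symm (e z.1)))).toFun z.2)
  rw [hz]

/-- A curve tangent to `η` provides a candidate. In a frame, the covariant derivative is a
combination of the derivatives along the curve of two functions on `𝒥`, a coordinate of `Φ` and a
ratio of half-form structures, and these derivatives depend only on the velocity of the curve. -/
theorem existsUnique_isCovDeriv [CompactSpace M] {Φ : ACS Ω → PSec n k L δ}
    (hΦ : IsSmoothSection Φ) (j : ACS Ω) (η : TangentACS j) :
    ∃! v : PSec n k L δ, IsCovDeriv F Φ η v := by
  obtain ⟨p, hp, hpη, -⟩ := exists_two_parameter_family η η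
  have hγ : IsSmoothFamily univ fun s : ℝ => p (s, 0) :=
    hp.comp (f := fun s : ℝ => (s, (0 : ℝ))) (by fun_prop) (mapsTo_univ _ _)
  obtain ⟨D, hD, -, hDc⟩ := exists_covDeriv_family F hγ (hΦ.comp isOpen_univ hγ) (1 : ℝ)
  have h0 : IsCovDerivAlong F (fun s => p (s, 0)) (fun s => Φ (p (s, 0))) 0 (D 0) :=
    hDc id contDiff_id 0 (hasDerivAt_id 0)
  have ha : ∀ x, HasDerivAt (fun t => F.ratio (p (0, 0)) (p (t, 0)) x)
      (F.rate (fun s => p (s, 0)) 1 0 x) (0 : ℝ) := fun x =>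
    F.hasDerivAt_ratio hγ (f := id) (hasDerivAt_id (0 : ℝ)) x
  have h00 : p (0, 0) = j := hpη.1
  refine ⟨D 0, fun γ hγ' hη => ?_, fun v hv => PSec.ext_toFun fun x => fibCoord_injective ?_⟩
  · have ha' : ∀ x, HasDerivAt (fun t => F.ratio (γ 0) (γ t) x)
        (F.rate (fun s => p (s, 0)) 1 0 x) (0 : ℝ) := fun x => by
      rw [hη.1]
      refine hasDerivAt_of_hasVelocity (f := fun i => F.ratio j i x) (fun U hU h0U q hq => ?_)
        hγ hγ' hpη hη ?_
      · exact (F.contDiffAt_ratio hU (pa := fun _ => j) ((isSmoothFamily_iff hU).2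
          (isSmoothEnd_const j.smooth _)) hq x h0U).differentiableAt (by simp)
      · have := ha x
        rwa [h00] at this
    refine (isCovDerivAlong_iff F hγ' ha').2 fun x => ?_
    refine hasDerivAt_of_hasVelocity (f := fun i => fibCoord k L δ x x ((Φ i).toFun x))
      (fun U hU h0U q hq => ?_) hγ hγ' hpη hη ?_
    · have hx : (((0, 0), x) : (ℝ × ℝ) × M) ∈ U ×ˢ (dom L x ∩ dom δ x) :=
        ⟨h0U, mem_dom x, mem_dom x⟩
      exact (contDiffAt_fst_of_contMDiffAt (z₀ := (((0, 0), x) : (ℝ × ℝ) × M))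
        (((hΦ.comp hU hq) x _ hx).contMDiffAt
          ((hU.prod (isOpen_dom_inter x)).mem_nhds hx))).differentiableAt (by simp)
    · have := (isCovDerivAlong_iff F hγ ha).1 h0 x
      rw [hη.1]
      rwa [h00] at this
  · have h1 := (isCovDerivAlong_iff F hγ ha).1 h0 x
    have h2 := (isCovDerivAlong_iff F hγ ha).1 (hv _ hγ hpη) x
    exact sub_left_inj.1 (h2.unique h1)

end Covariant

/-! ### The curvature -/

section Curvature

open Set

variable {n : ℕ} {M : Type*} [TopologicalSpace M] [ChartedSpace (Mod n) M]
  [IsManifold (𝓡 (2 * n)) ∞ M] {Ω : SymplecticForm n M}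

theorem toMatrix_coordBasis {x₀ x : M} (hx : x ∈ src n x₀) (T : Tan n x →L[ℝ] Tan n x)
    (i l : Fin n ⊕ Fin n) :
    LinearMap.toMatrix (coordBasis hx) (coordBasis hx) T.toLinearMap i l =
      (modBasis n).repr (coordEnd x₀ x T (modBasis n l)) i := by
  rw [LinearMap.toMatrix_apply, coordBasis_apply]
  rfl

/-- A matrix entry in the basis `modBasis`, as a continuous linear form. -/
def entry (i l : Fin n ⊕ Fin n) : (Mod n →L[ℝ] Mod n) →L[ℝ] ℝ :=
  (LinearMap.toContinuousLinearMap ((modBasis n).coord i)).comp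
    (ContinuousLinearMap.apply ℝ (Mod n) (modBasis n l))

theorem HasVelocity.hasDerivAt_toMatrix {γ : ℝ → ACS Ω} {j : ACS Ω} {η : TangentACS j}
    (h : HasVelocity γ η) (hγ : IsSmoothFamily univ γ) {x₀ x : M} (hx : x ∈ src n x₀)
    (i l : Fin n ⊕ Fin n) :
    HasDerivAt (fun t => LinearMap.toMatrix (coordBasis hx) (coordBasis hx) ((γ t).lin x) i l)
      (LinearMap.toMatrix (coordBasis hx) (coordBasis hx) (η.A x).toLinearMap i l) 0 := by
  rw [toMatrix_coordBasis]
  simp only [ACS.lin, toMatrix_coordBasis]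
  exact (entry i l).hasFDerivAt.comp_hasDerivAt 0 (h.hasDerivAt_coordEnd hγ hx)

theorem contDiff_toMatrix_lin {W : Type} [NormedAddCommGroup W] [NormedSpace ℝ W]
    {p : W → ACS Ω} (hp : IsSmoothFamily univ p) {x₀ x : M} (hx : x ∈ src n x₀)
    (i l : Fin n ⊕ Fin n) :
    ContDiff ℝ ∞ fun w =>
      LinearMap.toMatrix (coordBasis hx) (coordBasis hx) ((p w).lin x) i l := by
  simp only [ACS.lin, toMatrix_coordBasis]
  exact (entry i l).contDiff.comp (contDiff_iff_contDiffAt.2 fun w =>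
    ((isSmoothFamily_iff isOpen_univ).1 hp).contDiffAt isOpen_univ (mem_univ w) hx)

variable
  {δ : M → Type*} [TopologicalSpace (TotalSpace ℂ δ)] [∀ x, AddCommGroup (δ x)]
  [∀ x, Module ℂ (δ x)] [∀ x, TopologicalSpace (δ x)] [FiberBundle ℂ δ]
  (F : HalfFormFamily Ω δ)

theorem HalfFormFamily.contDiff_form {W : Type} [NormedAddCommGroup W] [NormedSpace ℝ W]
    [FiniteDimensional ℝ W] {p : W → ACS Ω} (hp : IsSmoothFamily univ p) (x : M)
    (u : Fin n → Tan n x) :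
    ContDiff ℝ ∞ fun w => F.form (p w) x (frame δ x x) (frame δ x x) u := by
  have h := F.contMDiffOn_form isOpen_univ hp x fun i => vecCoord x x (u i)
  refine contDiff_iff_contDiffAt.2 fun w => ?_
  have hx : ((w, x) : W × M) ∈ univ ×ˢ (dom δ x ∩ src n x) := ⟨mem_univ _, mem_dom x, mem_src x⟩
  have h1 := contDiffAt_fst_of_contMDiffAt (z₀ := (w, x)) ((h _ hx).contMDiffAt
    ((isOpen_univ.prod ((isOpen_dom x).inter (isOpen_src x))).mem_nhds hx))
  have hu : (fun i => coordVec x (vecCoord x x (u i)) x) = u :=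
    funext fun i => coordVecL_vecCoord (mem_src x) (u i)
  simpa only [hu] using h1

variable [VectorBundle ℂ ℂ δ]

/-- The curvature of the connection, in terms of the derivatives of the half-form structures. -/
theorem HalfFormFamily.halfTrace_eq {p : ℝ × ℝ → ACS Ω} (hp : IsSmoothFamily univ p)
    {j : ACS Ω} {η μ : TangentACS j} (hη : HasVelocity (fun s => p (s, 0)) η)
    (hμ : HasVelocity (fun t => p (0, t)) μ) (x : M) {d d' : ℂ}
    (hd : HasDerivAt (fun s => F.rate p (0, 1) (s, 0) x) d 0)
    (hd' : HasDerivAt (fun t => F.rate p (1, 0) (0, t) x) d' 0) :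
    (1 / 2) * (d - d') = halfTrace (η.toHom x) (μ.toHom x) := by
  have hx := mem_src (n := n) x
  have he := frame_ne_zero (δ := δ) (mem_dom x)
  have hr : ∀ ja jb : ACS Ω, F.ratio ja jb x =
      wedge (F.form jb x (frame δ x x) (frame δ x x))
        (conjN (F.form ja x (frame δ x x) (frame δ x x))) (coordBasis hx) /
      wedge (F.form ja x (frame δ x x) (frame δ x x))
        (conjN (F.form ja x (frame δ x x) (frame δ x x))) (coordBasis hx) := fun ja jb =>
    F.ratio_eq ja jb he (coordBasis hx)
  refine curvature_of_generators (coordBasis hx) (p := fun w => (p w).lin x)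
    (fun w => (p w).sq x) (fun w w' => surjective_lin_add _ _ x)
    (contDiff_toMatrix_lin hp hx)
    (θ := fun w => F.form (p w) x (frame δ x x) (frame δ x x))
    (fun w => F.exists_eq_smul_form (p w) he) (F.contDiff_form hp x)
    (J := j.lin x) (A := (η.A x).toLinearMap) (B := (μ.A x).toLinearMap)
    (by rw [← hη.1]) (η.anti x) (μ.anti x)
    (hη.hasDerivAt_toMatrix (hp.comp (f := fun s : ℝ => (s, (0 : ℝ))) (by fun_prop)
      (mapsTo_univ _ _)) hx)
    (hμ.hasDerivAt_toMatrix (hp.comp (f := fun t : ℝ => ((0 : ℝ), t)) (by fun_prop)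
      (mapsTo_univ _ _)) hx)
    (as := fun w => F.rate p (1, 0) w x) (at' := fun w => F.rate p (0, 1) w x) ?_ ?_ hd hd'
  · intro s t
    have := F.hasDerivAt_ratio hp (f := fun s' : ℝ => (s', t))
      ((hasDerivAt_id s).prodMk (hasDerivAt_const s t)) x
    simpa only [hr] using this
  · intro s t
    have := F.hasDerivAt_ratio hp (f := fun t' : ℝ => (s, t'))
      ((hasDerivAt_const t s).prodMk (hasDerivAt_id t)) x
    simpa only [hr] using this

variable {k : ℕ}
  {L : M → Type*} [TopologicalSpace (TotalSpace ℂ L)] [∀ x, AddCommGroup (L x)]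
  [∀ x, Module ℂ (L x)] [∀ x, TopologicalSpace (L x)] [FiberBundle ℂ L] [VectorBundle ℂ ℂ L]

/-- In a frame, `∇_s = ∂_s + A / 2` and `∇_t = ∂_t + B / 2`, so that their commutator is the
multiplication by `(∂_s B - ∂_t A) / 2`. -/
theorem isCurvature_halfTrace [CompactSpace M] {j : ACS Ω} (η μ : TangentACS j)
    (Φ₀ : PSec n k L δ) :
    IsCurvature F η μ Φ₀ (fun x => halfTrace (η.toHom x) (μ.toHom x) • Φ₀.toFun x) := by
  refine ⟨exists_two_parameter_family η μ, fun p hp hη hμ Φ hΦ hΦ0 => ?_⟩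
  obtain ⟨Φs, hs, hsv, hsc⟩ := exists_covDeriv_family F hp hΦ ((1, 0) : ℝ × ℝ)
  obtain ⟨Φt, ht, htv, htc⟩ := exists_covDeriv_family F hp hΦ ((0, 1) : ℝ × ℝ)
  obtain ⟨Φst, -, hstv, hstc⟩ := exists_covDeriv_family F hp ht ((1, 0) : ℝ × ℝ)
  obtain ⟨Φts, -, htsv, htsc⟩ := exists_covDeriv_family F hp hs ((0, 1) : ℝ × ℝ)
  have d1 : ∀ s t : ℝ, HasDerivAt (fun a : ℝ => (a, t)) ((1, 0) : ℝ × ℝ) s := fun s t =>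
    (hasDerivAt_id s).prodMk (hasDerivAt_const s t)
  have d2 : ∀ s t : ℝ, HasDerivAt (fun b : ℝ => (s, b)) ((0, 1) : ℝ × ℝ) t := fun s t =>
    (hasDerivAt_const t s).prodMk (hasDerivAt_id t)
  refine ⟨Φs, Φt, hs, ht, fun s t => hsc (fun a => (a, t)) (by fun_prop) s (d1 s t),
    fun s t => htc (fun b => (s, b)) (by fun_prop) t (d2 s t), Φst (0, 0), Φts (0, 0),
    hstc (fun a => (a, 0)) (by fun_prop) 0 (d1 0 0),
    htsc (fun b => (0, b)) (by fun_prop) 0 (d2 0 0), fun x => fibCoord_injective ?_⟩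
  have hrate : ∀ e : ℝ × ℝ, ContDiff ℝ ∞ fun w => F.rate p e w x := fun e =>
    contDiff_iff_contDiffAt.2 fun w => contDiffAt_fst_of_contMDiffAt (z₀ := (w, x))
      ((F.contMDiffOn_rate hp e (w, x) ⟨mem_univ _, mem_univ _⟩).contMDiffAt
        ((isOpen_univ.prod isOpen_univ).mem_nhds ⟨mem_univ _, mem_univ _⟩))
  set A := fun w => F.rate p (1, 0) w x with hA
  set B := fun w => F.rate p (0, 1) w x with hB
  set φ := fun w => fibCoord k L δ x x ((Φ w).toFun x) with hφ
  have hφs : ContDiff ℝ ∞ φ := hΦ.contDiff _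
  have hAs : ContDiff ℝ ∞ A := hrate _
  have hBs : ContDiff ℝ ∞ B := hrate _
  have hR := F.halfTrace_eq hp hη hμ x (hasDerivAt_dFst hBs 0 0) (hasDerivAt_dSnd hAs 0 0)
  have hft : (fun w => fibCoord k L δ x x ((Φt w).toFun x)) =
      fun w => dSnd φ w + 1 / 2 * B w * φ w := funext fun w => htv w x
  have hfs : (fun w => fibCoord k L δ x x ((Φs w).toFun x)) =
      fun w => dFst φ w + 1 / 2 * A w * φ w := funext fun w => hsv w x
  have e1 : fderiv ℝ (fun w => fibCoord k L δ x x ((Φt w).toFun x)) (0, 0) (1, 0) =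
      dFst (dSnd φ) (0, 0) + (1 / 2 * dFst B (0, 0) * φ (0, 0) +
        1 / 2 * B (0, 0) * dFst φ (0, 0)) :=
    (hasDerivAt_dFst (ht.contDiff (fibCoord k L δ x x)) 0 0).unique (by
      have := (hasDerivAt_dFst (contDiff_dSnd hφs) 0 0).add
        (((hasDerivAt_dFst hBs 0 0).const_mul (1 / 2)).mul (hasDerivAt_dFst hφs 0 0))
      refine this.congr_of_eventuallyEq (Filter.Eventually.of_forall fun s => ?_)
      exact congrFun hft (s, 0))
  have e2 : fderiv ℝ (fun w => fibCoord k L δ x x ((Φs w).toFun x)) (0, 0) (0, 1) =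
      dSnd (dFst φ) (0, 0) + (1 / 2 * dSnd A (0, 0) * φ (0, 0) +
        1 / 2 * A (0, 0) * dSnd φ (0, 0)) :=
    (hasDerivAt_dSnd (hs.contDiff (fibCoord k L δ x x)) 0 0).unique (by
      have := (hasDerivAt_dSnd (contDiff_dFst hφs) 0 0).add
        (((hasDerivAt_dSnd hAs 0 0).const_mul (1 / 2)).mul (hasDerivAt_dSnd hφs 0 0))
      refine this.congr_of_eventuallyEq (Filter.Eventually.of_forall fun s => ?_)
      exact congrFun hfs (0, s))
  rw [map_smul, map_sub, hstv, htsv, e1, e2, dFst_dSnd_comm hφs, ← hR, smul_eq_mul,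
    congrFun hft, congrFun hfs, ← hΦ0]
  change _ * φ (0, 0) = _ + 1 / 2 * A (0, 0) * _ - (_ + 1 / 2 * B (0, 0) * _)
  ring

end Curvature

/-! ### The Hermitian structure of `δ_j` -/

section Norm

open Set

variable {n : ℕ}

theorem contDiff_omegaPow (e : Fin (2 * n) → Mod n) :
    ContDiff ℝ ∞ fun B : Mod n →L[ℝ] Mod n →L[ℝ] ℝ => omegaPow n (fun v w => B v w) e := by
  unfold omegaPow
  refine contDiff_const.mul (ContDiff.sum fun σ _ =>
    contDiff_const.mul (contDiff_prod fun i _ => ?_))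
  exact (contDiff_id.clm_apply contDiff_const).clm_apply contDiff_const

variable {M : Type*} [TopologicalSpace M] [ChartedSpace (Mod n) M]
  [IsManifold (𝓡 (2 * n)) ∞ M] (Ω : SymplecticForm n M)

/-- The symplectic form at a point as a bilinear form. -/
def SymplecticForm.lin (x : M) : Tan n x →ₗ[ℝ] Tan n x →ₗ[ℝ] ℝ :=
  (ContinuousLinearMap.coeLM ℝ) ∘ₗ (Ω.form x).toLinearMap

variable {Ω}

theorem omegaPow_form_ne_zero (j : ACS Ω) (x : M) (e : Module.Basis (Fin (2 * n)) ℝ (Tan n x)) :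
    omegaPow n (fun v w : Tan n x => Ω.form x v w) e ≠ 0 :=
  omegaPow_ne_zero (B := Ω.lin x) (J := j.lin x) (j.sq x) (Ω.alternating x) (j.compatible x)
    (j.positive x) e

theorem coordForm_omegaPow {x₀ x : M} (hx : x ∈ src n x₀) (e : Fin (2 * n) → Mod n) :
    omegaPow n (fun v w => coordForm Ω x₀ x v w) e =
      omegaPow n (fun v w : Tan n x => Ω.form x v w) (fun a => coordVec x₀ (e a) x) := by
  simp only [omegaPow, coordForm_apply Ω hx]

variable
  {δ : M → Type*} [TopologicalSpace (TotalSpace ℂ δ)] [∀ x, AddCommGroup (δ x)]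
  [∀ x, Module ℂ (δ x)] [∀ x, TopologicalSpace (δ x)] [FiberBundle ℂ δ]
  (F : HalfFormFamily Ω δ)

namespace HalfFormFamily

/-- The scalar product `(φ_j(u²), φ_j(u²))`, computed on a family of vectors. -/
def formSq (j : ACS Ω) (x : M) (u : δ x) (b : Fin n ⊕ Fin n → Tan n x) : ℂ :=
  Complex.I ^ ((n : ℤ) * (2 - n)) * F.pairing j j x u b /
    (omegaPow n (fun v w : Tan n x => Ω.form x v w) (fun a => b ((topEquiv n).symm a)) : ℂ)

theorem formSq_eq_of_basis (j : ACS Ω) (x : M) (u : δ x)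
    (b b' : Module.Basis (Fin n ⊕ Fin n) ℝ (Tan n x)) :
    F.formSq j x u b' = F.formSq j x u b := by
  have h1 : F.pairing j j x u b' = (b.det b' : ℂ) * F.pairing j j x u b := by
    rw [pairing, alternatingMap_apply_eq_det b, Complex.real_smul]; rfl
  have h2 := omegaPow_eq_det (Ω.lin x) (b.reindex (topEquiv n)) (fun a => b' ((topEquiv n).symm a))
  have h3 : (b.reindex (topEquiv n)).det (fun a => b' ((topEquiv n).symm a)) = b.det b' := by
    rw [Module.Basis.det_reindex]
    congr 1
    funext i
    simp
  have h4 : (b.det b' : ℂ) ≠ 0 := by exact_mod_cast (b.isUnit_det b').ne_zero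
  rw [h3, show ⇑(b.reindex (topEquiv n)) = fun a => b ((topEquiv n).symm a) from
    funext fun a => b.reindex_apply _ _] at h2
  have h2' : omegaPow n (fun v w : Tan n x => Ω.form x v w) (fun a => b' ((topEquiv n).symm a)) =
    b.det b' * omegaPow n (fun v w : Tan n x => Ω.form x v w) (fun a => b ((topEquiv n).symm a)) :=
    h2
  rw [formSq, formSq, h1, h2', Complex.ofReal_mul, mul_left_comm, mul_div_mul_left _ _ h4]

theorem normSq_eq (j : ACS Ω) (x : M) (u : δ x) (b : Module.Basis (Fin n ⊕ Fin n) ℝ (Tan n x)) :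
    F.normSq j x u = Real.sqrt (F.formSq j x u b).re := by
  rw [F.formSq_eq_of_basis j x u (tanBasis x) b]
  have h : ∀ a, (tanBasis (n := n) x) ((topEquiv n).symm a) =
      (EuclideanSpace.single a (1 : ℝ) : Mod n) := fun a => by
    have := modBasis_apply ((topEquiv n).symm a)
    rw [Equiv.apply_symm_apply] at this
    exact this
  have h' : ∀ i, (tanBasis (n := n) x) i =
      (EuclideanSpace.single (topEquiv n i) (1 : ℝ) : Mod n) := modBasis_apply
  have e1 : (fun a => (tanBasis (n := n) x) ((topEquiv n).symm a)) =
      fun a => (EuclideanSpace.single a (1 : ℝ) : Mod n) := funext h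
  have e2 : ⇑(tanBasis (n := n) x) =
      fun i => (EuclideanSpace.single (topEquiv n i) (1 : ℝ) : Mod n) := funext h'
  rw [formSq, e1, pairing, e2]
  rfl

theorem normSq_smul (j : ACS Ω) (x : M) (c : ℂ) (u : δ x) :
    F.normSq j x (c • u) = Complex.normSq c * F.normSq j x u := by
  have h : F.formSq j x (c • u) (tanBasis x) =
      ((Complex.normSq c * Complex.normSq c : ℝ) : ℂ) * F.formSq j x u (tanBasis x) := by
    rw [formSq, formSq, pairing_smul, Complex.ofReal_mul, Complex.normSq_eq_conj_mul_self, map_mul]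
    ring
  rw [F.normSq_eq j x _ (tanBasis x), F.normSq_eq j x _ (tanBasis x), h, Complex.re_ofReal_mul,
    Real.sqrt_mul (mul_self_nonneg _), Real.sqrt_mul_self (Complex.normSq_nonneg c)]

theorem pairing_swap (ja jb : ACS Ω) (x : M) (u : δ x) (b : Fin n ⊕ Fin n → Tan n x) :
    F.pairing ja jb x u b = (-1) ^ n * starRingEnd ℂ (F.pairing jb ja x u b) :=
  wedge_conjN_swap _ _ _

/-- The scalar `i^{n(2-n)}` makes `α ∧ conj α` real. -/
theorem conj_formSq (j : ACS Ω) (x : M) (u : δ x) (b : Fin n ⊕ Fin n → Tan n x) :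
    starRingEnd ℂ (F.formSq j x u b) = F.formSq j x u b := by
  have h1 : starRingEnd ℂ (F.pairing j j x u b) = (-1) ^ n * F.pairing j j x u b := by
    have := congrArg (starRingEnd ℂ) (F.pairing_swap j j x u b)
    simpa using this
  have h2 : starRingEnd ℂ (Complex.I ^ ((n : ℤ) * (2 - n))) * (-1) ^ n =
      Complex.I ^ ((n : ℤ) * (2 - n)) := by
    have h3 : (Complex.I ^ ((n : ℤ) * (2 - n))) * Complex.I ^ ((n : ℤ) * (2 - n)) = (-1) ^ n := by
      rw [← mul_zpow, Complex.I_mul_I]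
      rcases Nat.even_or_odd n with h | h
      · rw [h.neg_one_pow, Even.neg_one_zpow (((Int.even_coe_nat n).2 h).mul_right _)]
      · rw [h.neg_one_pow, Odd.neg_one_zpow]
        have hn : Odd (n : ℤ) := (Int.odd_coe_nat n).2 h
        exact hn.mul (even_two.sub_odd hn)
    rw [← h3, map_zpow₀, Complex.conj_I, ← Complex.inv_I, inv_zpow,
      inv_mul_cancel_left₀ (zpow_ne_zero _ Complex.I_ne_zero)]
  rw [formSq, map_div₀, map_mul, h1, Complex.conj_ofReal]
  congr 1
  rw [← mul_assoc, h2]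

variable {W : Type} [NormedAddCommGroup W] [NormedSpace ℝ W] [FiniteDimensional ℝ W]

theorem contMDiffOn_formSq {p : W → ACS Ω} (hp : IsSmoothFamily univ p) (x₀ : M) :
    ContMDiffOn (𝓘(ℝ, W).prod (𝓡 (2 * n))) 𝓘(ℝ, ℂ) ∞
      (fun z : W × M => F.formSq (p z.1) z.2 (frame δ x₀ z.2)
        (fun i => coordVec x₀ (modBasis n i) z.2)) (univ ×ˢ (dom δ x₀ ∩ src n x₀)) := by
  have h0 : ContMDiffOn (𝓘(ℝ, W).prod (𝓡 (2 * n))) 𝓘(ℝ, Mod n →L[ℝ] Mod n →L[ℝ] ℝ) ∞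
      (fun z : W × M => coordForm Ω x₀ z.2) (univ ×ˢ (dom δ x₀ ∩ src n x₀)) :=
    (contMDiffOn_coordForm Ω x₀).comp contMDiffOn_snd fun z hz => hz.2.2
  have h2 : ContMDiffOn (𝓘(ℝ, W).prod (𝓡 (2 * n))) 𝓘(ℝ, ℂ) ∞
      (fun z : W × M => ((omegaPow n (fun v w => coordForm Ω x₀ z.2 v w)
        (fun a => modBasis n ((topEquiv n).symm a)) : ℝ) : ℂ)) (univ ×ˢ (dom δ x₀ ∩ src n x₀)) :=
    ((Complex.ofRealCLM.contDiff.comp (contDiff_omegaPow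
      fun a => modBasis n ((topEquiv n).symm a))).contMDiff).comp_contMDiffOn h0
  have h3 : ∀ z ∈ (univ : Set W) ×ˢ (dom δ x₀ ∩ src n x₀),
      ((omegaPow n (fun v w => coordForm Ω x₀ z.2 v w)
        (fun a => modBasis n ((topEquiv n).symm a)) : ℝ) : ℂ) ≠ 0 := fun z hz => by
    rw [coordForm_omegaPow hz.2.2]
    have h4 := omegaPow_form_ne_zero (p z.1) z.2 ((coordBasis hz.2.2).reindex (topEquiv n))
    rw [show ⇑((coordBasis hz.2.2).reindex (topEquiv n)) = fun a =>
        coordVec x₀ (modBasis n ((topEquiv n).symm a)) z.2 from funext fun a => by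
          rw [Module.Basis.reindex_apply, coordBasis_apply]] at h4
    exact Complex.ofReal_ne_zero.2 h4
  refine (contMDiffOn_complex_div (contMDiffOn_complex_mul
    (contMDiffOn_const (c := Complex.I ^ ((n : ℤ) * (2 - n))))
    (F.contMDiffOn_pairing isOpen_univ hp hp x₀)) h2 h3).congr fun z hz => ?_
  rw [coordForm_omegaPow hz.2.2, formSq]

variable [VectorBundle ℂ ℂ δ]

theorem formSq_re_ne_zero (j : ACS Ω) {x : M} {u : δ x} (hu : u ≠ 0)
    (b : Module.Basis (Fin n ⊕ Fin n) ℝ (Tan n x)) : (F.formSq j x u b).re ≠ 0 := by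
  intro h
  have h1 : F.formSq j x u b = 0 :=
    Complex.ext h (Complex.conj_eq_iff_im.1 (F.conj_formSq j x u b))
  have h2 := omegaPow_form_ne_zero j x (b.reindex (topEquiv n))
  rw [show ⇑(b.reindex (topEquiv n)) = fun a => b ((topEquiv n).symm a) from
    funext fun a => b.reindex_apply _ _] at h2
  refine div_ne_zero (mul_ne_zero (zpow_ne_zero _ Complex.I_ne_zero) (F.pairing_ne_zero j j hu b))
    (Complex.ofReal_ne_zero.2 h2) h1

theorem contMDiffOn_normSq {p : W → ACS Ω} (hp : IsSmoothFamily univ p) (x₀ : M) :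
    ContMDiffOn (𝓘(ℝ, W).prod (𝓡 (2 * n))) 𝓘(ℝ, ℝ) ∞
      (fun z : W × M => F.normSq (p z.1) z.2 (frame δ x₀ z.2)) (univ ×ˢ (dom δ x₀ ∩ src n x₀)) := by
  have hre : ContMDiffOn (𝓘(ℝ, W).prod (𝓡 (2 * n))) 𝓘(ℝ, ℝ) ∞
      (fun z : W × M => (F.formSq (p z.1) z.2 (frame δ x₀ z.2)
        (fun i => coordVec x₀ (modBasis n i) z.2)).re) (univ ×ˢ (dom δ x₀ ∩ src n x₀)) :=
    Complex.reCLM.contDiff.contMDiff.comp_contMDiffOn (F.contMDiffOn_formSq hp x₀)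
  have hbasis : ∀ z : W × M, (hz : z ∈ (univ : Set W) ×ˢ (dom δ x₀ ∩ src n x₀)) →
      (fun i => coordVec x₀ (modBasis n i) z.2) = coordBasis hz.2.2 := fun z hz =>
    funext fun i => (coordBasis_apply hz.2.2 i).symm
  have hsq : ContMDiffOn (𝓘(ℝ, W).prod (𝓡 (2 * n))) 𝓘(ℝ, ℝ) ∞
      (fun z : W × M => Real.sqrt (F.formSq (p z.1) z.2 (frame δ x₀ z.2)
        (fun i => coordVec x₀ (modBasis n i) z.2)).re) (univ ×ˢ (dom δ x₀ ∩ src n x₀)) := by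
    intro z hz
    have hne : (F.formSq (p z.1) z.2 (frame δ x₀ z.2)
        (fun i => coordVec x₀ (modBasis n i) z.2)).re ≠ 0 := by
      rw [hbasis z hz]
      exact F.formSq_re_ne_zero _ (frame_ne_zero hz.2.1) _
    exact (Real.contDiffAt_sqrt hne).contMDiffAt.comp_contMDiffWithinAt z (hre z hz)
  refine hsq.congr fun z hz => ?_
  rw [hbasis z hz]
  exact F.normSq_eq _ _ _ _

/-- The derivative of the Hermitian norm of `δ_j` along a curve. -/
theorem hasDerivAt_normSq {γ : ℝ → ACS Ω} (hγ : IsSmoothFamily univ γ) {x : M} {t₀ : ℝ} {a : ℂ}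
    (ha : HasDerivAt (fun t => F.ratio (γ t₀) (γ t) x) a t₀) :
    HasDerivAt (fun t => F.normSq (γ t) x (frame δ x x))
      (a.re * F.normSq (γ t₀) x (frame δ x x)) t₀ := by
  set e := frame δ x x with he
  have he0 : e ≠ 0 := frame_ne_zero (mem_dom x)
  set b := coordBasis (mem_src (n := n) x) with hb
  have hbv : (fun i => coordVec x (modBasis n i) x) = b :=
    funext fun i => (coordBasis_apply (mem_src (n := n) x) i).symm
  have hne := F.pairing_ne_zero (γ t₀) (γ t₀) he0 b
  -- the two partial derivatives of the pairing on the diagonal are conjugate, up to sign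
  have hx : (((t₀, t₀), x) : (ℝ × ℝ) × M) ∈ univ ×ˢ (dom δ x ∩ src n x) :=
    ⟨mem_univ _, mem_dom x, mem_src x⟩
  have hg := (contDiffAt_fst_of_contMDiffAt (z₀ := (((t₀, t₀), x) : (ℝ × ℝ) × M))
    (((F.contMDiffOn_pairing (W := ℝ × ℝ) isOpen_univ (pa := fun q => γ q.1)
      (pb := fun q => γ q.2) (hγ.comp contDiff_fst (mapsTo_univ _ _))
      (hγ.comp contDiff_snd (mapsTo_univ _ _)) x) _ hx).contMDiffAt
      ((isOpen_univ.prod ((isOpen_dom x).inter (isOpen_src x))).mem_nhds hx))).differentiableAt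
      (by simp) |>.hasFDerivAt
  simp only [hbv] at hg
  set G' := fderiv ℝ (fun q : ℝ × ℝ => F.pairing (γ q.1) (γ q.2) x e b) (t₀, t₀)
  have d2 : HasDerivAt (fun t => F.pairing (γ t₀) (γ t) x e b) (G' (0, 1)) t₀ :=
    HasFDerivAt.comp_hasDerivAt (f := fun t : ℝ => (t₀, t)) t₀ hg
      ((hasDerivAt_const t₀ t₀).prodMk (hasDerivAt_id t₀))
  have d1 : HasDerivAt (fun t => F.pairing (γ t) (γ t₀) x e b) (G' (1, 0)) t₀ :=
    HasFDerivAt.comp_hasDerivAt (f := fun t : ℝ => (t, t₀)) t₀ hg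
      ((hasDerivAt_id t₀).prodMk (hasDerivAt_const t₀ t₀))
  have d3 : HasDerivAt (fun t => F.pairing (γ t) (γ t) x e b) (G' (1, 1)) t₀ :=
    HasFDerivAt.comp_hasDerivAt (f := fun t : ℝ => (t, t)) t₀ hg
      ((hasDerivAt_id t₀).prodMk (hasDerivAt_id t₀))
  have v2 : G' (0, 1) = a * F.pairing (γ t₀) (γ t₀) x e b :=
    d2.unique ((ha.mul_const (F.pairing (γ t₀) (γ t₀) x e b)).congr_of_eventuallyEq
      (Filter.Eventually.of_forall fun t => by
        change F.pairing (γ t₀) (γ t) x e b = F.ratio (γ t₀) (γ t) x * _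
        rw [F.ratio_eq (γ t₀) (γ t) he0 b, div_mul_cancel₀ _ hne]))
  have v1 : G' (1, 0) = starRingEnd ℂ a * F.pairing (γ t₀) (γ t₀) x e b := by
    have h1 : HasDerivAt (fun t => F.pairing (γ t) (γ t₀) x e b)
        ((-1) ^ n * starRingEnd ℂ (G' (0, 1))) t₀ :=
      ((Complex.conjCLE.toContinuousLinearMap.hasFDerivAt.comp_hasDerivAt t₀ d2).const_mul
        ((-1) ^ n)).congr_of_eventuallyEq (Filter.Eventually.of_forall fun t =>
          F.pairing_swap (γ t) (γ t₀) x e b)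
    rw [d1.unique h1, v2, map_mul, mul_left_comm, ← F.pairing_swap]
  have v3 : G' (1, 1) = ((2 * a.re : ℝ) : ℂ) * F.pairing (γ t₀) (γ t₀) x e b := by
    have : ((1, 1) : ℝ × ℝ) = (1, 0) + (0, 1) := by simp
    rw [this, map_add, v1, v2, ← add_mul, add_comm, Complex.add_conj]
  have d4 : HasDerivAt (fun t => F.formSq (γ t) x e b)
      (((2 * a.re : ℝ) : ℂ) * F.formSq (γ t₀) x e b) t₀ := by
    refine ((d3.const_mul (Complex.I ^ ((n : ℤ) * (2 - n)))).div_const _).congr_deriv ?_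
    rw [v3, formSq]
    ring
  have d5 := Complex.reCLM.hasFDerivAt.comp_hasDerivAt t₀ d4
  have d6 : HasDerivAt (fun t => (F.formSq (γ t) x e b).re)
      (2 * a.re * (F.formSq (γ t₀) x e b).re) t₀ :=
    d5.congr_deriv (Complex.re_ofReal_mul _ _)
  have d7 := d6.sqrt (F.formSq_re_ne_zero (γ t₀) he0 b)
  simp only [F.normSq_eq _ x e b]
  refine d7.congr_deriv ?_
  -- the sign of the scalar product plays no role: both sides vanish if it is negative, since then
  -- `Real.sqrt` and the quotient by it are zero
  rcases lt_or_ge 0 (F.formSq (γ t₀) x e b).re with h | h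
  · have hs := Real.sqrt_pos.2 h
    rw [div_eq_iff (by positivity)]
    linear_combination (-2 * a.re) * Real.mul_self_sqrt h.le
  · simp [Real.sqrt_eq_zero_of_nonpos h]

end HalfFormFamily

end Norm

/-! ### The Liouville measure is finite -/

section Liouville

open Set MeasureTheory

variable {n : ℕ} {M : Type*} [TopologicalSpace M] [ChartedSpace (Mod n) M]
  [IsManifold (𝓡 (2 * n)) ∞ M]

theorem continuousOn_omegaPow_coordVec (Ω : SymplecticForm n M) (i : M) :
    ContinuousOn (fun x => omegaPow n (fun v w : Tan n x => Ω.form x v w)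
      (fun a => coordVec i (EuclideanSpace.single a 1) x)) (src n i) :=
  ((contDiff_omegaPow fun a => (EuclideanSpace.single a 1 : Mod n)).continuous.comp_continuousOn
    (contMDiffOn_coordForm Ω i).continuousOn).congr fun _ hx => (coordForm_omegaPow hx _).symm

variable [CompactSpace M] [T2Space M]

theorem tsupport_partition_subset (i : M) : tsupport (partition (n := n) (M := M) i) ⊆ src n i :=
  Classical.choose_spec (SmoothPartitionOfUnity.exists_isSubordinate_chartAt_source
    (I := 𝓡 (2 * n)) (M := M)) i

variable [MeasurableSpace M]

/-- Finitely many functions of the partition of unity are nonzero, and the density of each of the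
corresponding measures is bounded and supported in a compact subset of the target of a chart. -/
instance isFiniteMeasure_liouville (Ω : SymplecticForm n M) : IsFiniteMeasure (liouville Ω) := by
  set dens : M → M → ℝ := fun i x => partition (n := n) (M := M) i x *
    (|omegaPow n (fun v w : Tan n x => Ω.form x v w)
      (fun a => coordVec i (EuclideanSpace.single a 1) x)| / (n.factorial : ℝ)) with hdens
  set m : M → Measure (Mod n) := fun i =>
    ((volume : Measure (Mod n)).restrict (extChartAt (𝓡 (2 * n)) i).target).withDensity
      (fun y => ENNReal.ofReal (dens i ((extChartAt (𝓡 (2 * n)) i).symm y))) with hm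
  have hL : liouville Ω = Measure.sum fun i => (m i).map (extChartAt (𝓡 (2 * n)) i).symm := rfl
  have hfin : ∀ i, IsFiniteMeasure (m i) := fun i => by
    have hK : IsCompact (tsupport (partition (n := n) (M := M) i)) :=
      (isClosed_tsupport _).isCompact
    have hc : ContinuousOn (dens i) (src n i) :=
      ((partition (n := n) (M := M) i).2.continuous.continuousOn).mul
        ((continuousOn_omegaPow_coordVec Ω i).abs.div_const _)
    obtain ⟨C, hC⟩ := hK.exists_bound_of_continuousOn (hc.mono (tsupport_partition_subset i))
    set K' := extChartAt (𝓡 (2 * n)) i '' tsupport (partition (n := n) (M := M) i) with hK'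
    have hK'c : IsCompact K' := hK.image_of_continuousOn ((continuousOn_extChartAt i).mono (by
      rw [extChartAt_source]; exact tsupport_partition_subset i))
    refine isFiniteMeasure_withDensity (ne_of_lt ?_)
    have hle : ∀ y ∈ (extChartAt (𝓡 (2 * n)) i).target,
        ENNReal.ofReal (dens i ((extChartAt (𝓡 (2 * n)) i).symm y)) ≤
          K'.indicator (fun _ => ENNReal.ofReal C) y := fun y hy => by
      by_cases hy' : (extChartAt (𝓡 (2 * n)) i).symm y ∈ tsupport (partition (n := n) (M := M) i)
      · have hyK : y ∈ K' := ⟨_, hy', (extChartAt (𝓡 (2 * n)) i).right_inv hy⟩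
        rw [indicator_of_mem hyK]
        exact ENNReal.ofReal_le_ofReal ((le_abs_self _).trans (hC _ hy'))
      · have : dens i ((extChartAt (𝓡 (2 * n)) i).symm y) = 0 := by
          rw [hdens]
          simp only [image_eq_zero_of_notMem_tsupport hy', zero_mul]
        rw [this, ENNReal.ofReal_zero]
        exact zero_le
    calc ∫⁻ y in (extChartAt (𝓡 (2 * n)) i).target,
          ENNReal.ofReal (dens i ((extChartAt (𝓡 (2 * n)) i).symm y))
        ≤ ∫⁻ y in (extChartAt (𝓡 (2 * n)) i).target, K'.indicator (fun _ => ENNReal.ofReal C) y :=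
          setLIntegral_mono' (isOpen_extChartAt_target i).measurableSet hle
      _ ≤ ∫⁻ y, K'.indicator (fun _ => ENNReal.ofReal C) y := setLIntegral_le_lintegral _ _
      _ = ENNReal.ofReal C * volume K' := by
          rw [lintegral_indicator_const hK'c.measurableSet]
      _ < ⊤ := ENNReal.mul_lt_top ENNReal.ofReal_lt_top hK'c.measure_lt_top
  have hz : {i : M | (Function.support (partition (n := n) (M := M) i)).Nonempty}.Finite :=
    (partition (n := n) (M := M)).locallyFinite.finite_nonempty_of_compact
  have h0 : ∀ i, i ∉ hz.toFinset → m i = 0 := fun i hi => by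
    have hp : ∀ x, partition (n := n) (M := M) i x = 0 := fun x => by
      by_contra h
      exact hi (hz.mem_toFinset.2 ⟨x, h⟩)
    simp only [hm, hdens, hp, zero_mul, ENNReal.ofReal_zero]
    exact withDensity_zero
  refine ⟨?_⟩
  rw [hL, Measure.sum_apply _ MeasurableSet.univ, tsum_eq_sum (s := hz.toFinset)
    fun i hi => by rw [h0 i hi, Measure.map_zero]; rfl]
  refine ENNReal.sum_lt_top.2 fun i _ => ?_
  have := hfin i
  exact measure_lt_top _ _

end Liouville

/-! ### Compatibility with the Hermitian structure -/

section Hermitian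

open Set MeasureTheory

variable {n : ℕ} {M : Type*} [TopologicalSpace M] [ChartedSpace (Mod n) M] {k : ℕ}
  {L : M → Type*} [TopologicalSpace (TotalSpace ℂ L)] [∀ x, AddCommGroup (L x)]
  [∀ x, Module ℂ (L x)] [∀ x, TopologicalSpace (L x)] [FiberBundle ℂ L] [VectorBundle ℂ ℂ L]
  {δ : M → Type*} [TopologicalSpace (TotalSpace ℂ δ)] [∀ x, AddCommGroup (δ x)]
  [∀ x, Module ℂ (δ x)] [∀ x, TopologicalSpace (δ x)] [FiberBundle ℂ δ] [VectorBundle ℂ ℂ δ]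

theorem isSmoothSecFamily_const {W : Type} [NormedAddCommGroup W] [NormedSpace ℝ W]
    (v : PSec n k L δ) : IsSmoothSecFamily univ (fun _ : W => v) := fun x₀ =>
  (v.smooth x₀).comp contMDiffOn_snd fun _ hz => hz.2

variable [IsManifold (𝓡 (2 * n)) ∞ M] {Ω : SymplecticForm n M}
  (F : HalfFormFamily Ω δ) (h : HermitianMetric (n := n) L)

theorem fibCoord_eq_mul (x₀ x : M) (z : Fib k L δ x) :
    fibCoord k L δ x₀ x z = fibCoord k L δ x x z *
      (coord L x₀ x (frame L x x) ^ k * coord δ x₀ x (frame δ x x)) := by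
  rw [functional_fib (fibCoord k L δ x₀ x) z, fibFrame, fibCoord_tmul]
  simp

/-- The scalar product of `L^k ⊗ δ_j` may be computed with any local frame. -/
theorem fibInner_eq (j : ACS Ω) {x₀ x : M} (hL : x ∈ dom L x₀) (hδ : x ∈ dom δ x₀)
    (u v : Fib k L δ x) :
    fibInner F h j x u v = fibCoord k L δ x₀ x u * starRingEnd ℂ (fibCoord k L δ x₀ x v) *
      h.inner x (frame L x₀ x) (frame L x₀ x) ^ k * (F.normSq j x (frame δ x₀ x) : ℂ) := by
  have e1 : h.inner x (frame L x x) (frame L x x) = coord L x₀ x (frame L x x) *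
      starRingEnd ℂ (coord L x₀ x (frame L x x)) * h.inner x (frame L x₀ x) (frame L x₀ x) := by
    conv_lhs => rw [← coord_smul_frame hL (frame L x x)]
    rw [(h.inner x).map_smul, LinearMap.smul_apply, LinearMap.map_smulₛₗ, smul_eq_mul, smul_eq_mul,
      mul_assoc]
  have e2 : F.normSq j x (frame δ x x) = Complex.normSq (coord δ x₀ x (frame δ x x)) *
      F.normSq j x (frame δ x₀ x) := by
    conv_lhs => rw [← coord_smul_frame hδ (frame δ x x)]
    rw [F.normSq_smul]
  rw [fibInner, e1, e2, fibCoord_eq_mul x₀ x u, fibCoord_eq_mul x₀ x v, Complex.ofReal_mul,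
    Complex.normSq_eq_conj_mul_self, map_mul, map_mul, map_pow]
  ring

variable {W : Type} [NormedAddCommGroup W] [NormedSpace ℝ W] [FiniteDimensional ℝ W]

theorem contMDiffOn_fibInner {p : W → ACS Ω} (hp : IsSmoothFamily univ p)
    {Φ Φ' : W → PSec n k L δ} (hΦ : IsSmoothSecFamily univ Φ) (hΦ' : IsSmoothSecFamily univ Φ') :
    ContMDiffOn (𝓘(ℝ, W).prod (𝓡 (2 * n))) 𝓘(ℝ, ℂ) ∞
      (fun z : W × M => fibInner F h (p z.1) z.2 ((Φ z.1).toFun z.2) ((Φ' z.1).toFun z.2))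
      (univ ×ˢ univ) := by
  intro z₀ _
  set V : Set M := (dom L z₀.2 ∩ dom δ z₀.2) ∩ src n z₀.2 with hV
  have hVo : IsOpen V := (isOpen_dom_inter _).inter (isOpen_src _)
  have hz₀ : z₀ ∈ (univ : Set W) ×ˢ V := ⟨mem_univ _, ⟨mem_dom _, mem_dom _⟩, mem_src _⟩
  have hsub : (univ : Set W) ×ˢ V ⊆ univ ×ˢ (dom L z₀.2 ∩ dom δ z₀.2) :=
    prod_mono subset_rfl inter_subset_left
  have h1 := (hΦ z₀.2).mono hsub
  have h2 := Complex.conjCLE.contDiff.contMDiff.comp_contMDiffOn ((hΦ' z₀.2).mono hsub)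
  have h3 : ContMDiffOn (𝓘(ℝ, W).prod (𝓡 (2 * n))) 𝓘(ℝ, ℂ) ∞
      (fun z : W × M => h.inner z.2 (frame L z₀.2 z.2) (frame L z₀.2 z.2) ^ k) (univ ×ˢ V) := by
    have h4 : ContMDiffOn (𝓘(ℝ, W).prod (𝓡 (2 * n))) 𝓘(ℝ, ℂ) ∞
        (fun z : W × M => h.inner z.2 (frame L z₀.2 z.2) (frame L z₀.2 z.2)) (univ ×ˢ V) :=
      (h.smooth z₀.2).comp contMDiffOn_snd fun z hz => hz.2.1.1
    exact ((contDiff_id (𝕜 := ℝ) (E := ℂ)).pow k).contMDiff.comp_contMDiffOn h4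
  have h5 : ContMDiffOn (𝓘(ℝ, W).prod (𝓡 (2 * n))) 𝓘(ℝ, ℂ) ∞
      (fun z : W × M => (F.normSq (p z.1) z.2 (frame δ z₀.2 z.2) : ℂ)) (univ ×ˢ V) :=
    Complex.ofRealCLM.contDiff.contMDiff.comp_contMDiffOn ((F.contMDiffOn_normSq hp z₀.2).mono
      fun z hz => ⟨mem_univ _, hz.2.1.2, hz.2.2⟩)
  have h6 := contMDiffOn_complex_mul (contMDiffOn_complex_mul (contMDiffOn_complex_mul h1 h2) h3) h5
  exact ((h6.congr fun z hz => fibInner_eq F h (p z.1) hz.2.1.1 hz.2.1.2 _ _).contMDiffAt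
    ((isOpen_univ.prod hVo).mem_nhds hz₀)).contMDiffWithinAt

theorem continuous_fibInner (j : ACS Ω) (u v : PSec n k L δ) :
    Continuous fun x => fibInner F h j x (u.toFun x) (v.toFun x) := by
  have := contMDiffOn_slice (contMDiffOn_fibInner F h (W := ℝ) (p := fun _ => j)
    ((isSmoothFamily_iff isOpen_univ).2 (isSmoothEnd_const j.smooth _))
    (isSmoothSecFamily_const u) (isSmoothSecFamily_const v)) 0
  exact continuousOn_univ.1 this.continuousOn

/-- The Leibniz rule for the scalar product of `L^k ⊗ δ_j` at a point. -/
theorem hasDerivAt_fibInner {γ : ℝ → ACS Ω} (hγ : IsSmoothFamily univ γ) {Φ Φ' : ℝ → PSec n k L δ}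
    {t₀ : ℝ} {v v' : PSec n k L δ} (hv : IsCovDerivAlong F γ Φ t₀ v)
    (hv' : IsCovDerivAlong F γ Φ' t₀ v') (x : M) :
    HasDerivAt (fun t => fibInner F h (γ t) x ((Φ t).toFun x) ((Φ' t).toFun x))
      (fibInner F h (γ t₀) x (v.toFun x) ((Φ' t₀).toFun x) +
        fibInner F h (γ t₀) x ((Φ t₀).toFun x) (v'.toFun x)) t₀ := by
  have ha : ∀ x, HasDerivAt (fun t => F.ratio (γ t₀) (γ t) x) (F.rate γ 1 t₀ x) t₀ := fun x =>
    F.hasDerivAt_ratio hγ (f := id) (hasDerivAt_id t₀) x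
  have h1 := (isCovDerivAlong_iff F hγ ha).1 hv x
  have h2 : HasDerivAt (fun t => starRingEnd ℂ (fibCoord k L δ x x ((Φ' t).toFun x)))
      (starRingEnd ℂ (fibCoord k L δ x x (v'.toFun x) -
        1 / 2 * F.rate γ 1 t₀ x * fibCoord k L δ x x ((Φ' t₀).toFun x))) t₀ :=
    Complex.conjCLE.toContinuousLinearMap.hasFDerivAt.comp_hasDerivAt t₀
      ((isCovDerivAlong_iff F hγ ha).1 hv' x)
  have h3 : HasDerivAt (fun t => (F.normSq (γ t) x (frame δ x x) : ℂ))
      (((F.rate γ 1 t₀ x).re * F.normSq (γ t₀) x (frame δ x x) : ℝ) : ℂ) t₀ :=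
    Complex.ofRealCLM.hasFDerivAt.comp_hasDerivAt t₀ (F.hasDerivAt_normSq hγ (ha x))
  have h4 := ((h1.fun_mul h2).mul_const (h.inner x (frame L x x) (frame L x x) ^ k)).fun_mul h3
  refine h4.congr_deriv ?_
  simp only [fibInner, Complex.ofReal_mul, Complex.re_eq_add_conj, map_sub, map_mul, map_div₀,
    map_one, map_ofNat]
  ring

variable [CompactSpace M] [MeasurableSpace M] [BorelSpace M]

/-- Differentiation under the integral, for a smooth family of functions on a compact manifold. -/
theorem hasDerivAt_integral_of_contMDiffOn {μ : Measure M} [IsFiniteMeasure μ] {q : ℝ × M → ℂ}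
    (hqs : ContMDiffOn (𝓘(ℝ, ℝ).prod (𝓡 (2 * n))) 𝓘(ℝ, ℂ) ∞ q (univ ×ˢ univ)) {r : M → ℂ}
    (hr : ∀ x, HasDerivAt (fun t => q (t, x)) (r x) 0) :
    HasDerivAt (fun t => ∫ x, q (t, x) ∂μ) (∫ x, r x ∂μ) 0 := by
  have hqc : Continuous q := by
    have := hqs.continuousOn
    rwa [univ_prod_univ, continuousOn_univ] at this
  set q' : ℝ × M → ℂ := fun z => fderiv ℝ (fun t => q (t, z.2)) z.1 1 with hq'
  have hq'c : Continuous q' := by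
    have := (contMDiffOn_fderiv_fst (isOpen_univ.prod isOpen_univ) hqs 1).continuousOn
    rwa [univ_prod_univ, continuousOn_univ] at this
  have hqd : ∀ t x, HasDerivAt (fun t => q (t, x)) (q' (t, x)) t := fun t x => by
    have hd := ((contDiffAt_fst_of_contMDiffAt (z₀ := (t, x)) ((hqs (t, x) ⟨mem_univ _, mem_univ _⟩
      ).contMDiffAt ((isOpen_univ.prod isOpen_univ).mem_nhds ⟨mem_univ _, mem_univ _⟩))
      ).differentiableAt (by simp)).hasDerivAt
    simp only [hq']
    rw [fderiv_eq_smul_deriv, one_smul]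
    exact hd
  obtain ⟨C, hC⟩ := ((isCompact_Icc (a := (-1 : ℝ)) (b := 1)).prod
    (isCompact_univ (X := M))).exists_bound_of_continuousOn hq'c.continuousOn
  have hslice : ∀ (r : ℝ × M → ℂ), Continuous r → ∀ t, Continuous fun x => r (t, x) :=
    fun r hr t => hr.comp (Continuous.prodMk continuous_const continuous_id)
  have hmain := (hasDerivAt_integral_of_dominated_loc_of_deriv_le (μ := μ)
    (F := fun t x => q (t, x)) (F' := fun t x => q' (t, x)) (x₀ := (0 : ℝ)) (s := Icc (-1) 1)
    (bound := fun _ => C) (Icc_mem_nhds (by norm_num) (by norm_num))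
    (Filter.Eventually.of_forall fun t => (hslice q hqc t).aestronglyMeasurable)
    ((hslice q hqc 0).integrable_of_hasCompactSupport (HasCompactSupport.of_compactSpace _))
    (hslice q' hq'c 0).aestronglyMeasurable
    (Filter.Eventually.of_forall fun x t ht => hC (t, x) ⟨ht, mem_univ _⟩) (integrable_const C)
    (Filter.Eventually.of_forall fun x t _ => hqd t x)).2
  have hval : r = fun x => q' (0, x) := funext fun x => (hr x).unique (hqd 0 x)
  rw [hval]
  exact hmain

variable [T2Space M]

/-- The scalar product of two families of sections along a curve of almost complex structures is
differentiable, and its derivative is given by the covariant derivatives of the families. -/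
theorem hasDerivAt_pInner {γ : ℝ → ACS Ω} (hγ : IsSmoothFamily univ γ)
    {Φ Φ' : ℝ → PSec n k L δ} (hΦ : IsSmoothSecFamily univ Φ) (hΦ' : IsSmoothSecFamily univ Φ')
    {v v' : PSec n k L δ} (hv : IsCovDerivAlong F γ Φ 0 v) (hv' : IsCovDerivAlong F γ Φ' 0 v') :
    HasDerivAt (fun t => pInner F h (γ t) (Φ t) (Φ' t))
      (pInner F h (γ 0) v (Φ' 0) + pInner F h (γ 0) (Φ 0) v') 0 := by
  have hint : ∀ u w : PSec n k L δ,
      Integrable (fun x => fibInner F h (γ 0) x (u.toFun x) (w.toFun x)) (liouville Ω) :=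
    fun u w => (continuous_fibInner F h (γ 0) u w).integrable_of_hasCompactSupport
      (HasCompactSupport.of_compactSpace _)
  have hsum : pInner F h (γ 0) v (Φ' 0) + pInner F h (γ 0) (Φ 0) v' =
      ∫ x, (fibInner F h (γ 0) x (v.toFun x) ((Φ' 0).toFun x) +
        fibInner F h (γ 0) x ((Φ 0).toFun x) (v'.toFun x)) ∂(liouville Ω) :=
    (integral_add (hint v (Φ' 0)) (hint (Φ 0) v')).symm
  rw [hsum]
  exact hasDerivAt_integral_of_contMDiffOn (μ := liouville Ω)
    (q := fun z : ℝ × M => fibInner F h (γ z.1) z.2 ((Φ z.1).toFun z.2) ((Φ' z.1).toFun z.2))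
    (contMDiffOn_fibInner F h hγ hΦ hΦ') (hasDerivAt_fibInner F h hγ hv hv')

theorem hasDirDeriv_pInner {Φ Φ' : ACS Ω → PSec n k L δ} (hΦ : IsSmoothSection Φ)
    (hΦ' : IsSmoothSection Φ') {j : ACS Ω} {η : TangentACS j} {v v' : PSec n k L δ}
    (hv : IsCovDeriv F Φ η v) (hv' : IsCovDeriv F Φ' η v') :
    HasDirDeriv (fun i => pInner F h i (Φ i) (Φ' i)) η
      (pInner F h j v (Φ' j) + pInner F h j (Φ j) v') := by
  intro γ hγ hη
  have h3 := hasDerivAt_pInner F h hγ (Φ := fun t => Φ (γ t)) (Φ' := fun t => Φ' (γ t))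
    (hΦ.comp isOpen_univ hγ) (hΦ'.comp isOpen_univ hγ) (hv γ hγ hη) (hv' γ hγ hη)
  simp only [hη.1] at h3
  exact h3

end Hermitian

end HalfForm

end

theorem mainTheorem8 {n : ℕ} {M : Type*} [TopologicalSpace M] [ChartedSpace (HalfForm.Mod n) M]
    [IsManifold (𝓡 (2 * n)) ∞ M] [CompactSpace M] [T2Space M] [MeasurableSpace M] [BorelSpace M]
    (Ω : HalfForm.SymplecticForm n M)
    (L : M → Type*) [TopologicalSpace (TotalSpace ℂ L)] [∀ x, AddCommGroup (L x)]
    [∀ x, Module ℂ (L x)] [∀ x, TopologicalSpace (L x)] [∀ x, IsTopologicalAddGroup (L x)]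
    [∀ x, ContinuousSMul ℝ (L x)] [FiberBundle ℂ L] [VectorBundle ℂ ℂ L] [VectorBundle ℝ ℂ L]
    [ContMDiffVectorBundle ∞ ℂ L (𝓡 (2 * n))]
    (B : HalfForm.Prequantization L Ω)
    (δ : M → Type*) [TopologicalSpace (TotalSpace ℂ δ)] [∀ x, AddCommGroup (δ x)]
    [∀ x, Module ℂ (δ x)] [∀ x, TopologicalSpace (δ x)] [FiberBundle ℂ δ] [VectorBundle ℂ ℂ δ]
    [VectorBundle ℝ ℂ δ] [ContMDiffVectorBundle ∞ ℂ δ (𝓡 (2 * n))]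
    (F : HalfForm.HalfFormFamily Ω δ) (k : ℕ) :
    -- the connection is well-defined
    (∀ Φ : HalfForm.ACS Ω → HalfForm.PSec n k L δ, HalfForm.IsSmoothSection Φ →
      ∀ (j : HalfForm.ACS Ω) (η : HalfForm.TangentACS j),
        ∃! v : HalfForm.PSec n k L δ, HalfForm.IsCovDeriv F Φ η v) ∧
    -- it is compatible with the Hermitian structure
    (∀ Φ Φ' : HalfForm.ACS Ω → HalfForm.PSec n k L δ,
      HalfForm.IsSmoothSection Φ → HalfForm.IsSmoothSection Φ' →
      ∀ (j : HalfForm.ACS Ω) (η : HalfForm.TangentACS j) (v v' : HalfForm.PSec n k L δ),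
        HalfForm.IsCovDeriv F Φ η v → HalfForm.IsCovDeriv F Φ' η v' →
        HalfForm.HasDirDeriv (fun i => HalfForm.pInner F B.metric i (Φ i) (Φ' i)) η
          (HalfForm.pInner F B.metric j v (Φ' j) + HalfForm.pInner F B.metric j (Φ j) v')) ∧
    -- its curvature is the multiplication by `½ tr (η μ̄ - μ η̄)`
    (∀ (j : HalfForm.ACS Ω) (η μ : HalfForm.TangentACS j) (Φ₀ : HalfForm.PSec n k L δ),
      HalfForm.IsCurvature F η μ Φ₀
        (fun x => HalfForm.halfTrace (η.toHom x) (μ.toHom x) • Φ₀.toFun x)) :=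
  ⟨fun _ hΦ _ _ => HalfForm.existsUnique_isCovDeriv F hΦ _ _,
    fun _ _ hΦ hΦ' _ _ _ _ hv hv' => HalfForm.hasDirDeriv_pInner F B.metric hΦ hΦ' hv hv',
    fun _ η μ Φ₀ => HalfForm.isCurvature_halfTrace F η μ Φ₀⟩
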